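/- A partial linear space is a non-empty point set $P$ with a family of proper subsets of $P$ (lines), each containing at least two points, such that every point is on a line and two distinct points are on at most one common line; points are collinear if some line contains them (so a point is collinear to itself). A subspace is a set of points containing the line through any two of its distinct collinear points; it is singular if any two of its points are collinear. A polar space is a partial linear space such that every line has at least three points, no point is collinear to all points, each point is collinear to exactly one or to all points of each line, and every chain of singular subspaces is finite; it has rank $n$ if its maximal singular subspaces have (projective) dimension $n-1$. For $n\ge 2$, a thin polar space of rank $n$ is a partial linear space isomorphic to the one with points $\pm1,\dots,\pm n$ whose lines are all the sets $\{i,j\}$ with $j\ne \pm i$; its singular subspaces $S$ have dimension $|S|-1$. For a polar space or thin polar space $\Pi$ of rank $n$ and $0\le k\le n-1$, let $\mathcal G_k(\Pi)$ be the set of $k$-dimensional singular subspaces, and let $\Gamma_k(\Pi)$ be the graph on $\mathcal G_k(\Pi)$ in which two distinct elements are adjacent if they lie in a common $(k+1)$-dimensional singular subspace (when $k\le n-2$), or if their intersection is $(n-2)$-dimensional (when $k=n-1$). Write $\Gamma_k(n)$ for $\Gamma_k$ of a thin polar space of rank $n$. A frame of $\Pi$ is a set of $2n$ points each of which is non-collinear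 to exactly one point of the set; the apartment of $\mathcal G_k(\Pi)$ associated to a frame consists of all $k$-dimensional singular subspaces spanned by subsets of the frame. Corollary 1. Let $\Pi$ be a polar space or a thin polar space of rank $n$ and let $0\le k\le n-1$. Then the image of every isometric embedding of $\Gamma_k(n)$ in $\Gamma_k(\Pi)$ (an injection of the vertex sets that preserves adjacency, non-adjacency and distance) is an apartment of $\mathcal G_k(\Pi)$. -/

import Mathlib

/-- A partial linear space on the point set `P`: a non-empty set of points together with a family
of proper subsets, called lines, such that every line contains at least two points, every point is
on a line, and two distinct points are on at most one common line. -/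
structure PartialLinearSpace (P : Type*) where
  lines : Set (Set P)
  nonempty : Nonempty P
  ne_univ : ∀ L ∈ lines, L ≠ Set.univ
  two_le : ∀ L ∈ lines, 2 ≤ L.encard
  exists_line : ∀ p : P, ∃ L ∈ lines, p ∈ L
  line_unique : ∀ p q : P, p ≠ q → ∀ L ∈ lines, ∀ M ∈ lines,
    p ∈ L → q ∈ L → p ∈ M → q ∈ M → L = M

namespace PartialLinearSpace

variable {P Q : Type*}

/-- Two points are collinear if some line contains both of them; every point is collinear
to itself. -/
def Collinear (X : PartialLinearSpace P) (p q : P) : Prop :=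
  ∃ L ∈ X.lines, p ∈ L ∧ q ∈ L

/-- A subspace contains the line joining any two of its distinct collinear points. -/
def IsSubspace (X : PartialLinearSpace P) (S : Set P) : Prop :=
  ∀ p ∈ S, ∀ q ∈ S, p ≠ q → ∀ L ∈ X.lines, p ∈ L → q ∈ L → L ⊆ S

/-- A singular subspace is a subspace any two points of which are collinear. -/
def IsSingularSubspace (X : PartialLinearSpace P) (S : Set P) : Prop :=
  X.IsSubspace S ∧ ∀ p ∈ S, ∀ q ∈ S, X.Collinear p q

/-- The singular subspaces, ordered by inclusion. -/
abbrev SingularSubspace (X : PartialLinearSpace P) : Type _ :=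
  {S : Set P // X.IsSingularSubspace S}

/-- The intersection of two singular subspaces. -/
def SingularSubspace.inter {X : PartialLinearSpace P} (S T : X.SingularSubspace) :
    X.SingularSubspace :=
  ⟨S.1 ∩ T.1,
    fun p hp q hq hpq L hL hpL hqL => Set.subset_inter
      (S.2.1 p hp.1 q hq.1 hpq L hL hpL hqL) (T.2.1 p hp.2 q hq.2 hpq L hL hpL hqL),
    fun p hp q hq => S.2.2 p hp.1 q hq.1⟩

/-- The subspace spanned by a set of points: the smallest subspace containing it. -/
def span (X : PartialLinearSpace P) (A : Set P) : Set P :=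
  ⋂₀ {S | X.IsSubspace S ∧ A ⊆ S}

/-- `S` has projective dimension `d`: the longest chains of singular subspaces
`∅ ⊂ S₀ ⊂ S₁ ⊂ ⋯ ⊂ S_d = S` ending in `S` have exactly `d + 1` steps. So the empty subspace has
dimension `-1`, a point has dimension `0`, and a projective space or a simplex has its usual
dimension. -/
def SingularSubspace.HasDim {X : PartialLinearSpace P} (S : X.SingularSubspace) (d : ℤ) : Prop :=
  ∃ h : ℕ, Order.height S = (h : ℕ∞) ∧ (h : ℤ) = d + 1

/-- The axioms of a polar space. -/
structure IsPolarSpace (X : PartialLinearSpace P) : Prop where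
  /-- every line contains at least three points -/
  three_le : ∀ L ∈ X.lines, 3 ≤ L.encard
  /-- no point is collinear to all points -/
  nondegenerate : ¬ ∃ p : P, ∀ q : P, X.Collinear p q
  /-- every point is collinear to exactly one or to all points of every line -/
  one_or_all : ∀ p : P, ∀ L ∈ X.lines,
    (∃! q : P, q ∈ L ∧ X.Collinear p q) ∨ (∀ q ∈ L, X.Collinear p q)
  /-- chains of singular subspaces are finite -/
  finite_chain : ∀ C : Set X.SingularSubspace, IsChain (· ≤ ·) C → C.Finite

/-- The rank is `n`: all maximal singular subspaces have dimension `n - 1`. -/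
def HasRank (X : PartialLinearSpace P) (n : ℕ) : Prop :=
  ∀ M : X.SingularSubspace, IsMax M → M.HasDim ((n : ℤ) - 1)

/-- The antipode `-i` of a point `i` of the standard thin polar space; the pairs
`(i, true)` and `(i, false)` stand for `+i` and `-i`. -/
def antipode {n : ℕ} (i : Fin n × Bool) : Fin n × Bool := (i.1, !i.2)

/-- The standard thin polar space of rank `n ≥ 2`: the points are `±1, …, ±n`, the lines are all
two-element sets `{i, j}` with `j ≠ -i`. -/
def thinPolarSpace (n : ℕ) (hn : 2 ≤ n) : PartialLinearSpace (Fin n × Bool) where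
  lines := {L | ∃ i j, i ≠ j ∧ j ≠ antipode i ∧ L = {i, j}}
  nonempty := ⟨(⟨0, by omega⟩, true)⟩
  ne_univ := by
    rintro L ⟨i, j, hij, hj, rfl⟩ h
    have hi : antipode i ∈ ({i, j} : Set (Fin n × Bool)) := h ▸ Set.mem_univ _
    rcases hi with hi | hi
    · have := congrArg Prod.snd hi
      simp [antipode] at this
    · exact hj hi.symm
  two_le := by
    rintro L ⟨i, j, hij, -, rfl⟩
    rw [Set.encard_pair hij]
  exists_line := by
    intro p
    obtain ⟨q, hq⟩ : ∃ q : Fin n, q ≠ p.1 := by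
      have : Nontrivial (Fin n) := Fin.nontrivial_iff_two_le.mpr hn
      exact exists_ne p.1
    exact ⟨{p, (q, true)}, ⟨p, (q, true), fun h => hq (congrArg Prod.fst h).symm,
      fun h => hq (congrArg Prod.fst h), rfl⟩, Or.inl rfl⟩
  line_unique := by
    have key : ∀ p q i j : Fin n × Bool, p ≠ q → p ∈ ({i, j} : Set (Fin n × Bool)) →
        q ∈ ({i, j} : Set (Fin n × Bool)) → ({i, j} : Set (Fin n × Bool)) = {p, q} := by
      rintro p q i j hpq (rfl | rfl) (rfl | rfl)
      · exact absurd rfl hpq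
      · rfl
      · exact Set.pair_comm _ _
      · exact absurd rfl hpq
    rintro p q hpq L ⟨i, j, -, -, rfl⟩ M ⟨i', j', -, -, rfl⟩ h1 h2 h3 h4
    rw [key p q i j hpq h1 h2, key p q i' j' hpq h3 h4]

/-- Two partial linear spaces are isomorphic if there is a collineation between them: a bijection
of the points that maps the family of lines onto the family of lines. -/
def Isomorphic (X : PartialLinearSpace P) (Y : PartialLinearSpace Q) : Prop :=
  ∃ α : P ≃ Q, (fun L : Set P => α '' L) '' X.lines = Y.lines

/-- A thin polar space of rank `n`: a partial linear space isomorphic to the standard one. -/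
def IsThinPolarSpace (X : PartialLinearSpace P) (n : ℕ) : Prop :=
  ∃ hn : 2 ≤ n, X.Isomorphic (thinPolarSpace n hn)

/-- The polar Grassmannian of all `k`-dimensional singular subspaces. -/
abbrev Grassmannian (X : PartialLinearSpace P) (k : ℕ) : Type _ :=
  {S : X.SingularSubspace // S.HasDim (k : ℤ)}

/-- The polar Grassmann graph on the `k`-dimensional singular subspaces of a (thin) polar space of
rank `n`. For `k ≤ n - 2` two distinct vertices are adjacent if some `(k + 1)`-dimensional singular
subspace contains both; for `k = n - 1` two distinct vertices are adjacent if their intersection is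
`(n - 2)`-dimensional. -/
def grassmannGraph (X : PartialLinearSpace P) (n k : ℕ) : SimpleGraph (X.Grassmannian k) where
  Adj S T := S ≠ T ∧
    ((k + 2 ≤ n ∧ ∃ U : X.SingularSubspace, U.HasDim ((k : ℤ) + 1) ∧ S.1 ≤ U ∧ T.1 ≤ U) ∨
      (k + 1 = n ∧ (S.1.inter T.1).HasDim ((n : ℤ) - 2)))
  symm := ⟨by
    rintro S T ⟨hne, ⟨hk, U, hU, hS, hT⟩ | ⟨hk, h⟩⟩
    · exact ⟨hne.symm, Or.inl ⟨hk, U, hU, hT, hS⟩⟩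
    · refine ⟨hne.symm, Or.inr ⟨hk, ?_⟩⟩
      have : T.1.inter S.1 = S.1.inter T.1 := Subtype.ext (Set.inter_comm _ _)
      rwa [this]⟩
  loopless := ⟨fun _ h => h.1 rfl⟩

/-- A frame of a (thin) polar space of rank `n`: a set of `2n` points each of which is
non-collinear to exactly one point of the set. -/
def IsFrame (X : PartialLinearSpace P) (n : ℕ) (F : Set P) : Prop :=
  F.encard = ((2 * n : ℕ) : ℕ∞) ∧ ∀ p ∈ F, ∃! q : P, q ∈ F ∧ ¬ X.Collinear p q

/-- The apartment of the Grassmannian associated to a frame `F`: all `k`-dimensional singular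
subspaces spanned by subsets of `F`. -/
def apartment (X : PartialLinearSpace P) (k : ℕ) (F : Set P) : Set (X.Grassmannian k) :=
  {S | ∃ A ⊆ F, S.1.1 = X.span A}

/-- `𝒜` is an apartment of the Grassmannian of `k`-dimensional singular subspaces. -/
def IsApartment (X : PartialLinearSpace P) (n k : ℕ) (𝒜 : Set (X.Grassmannian k)) : Prop :=
  ∃ F : Set P, X.IsFrame n F ∧ 𝒜 = X.apartment k F

end PartialLinearSpace

/-- A graph embedding is isometric if it preserves the distance between vertices. -/
def IsIsometricEmbedding {V W : Type*} {G : SimpleGraph V} {H : SimpleGraph W} (f : G ↪g H) :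
    Prop :=
  ∀ x y : V, H.edist (f x) (f y) = G.edist x y

/-! Polar and thin polar spaces are treated together through the one-or-all axiom, non-degeneracy
and bounded rank (`IsPolarLike`). These already make the joins of singular subspaces behave
projectively: joining a collinear outside point to a singular subspace gives the union of the
connecting lines and raises the rank by exactly one (`cone_isSubspace`, `rk_cone`).

Isometry enters only through opposition. Two vertices are opposite, i.e. no point of the second is
collinear to all of the first, exactly when their distance exceeds a threshold depending only on `n`
and `k` (`edist_le_iff`). In the thin space the vertices are the faces with `k + 1` vertices of a
cross-polytope, and the only opposite of S is −S. So the embedding yields subspaces x(S), indexed by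
faces, with prescribed adjacency and opposition (`IsConfiguration`). It suffices to find points p_i,
with p_i and p_j non-collinear exactly for j = −i, such that p_i ∈ x(S) whenever i ∈ S
(`IsFrameMap.isApartment`).

For `k = 0` the points are given. For `k = n - 1` the x(S) form a hypercube: p_i is the single point
common to two vertices at distance n − 1 whose faces share only i
(`exists_isFrameMap_of_hypercube`).

In between, the facets of a face W with `k + 2` vertices give a clique, so their images lie in a
common subspace of rank `k + 2` (top) or contain a common one of rank `k` (star). In a star the
images are independent modulo the common subspace, whence 2k + 2 ≤ n (`le_of_isStar`). If every W is
a top, p_a is the unique point of the top of W collinear to all of x(−(W∖a)), and it does not depend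
on W; for `k = n - 2` the tops themselves form a hypercube.

Suppose some W is a star. Unless some three faces R∪c, R∪d, R∪e map into one subspace of rank `k +
2`, the centre of the star can be moved to −W, against opposition. Such a row forces n = k + 3, and
with 2k + 2 ≤ n only `k = 1`, `n = 4` is left. There the Grassmann graph of the thin space has an
extra symmetry, from the 24 roots of D₄. Composing with it turns the row into a top without changing
the image, and one top makes all W tops (`isTop_of_isTop`). -/

namespace PartialLinearSpace

variable {P Q : Type*}

/-! ### Separation by perps, and cones over singular subspaces -/

/-- The axioms shared by polar spaces and thin polar spaces: the one-or-all axiom and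
non-degeneracy. -/
structure IsShultSpace (X : PartialLinearSpace P) : Prop where
  one_or_all : ∀ p : P, ∀ L ∈ X.lines,
    (∃! q : P, q ∈ L ∧ X.Collinear p q) ∨ (∀ q ∈ L, X.Collinear p q)
  nondegenerate : ∀ p : P, ∃ q : P, ¬ X.Collinear p q

/-- The set of points collinear to all points of `A`. -/
def perp (X : PartialLinearSpace P) (A : Set P) : Set P := {p | ∀ a ∈ A, X.Collinear p a}

/-- Every point of `C` is non-collinear to some point of `C`. -/
def NondegenerateOn (X : PartialLinearSpace P) (C : Set P) : Prop :=
  ∀ w ∈ C, ∃ r ∈ C, ¬ X.Collinear r w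

/-- The points lying on a line through `p` and a point of `A`, together with `p`. -/
def cone (X : PartialLinearSpace P) (p : P) (A : Set P) : Set P :=
  {x | x = p ∨ ∃ a ∈ A, ∃ L ∈ X.lines, p ∈ L ∧ a ∈ L ∧ x ∈ L}

theorem collinear_refl (X : PartialLinearSpace P) (p : P) : X.Collinear p p := by
  obtain ⟨L, hL, hp⟩ := X.exists_line p
  exact ⟨L, hL, hp, hp⟩

theorem Collinear.symm {X : PartialLinearSpace P} {p q : P} (h : X.Collinear p q) :
    X.Collinear q p := by
  obtain ⟨L, hL, hp, hq⟩ := h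
  exact ⟨L, hL, hq, hp⟩

theorem collinear_of_mem_line {X : PartialLinearSpace P} {L : Set P} (hL : L ∈ X.lines) {p q : P}
    (hp : p ∈ L) (hq : q ∈ L) : X.Collinear p q := ⟨L, hL, hp, hq⟩

theorem isSubspace_univ (X : PartialLinearSpace P) : X.IsSubspace Set.univ :=
  fun _ _ _ _ _ _ _ _ _ => Set.subset_univ _

theorem IsSubspace.inter {X : PartialLinearSpace P} {A B : Set P} (hA : X.IsSubspace A)
    (hB : X.IsSubspace B) : X.IsSubspace (A ∩ B) :=
  fun p hp q hq hpq L hL hpL hqL => Set.subset_inter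
    (hA p hp.1 q hq.1 hpq L hL hpL hqL) (hB p hp.2 q hq.2 hpq L hL hpL hqL)

theorem mem_perp {X : PartialLinearSpace P} {A : Set P} {p : P} :
    p ∈ X.perp A ↔ ∀ a ∈ A, X.Collinear p a := Iff.rfl

theorem perp_anti {X : PartialLinearSpace P} {A B : Set P} (h : A ⊆ B) : X.perp B ⊆ X.perp A :=
  fun _ hp a ha => hp a (h ha)

theorem subset_perp_comm {X : PartialLinearSpace P} {A B : Set P} :
    A ⊆ X.perp B ↔ B ⊆ X.perp A :=
  ⟨fun h _ hb _ ha => (h ha _ hb).symm, fun h _ ha _ hb => (h hb _ ha).symm⟩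

namespace IsShultSpace

variable {X : PartialLinearSpace P} (h : X.IsShultSpace)
include h

theorem exists_collinear_mem_line {L : Set P} (hL : L ∈ X.lines) (p : P) :
    ∃ u ∈ L, X.Collinear p u := by
  rcases h.one_or_all p L hL with ⟨q, hq, -⟩ | h1
  · exact ⟨q, hq.1, hq.2⟩
  · obtain ⟨a, ha⟩ : L.Nonempty := by
      rw [← Set.encard_pos]
      exact lt_of_lt_of_le (by norm_num) (X.two_le L hL)
    exact ⟨a, ha, h1 a ha⟩

theorem collinear_of_two {L : Set P} (hL : L ∈ X.lines) {p a b : P} (ha : a ∈ L) (hb : b ∈ L)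
    (hab : a ≠ b) (hpa : X.Collinear p a) (hpb : X.Collinear p b) {c : P} (hc : c ∈ L) :
    X.Collinear p c := by
  rcases h.one_or_all p L hL with ⟨q, -, hq⟩ | h1
  · exact absurd ((hq a ⟨ha, hpa⟩).trans (hq b ⟨hb, hpb⟩).symm) hab
  · exact h1 c hc

theorem isSubspace_perp (A : Set P) : X.IsSubspace (X.perp A) :=
  fun _ hp _ hq hpq _ hL hpL hqL _ hr a ha =>
    (h.collinear_of_two hL hpL hqL hpq (hp a ha).symm (hq a ha).symm hr).symm

theorem nondegenerateOn_univ : X.NondegenerateOn Set.univ := by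
  intro w _
  obtain ⟨q, hq⟩ := h.nondegenerate w
  exact ⟨q, trivial, fun hh => hq hh.symm⟩

/-- An inclusion u^⊥ ⊆ t^⊥ inside a non-degenerate subspace is an equality. If r is collinear to t
but not to u, a point r' outside t^⊥ is joined by a line to r, or else to a point of the line rt,
not collinear to u in either case. The point of that line collinear to u is then a second point of
it in t^⊥, which puts r' into t^⊥. -/
theorem perp_subset_symm {C : Set P} (hC : X.IsSubspace C) (hN : X.NondegenerateOn C) {u t : P}
    (ht : t ∈ C) (hut : ∀ q ∈ C, X.Collinear q u → X.Collinear q t) {r : P}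
    (hr : r ∈ C) (hrt : X.Collinear r t) (hu : u ∈ C) : X.Collinear r u := by
  by_contra hru
  obtain ⟨r', hr', hr't⟩ := hN t ht
  have hr'u : ¬ X.Collinear r' u := fun hh => hr't (hut r' hr' hh)
  have htu : X.Collinear t u := (hut u hu (X.collinear_refl u)).symm
  by_cases hrr : X.Collinear r' r
  · obtain ⟨L, hL, h1, h2⟩ := hrr
    obtain ⟨x, hx, hux⟩ := h.exists_collinear_mem_line hL u
    have hne : r' ≠ r := by rintro rfl; exact hr't hrt
    have hxC : x ∈ C := hC r' hr' r hr hne L hL h1 h2 hx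
    have hxr : x ≠ r := by rintro rfl; exact hru hux.symm
    exact hr't (h.collinear_of_two hL hx h2 hxr (hut x hxC hux.symm).symm hrt.symm h1).symm
  · have hrt' : r ≠ t := by rintro rfl; exact hru htu
    obtain ⟨L, hL, h1, h2⟩ := hrt
    obtain ⟨s, hs, hr's⟩ := h.exists_collinear_mem_line hL r'
    have hsC : s ∈ C := hC r hr t ht hrt' L hL h1 h2 hs
    have hst : s ≠ t := by rintro rfl; exact hr't hr's
    have hsu : ¬ X.Collinear s u := fun hh =>
      hru (h.collinear_of_two hL hs h2 hst hh.symm htu.symm h1).symm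
    have hne : r' ≠ s := by
      rintro rfl
      exact hr't (collinear_of_mem_line hL hs h2)
    obtain ⟨M, hM, h3, h4⟩ := hr's
    obtain ⟨x, hx, hux⟩ := h.exists_collinear_mem_line hM u
    have hxC : x ∈ C := hC r' hr' s hsC hne M hM h3 h4 hx
    have hxs : x ≠ s := by rintro rfl; exact hsu hux.symm
    exact hr't (h.collinear_of_two hM hx h4 hxs (hut x hxC hux.symm).symm
      (collinear_of_mem_line hL h2 hs) h3).symm

/-- If u^⊥ ⊆ w^⊥ then u^⊥ ⊆ t^⊥ for every t on the line uw, with equality by `perp_subset_symm`.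
Choosing t collinear to a point r outside w^⊥ puts r into u^⊥, a contradiction. -/
theorem exists_collinear_not_collinear {C : Set P} (hC : X.IsSubspace C)
    (hN : X.NondegenerateOn C) {u w : P} (hu : u ∈ C) (hw : w ∈ C) (huw : u ≠ w) :
    ∃ q ∈ C, X.Collinear q u ∧ ¬ X.Collinear q w := by
  by_contra! hcon
  obtain ⟨r, hr, hrw⟩ := hN w hw
  have hru : ¬ X.Collinear r u := fun hh => hrw (hcon r hr hh)
  obtain ⟨L, hL, h1, h2⟩ := hcon u hu (X.collinear_refl u)
  obtain ⟨t, ht, hrt⟩ := h.exists_collinear_mem_line hL r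
  have htC : t ∈ C := hC u hu w hw huw L hL h1 h2 ht
  exact hru (h.perp_subset_symm hC hN htC
    (fun q hq hqu => h.collinear_of_two hL h1 h2 huw hqu (hcon q hq hqu) ht) hr hrt hu)

/-- Given w, a point y collinear to a but not to w is moved along the line ya to the point collinear
to q. That point is not a, so it is still not collinear to w. -/
theorem nondegenerateOn_perp_pair {C : Set P} (hC : X.IsSubspace C)
    (hN : X.NondegenerateOn C) {a q : P} (ha : a ∈ C) (haq : ¬ X.Collinear a q) :
    X.NondegenerateOn (C ∩ X.perp {a, q}) := by
  rintro w ⟨hwC, hw⟩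
  have hwa : X.Collinear w a := hw a (Or.inl rfl)
  have hwq : X.Collinear w q := hw q (Or.inr rfl)
  have hne : a ≠ w := by rintro rfl; exact haq hwq
  obtain ⟨y, hy, hya, hyw⟩ := h.exists_collinear_not_collinear hC hN ha hwC hne
  have hyne : y ≠ a := by rintro rfl; exact hyw hwa.symm
  obtain ⟨L, hL, h1, h2⟩ := hya
  obtain ⟨s, hs, hqs⟩ := h.exists_collinear_mem_line hL q
  have hsC : s ∈ C := hC y hy a ha hyne L hL h1 h2 hs
  have hsa : s ≠ a := by rintro rfl; exact haq hqs.symm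
  refine ⟨s, ⟨hsC, ?_⟩, fun hsw => hyw
    (h.collinear_of_two hL hs h2 hsa hsw.symm hwa h1).symm⟩
  rintro _ (rfl | rfl)
  · exact collinear_of_mem_line hL hs h2
  · exact hqs.symm

/-- Separating a point from a line reduces to separating two points in {v, r}^⊥, with v ∈ L and r
outside v^⊥ and d^⊥: these are the points u ∈ L and w ∈ vd that are collinear to r. -/
theorem exists_collinear_line_not_collinear {C : Set P} (hC : X.IsSubspace C)
    (hN : X.NondegenerateOn C) {L : Set P} (hL : L ∈ X.lines) {a b d : P} (hab : a ≠ b)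
    (ha : a ∈ L) (hb : b ∈ L) (hd : d ∉ L) (haC : a ∈ C) (hbC : b ∈ C) (hdC : d ∈ C) :
    ∃ q ∈ C, (∀ x ∈ L, X.Collinear q x) ∧ ¬ X.Collinear q d := by
  have hLC : L ⊆ C := hC a haC b hbC hab L hL ha hb
  by_cases hall : ∀ v ∈ L, X.Collinear v d
  swap
  · push Not at hall
    obtain ⟨v, hv, hvd⟩ := hall
    exact ⟨v, hLC hv, fun x hx => collinear_of_mem_line hL hv hx, hvd⟩
  obtain ⟨r, hr, hrd⟩ := hN d hdC
  obtain ⟨u, hu, hru⟩ := h.exists_collinear_mem_line hL r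
  by_cases hrL : ∀ x ∈ L, X.Collinear r x
  · exact ⟨r, hr, hrL, hrd⟩
  push Not at hrL
  obtain ⟨v, hv, hrv⟩ := hrL
  have huv : u ≠ v := by rintro rfl; exact hrv hru
  have hvd : v ≠ d := by rintro rfl; exact hd hv
  obtain ⟨M, hM, h1, h2⟩ := hall v hv
  obtain ⟨w, hw, hrw⟩ := h.exists_collinear_mem_line hM r
  have hwC : w ∈ C := hC v (hLC hv) d hdC hvd M hM h1 h2 hw
  have hwv : w ≠ v := by rintro rfl; exact hrv hrw
  have huw : u ≠ w := by
    rintro rfl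
    have := X.line_unique u v huv L hL M hM hu hv hw h1
    exact hd (this ▸ h2)
  have hvr : ¬ X.Collinear v r := fun hh => hrv hh.symm
  have hC' : X.IsSubspace (C ∩ X.perp {v, r}) := hC.inter (h.isSubspace_perp _)
  have hN' := h.nondegenerateOn_perp_pair hC hN (hLC hv) hvr
  have memC' : ∀ x ∈ C, X.Collinear x v → X.Collinear x r → x ∈ C ∩ X.perp {v, r} := by
    rintro x hx h3 h4
    refine ⟨hx, ?_⟩
    rintro _ (rfl | rfl)
    · exact h3
    · exact h4
  obtain ⟨q, hq, hqu, hqw⟩ := h.exists_collinear_not_collinear hC' hN'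
    (memC' u (hLC hu) (collinear_of_mem_line hL hu hv) hru.symm)
    (memC' w hwC (collinear_of_mem_line hM hw h1) hrw.symm) huw
  have hqv : X.Collinear q v := hq.2 v (Or.inl rfl)
  exact ⟨q, hq.1, fun x hx => h.collinear_of_two hL hu hv huv hqu hqv hx,
    fun hqd => hqw (h.collinear_of_two hM h1 h2 hvd hqv hqd hw)⟩

/-- A relative form of L^⊥⊥ = L. Since {p, q}^⊥ is non-degenerate, a point of it off L could be
separated from L by a point r of {p, q}^⊥. -/
theorem mem_line_of_forall_collinear {L : Set P} (hL : L ∈ X.lines) {p q c : P}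
    (hpq : ¬ X.Collinear p q) (hLp : ∀ x ∈ L, X.Collinear x p) (hLq : ∀ x ∈ L, X.Collinear x q)
    (hcp : X.Collinear c p) (hcq : X.Collinear c q)
    (hc : ∀ r, X.Collinear r p → (∀ x ∈ L, X.Collinear r x) → X.Collinear r c) : c ∈ L := by
  by_contra hcL
  have memC : ∀ x, X.Collinear x p → X.Collinear x q → x ∈ Set.univ ∩ X.perp {p, q} := by
    rintro x h3 h4
    refine ⟨trivial, ?_⟩
    rintro _ (rfl | rfl)
    · exact h3
    · exact h4
  obtain ⟨a, b, ha, hb, hab⟩ : ∃ a b, a ∈ L ∧ b ∈ L ∧ a ≠ b := by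
    have := X.two_le L hL
    exact Set.one_lt_encard_iff.mp (lt_of_lt_of_le (by norm_num) this)
  obtain ⟨r, hr, hr1, hr2⟩ := h.exists_collinear_line_not_collinear
    (X.isSubspace_univ.inter (h.isSubspace_perp {p, q}))
    (h.nondegenerateOn_perp_pair X.isSubspace_univ h.nondegenerateOn_univ trivial hpq)
    hL hab ha hb hcL (memC a (hLp a ha) (hLq a ha)) (memC b (hLp b hb) (hLq b hb))
    (memC c hcp hcq)
  exact hr2 (hc r (hr.2 p (Or.inl rfl)) hr1)

/-- The Veblen axiom for singular subspaces: a line meeting pa and pb outside p must project from p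
into the line ab. It is derived from perps, without assuming that singular subspaces are projective.
-/
theorem cone_isSubspace {A : Set P} (hA : X.IsSingularSubspace A) {p : P} (hp : p ∈ X.perp A)
    (hpA : p ∉ A) : X.IsSubspace (X.cone p A) := by
  intro x hx y hy hxy L hL hxL hyL z hz
  by_cases hzp : z = p
  · exact Or.inl hzp
  rcases hx with rfl | ⟨a, ha, M, hM, hpM, haM, hxM⟩
  · rcases hy with rfl | ⟨b, hb, N, hN, hpN, hbN, hyN⟩
    · exact absurd rfl hxy
    · have := X.line_unique x y hxy L hL N hN hxL hyL hpN hyN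
      exact Or.inr ⟨b, hb, N, hN, hpN, hbN, this ▸ hz⟩
  · by_cases hyp : y = p
    · subst hyp
      have := X.line_unique x y hxy L hL M hM hxL hyL hxM hpM
      exact Or.inr ⟨a, ha, M, hM, hpM, haM, this ▸ hz⟩
    by_cases hxp : x = p
    · subst hxp
      obtain rfl | ⟨b, hb, N, hN, hpN, hbN, hyN⟩ := hy
      · exact absurd rfl hyp
      · have := X.line_unique x y hxy L hL N hN hxL hyL hpN hyN
        exact Or.inr ⟨b, hb, N, hN, hpN, hbN, this ▸ hz⟩
    obtain hy | ⟨b, hb, N, hN, hpN, hbN, hyN⟩ := hy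
    · exact absurd hy hyp
    by_cases hMN : M = N
    · subst hMN
      have := X.line_unique x y hxy L hL M hM hxL hyL hxM hyN
      exact Or.inr ⟨a, ha, M, hM, hpM, haM, this ▸ hz⟩
    have hpa : p ≠ a := by rintro rfl; exact hpA ha
    have hpb : p ≠ b := by rintro rfl; exact hpA hb
    have hab : a ≠ b := by
      rintro rfl
      exact hMN (X.line_unique p a hpa M hM N hN hpM haM hpN hbN)
    obtain ⟨K, hK, haK, hbK⟩ := hA.2 a ha b hb
    have hKA : K ⊆ A := hA.1 a ha b hb hab K hK haK hbK
    have key : ∀ r, X.Collinear r p → (∀ x ∈ K, X.Collinear r x) → X.Collinear r z := by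
      intro r hrp hrK
      have h1 := h.collinear_of_two hM hpM haM hpa hrp (hrK a haK) hxM
      have h2 := h.collinear_of_two hN hpN hbN hpb hrp (hrK b hbK) hyN
      exact h.collinear_of_two hL hxL hyL hxy h1 h2 hz
    have hpz : X.Collinear p z := key p (X.collinear_refl p) fun x hx => hp x (hKA hx)
    -- The auxiliary q picks out on the line pz the one point c that can lie on K. Whatever is
    -- collinear to p and to K is collinear to x and y, hence to z and c, so c ∈ K.
    obtain ⟨q, -, hqK, hqp⟩ := h.exists_collinear_line_not_collinear X.isSubspace_univ
      h.nondegenerateOn_univ hK hab haK hbK (fun hpK => hpA (hKA hpK)) trivial trivial trivial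
    obtain ⟨R, hR, hpR, hzR⟩ := hpz
    obtain ⟨c, hcR, hqc⟩ := h.exists_collinear_mem_line hR q
    have hcK : c ∈ K := h.mem_line_of_forall_collinear hK (fun hh => hqp hh.symm)
      (fun x hx => (hp x (hKA hx)).symm) (fun x hx => (hqK x hx).symm)
      (collinear_of_mem_line hR hcR hpR) hqc.symm (fun r hrp hrK =>
        h.collinear_of_two hR hpR hzR (Ne.symm hzp) hrp (key r hrp hrK) hcR)
    exact Or.inr ⟨c, hKA hcK, R, hR, hpR, hcR, hzR⟩

theorem cone_subset_perp {A B : Set P} {p : P} (hpA : p ∉ A) (hA : A ⊆ X.perp B)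
    (hp : p ∈ X.perp B) : X.cone p A ⊆ X.perp B := by
  rintro x (rfl | ⟨a, ha, L, hL, hpL, haL, hxL⟩)
  · exact hp
  · have hpa : p ≠ a := by rintro rfl; exact hpA ha
    exact h.isSubspace_perp B p hp a (hA ha) hpa L hL hpL haL hxL

theorem cone_isSingularSubspace {A : Set P} (hA : X.IsSingularSubspace A) {p : P}
    (hp : p ∈ X.perp A) (hpA : p ∉ A) : X.IsSingularSubspace (X.cone p A) := by
  refine ⟨h.cone_isSubspace hA hp hpA, ?_⟩
  have hAA : A ⊆ X.perp A := fun a ha b hb => hA.2 a ha b hb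
  have h1 : X.cone p A ⊆ X.perp A := h.cone_subset_perp hpA hAA hp
  refine h.cone_subset_perp hpA (subset_perp_comm.mp h1) ?_
  rintro x (rfl | ⟨a, ha, L, hL, hpL, haL, hxL⟩)
  · exact X.collinear_refl _
  · exact collinear_of_mem_line hL hpL hxL

omit h in
theorem self_mem_cone (X : PartialLinearSpace P) (p : P) (A : Set P) : p ∈ X.cone p A := Or.inl rfl

omit h in
theorem subset_cone {A : Set P} {p : P} (hp : p ∈ X.perp A) : A ⊆ X.cone p A := by
  intro a ha
  obtain ⟨L, hL, h1, h2⟩ := hp a ha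
  exact Or.inr ⟨a, ha, L, hL, h1, h2, h2⟩

omit h in
theorem cone_subset {A B : Set P} (hB : X.IsSubspace B) {p : P} (hpA : p ∉ A) (hAB : A ⊆ B)
    (hp : p ∈ B) : X.cone p A ⊆ B := by
  rintro x (rfl | ⟨a, ha, L, hL, hpL, haL, hxL⟩)
  · exact hp
  · have hpa : p ≠ a := by rintro rfl; exact hpA ha
    exact hB p hp a (hAB ha) hpa L hL hpL haL hxL

omit h in
/-- The exchange property of cones. -/
theorem mem_of_cone {A B : Set P} (hB : X.IsSubspace B) (hAB : A ⊆ B) {p x : P}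
    (hx : x ∈ X.cone p A) (hxB : x ∈ B) (hxA : x ∉ A) : p ∈ B := by
  rcases hx with rfl | ⟨a, ha, L, hL, hpL, haL, hxL⟩
  · exact hxB
  · have hxa : x ≠ a := by rintro rfl; exact hxA ha
    exact hB x hxB a (hAB ha) hxa L hL hxL haL hpL

end IsShultSpace

end PartialLinearSpace

/-! ### Rank of singular subspaces -/

namespace PartialLinearSpace

variable {P Q : Type*}

open Classical in
/-- The rank of a singular subspace: its dimension plus one. -/
noncomputable def rk (X : PartialLinearSpace P) (A : Set P) : ℕ :=
  if h : X.IsSingularSubspace A then (Order.height (⟨A, h⟩ : X.SingularSubspace)).toNat else 0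

/-- The properties of polar spaces and thin polar spaces of rank `n`. -/
structure IsPolarLike (X : PartialLinearSpace P) (n : ℕ) : Prop extends X.IsShultSpace where
  height_ne_top : ∀ A : X.SingularSubspace, Order.height A ≠ ⊤
  rk_le : ∀ A, X.IsSingularSubspace A → X.rk A ≤ n
  exists_extension : ∀ A, X.IsSingularSubspace A → X.rk A < n → ∃ p, p ∉ A ∧ p ∈ X.perp A

theorem isSingularSubspace_empty (X : PartialLinearSpace P) : X.IsSingularSubspace ∅ :=
  ⟨fun _ hp => absurd hp (Set.notMem_empty _), fun _ hp => absurd hp (Set.notMem_empty _)⟩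

theorem isSingularSubspace_singleton (X : PartialLinearSpace P) (p : P) :
    X.IsSingularSubspace {p} := by
  refine ⟨?_, ?_⟩
  · rintro a rfl b rfl hab
    exact absurd rfl hab
  · rintro a rfl b rfl
    exact X.collinear_refl _

theorem IsSingularSubspace.inter_subspace {X : PartialLinearSpace P} {A B : Set P}
    (hA : X.IsSingularSubspace A) (hB : X.IsSubspace B) : X.IsSingularSubspace (A ∩ B) :=
  ⟨hA.1.inter hB, fun p hp q hq => hA.2 p hp.1 q hq.1⟩

theorem IsSingularSubspace.subset_perp {X : PartialLinearSpace P} {A : Set P}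
    (hA : X.IsSingularSubspace A) : A ⊆ X.perp A := fun a ha b hb => hA.2 a ha b hb

namespace IsPolarLike

variable {X : PartialLinearSpace P} {n : ℕ} (h : X.IsPolarLike n)
include h

theorem coe_rk {A : Set P} (hA : X.IsSingularSubspace A) :
    (X.rk A : ℕ∞) = Order.height (⟨A, hA⟩ : X.SingularSubspace) := by
  rw [rk, dif_pos hA]
  exact ENat.natCast_toNat (h.height_ne_top _)

theorem hasDim_iff (A : X.SingularSubspace) (d : ℤ) : A.HasDim d ↔ (X.rk A.1 : ℤ) = d + 1 := by
  have := h.coe_rk A.2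
  constructor
  · rintro ⟨m, hm, hd⟩
    rw [show (⟨A.1, A.2⟩ : X.SingularSubspace) = A from rfl, hm] at this
    rw [← hd]
    exact_mod_cast this
  · intro hd
    exact ⟨X.rk A.1, this.symm, hd⟩

theorem rk_lt {A B : Set P} (hA : X.IsSingularSubspace A) (hB : X.IsSingularSubspace B)
    (hAB : A ⊆ B) (hne : A ≠ B) : X.rk A < X.rk B := by
  have hlt : (⟨A, hA⟩ : X.SingularSubspace) < ⟨B, hB⟩ :=
    lt_of_le_of_ne hAB fun hh => hne (congrArg Subtype.val hh)
  have := Order.height_strictMono hlt (lt_top_iff_ne_top.mpr (h.height_ne_top _))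
  rw [← h.coe_rk hA, ← h.coe_rk hB] at this
  exact_mod_cast this

theorem rk_mono {A B : Set P} (hA : X.IsSingularSubspace A) (hB : X.IsSingularSubspace B)
    (hAB : A ⊆ B) : X.rk A ≤ X.rk B := by
  rcases eq_or_ne A B with rfl | hne
  · exact le_rfl
  · exact (h.rk_lt hA hB hAB hne).le

theorem eq_of_subset {A B : Set P} (hA : X.IsSingularSubspace A) (hB : X.IsSingularSubspace B)
    (hAB : A ⊆ B) (hr : X.rk B ≤ X.rk A) : A = B := by
  by_contra hne
  exact absurd (h.rk_lt hA hB hAB hne) (not_lt.mpr hr)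

omit h in
theorem cone_eq_cone {A : Set P} (h : X.IsShultSpace) (hA : X.IsSingularSubspace A) {p x : P}
    (hp : p ∈ X.perp A) (hpA : p ∉ A) (hx : x ∈ X.cone p A) (hxA : x ∉ A) :
    X.cone x A = X.cone p A := by
  have hxp : x ∈ X.perp A := h.cone_subset_perp hpA hA.subset_perp hp hx
  have hAx : A ⊆ X.cone x A := IsShultSpace.subset_cone hxp
  have hc := h.cone_isSubspace hA hxp hxA
  refine subset_antisymm ?_ ?_
  · exact IsShultSpace.cone_subset (h.cone_isSubspace hA hp hpA) hxA
      (IsShultSpace.subset_cone hp) hx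
  · exact IsShultSpace.cone_subset hc hpA hAx
      (IsShultSpace.mem_of_cone hc hAx hx (IsShultSpace.self_mem_cone X x A) hxA)

omit h in
theorem eq_cone_inter {A C : Set P} (hC : X.IsSubspace C) {x : P} (hxC : x ∈ C) (hxA : x ∉ A)
    (hCA : C ⊆ X.cone x A) : C = X.cone x (A ∩ C) := by
  refine subset_antisymm ?_ ?_
  · intro y hy
    rcases hCA hy with rfl | ⟨a, ha, L, hL, hxL, haL, hyL⟩
    · exact Or.inl rfl
    · by_cases hyx : y = x
      · exact Or.inl hyx
      · exact Or.inr ⟨a, ⟨ha, hC y hy x hxC hyx L hL hyL hxL haL⟩, L, hL, hxL, haL, hyL⟩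
  · exact IsShultSpace.cone_subset hC (fun hh => hxA hh.1) Set.inter_subset_right hxC

/-- For the upper bound, a proper singular subspace C of the cone that is not inside A is itself a
cone over A ∩ C, and A ∩ C ≠ A. Induction on the rank of the cone gives rk C ≤ rk (A ∩ C) + 1 ≤ rk
A. -/
theorem rk_cone {A : Set P} (hA : X.IsSingularSubspace A) {p : P} (hp : p ∈ X.perp A)
    (hpA : p ∉ A) : X.rk (X.cone p A) = X.rk A + 1 := by
  apply le_antisymm
  · generalize hm : X.rk (X.cone p A) = m
    induction m using Nat.strong_induction_on generalizing A p with
    | _ m ih =>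
      have hB := h.cone_isSingularSubspace hA hp hpA
      have key : Order.height (⟨_, hB⟩ : X.SingularSubspace) ≤ ((X.rk A + 1 : ℕ) : ℕ∞) := by
        rw [Order.height_le_coe_iff]
        rintro ⟨C, hC⟩ hlt
        rw [← h.coe_rk hC]
        have hCB : C ⊆ X.cone p A := hlt.le
        have hne : C ≠ X.cone p A := fun hh => hlt.ne (Subtype.ext hh)
        suffices X.rk C ≤ X.rk A by exact_mod_cast Nat.lt_succ_of_le this
        by_cases hCA : C ⊆ A
        · exact h.rk_mono hC hA hCA
        · obtain ⟨x, hxC, hxA⟩ := Set.not_subset.mp hCA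
          have hcone := cone_eq_cone h.toIsShultSpace hA hp hpA (hCB hxC) hxA
          have hC' := eq_cone_inter hC.1 hxC hxA (hcone ▸ hCB)
          have hI : X.IsSingularSubspace (A ∩ C) := hA.inter_subspace hC.1
          have h1 := ih (X.rk C) (hm ▸ h.rk_lt hC hB hCB hne) hI (p := x)
            (fun a ha => hC.2 x hxC a ha.2) (fun hh => hxA hh.1) (by rw [← hC'])
          have h2 : X.rk (A ∩ C) < X.rk A := by
            refine h.rk_lt hI hA Set.inter_subset_left fun hh => hne ?_
            have hAC : A ⊆ C := Set.inter_eq_left.mp hh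
            exact subset_antisymm hCB (IsShultSpace.cone_subset hC.1 hpA hAC
              (IsShultSpace.mem_of_cone hC.1 hAC (hCB hxC) hxC hxA))
          omega
      rw [← h.coe_rk hB, hm] at key
      exact_mod_cast key
  · refine h.rk_lt hA (h.cone_isSingularSubspace hA hp hpA) (IsShultSpace.subset_cone hp) ?_
    intro hh
    exact hpA (hh ▸ IsShultSpace.self_mem_cone X p A)

theorem eq_cone {A B : Set P} (hA : X.IsSingularSubspace A) (hB : X.IsSingularSubspace B)
    (hAB : A ⊆ B) (hr : X.rk B ≤ X.rk A + 1) {x : P} (hxB : x ∈ B) (hxA : x ∉ A) :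
    B = X.cone x A := by
  have hx : x ∈ X.perp A := fun a ha => hB.2 x hxB a (hAB ha)
  refine (h.eq_of_subset (h.cone_isSingularSubspace hA hx hxA) hB
    (IsShultSpace.cone_subset hB.1 hxA hAB hxB) ?_).symm
  rw [h.rk_cone hA hx hxA]
  exact hr

/-- B is all of C or a hyperplane of it, so a subspace A not inside B is a cone over its trace on B.
-/
theorem rk_le_rk_inter {A B C : Set P} (hA : X.IsSingularSubspace A)
    (hB : X.IsSingularSubspace B) (hC : X.IsSingularSubspace C) (hAC : A ⊆ C) (hBC : B ⊆ C)
    (hr : X.rk C ≤ X.rk B + 1) : X.rk A ≤ X.rk (A ∩ B) + 1 := by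
  by_cases hAB : A ⊆ B
  · rw [Set.inter_eq_left.mpr hAB]
    omega
  · obtain ⟨x, hxA, hxB⟩ := Set.not_subset.mp hAB
    have h1 := h.eq_cone hB hC hBC hr (hAC hxA) hxB
    have h2 := eq_cone_inter hA.1 hxA hxB (h1 ▸ hAC)
    rw [Set.inter_comm] at h2
    have h3 := h.rk_cone (hA.inter_subspace hB.1) (p := x) (fun a ha => hA.2 x hxA a ha.1)
      (fun hh => hxB hh.2)
    rw [← h2] at h3
    exact h3.le

/-- Each line of A through a point x outside p^⊥ meets p^⊥, so A is contained in the cone from x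
over A ∩ p^⊥. -/
theorem rk_le_rk_inter_perp {A : Set P} (hA : X.IsSingularSubspace A) (p : P) :
    X.rk A ≤ X.rk (A ∩ X.perp {p}) + 1 := by
  by_cases hAp : A ⊆ X.perp {p}
  · rw [Set.inter_eq_left.mpr hAp]
    omega
  · obtain ⟨x, hxA, hxp⟩ := Set.not_subset.mp hAp
    have h1 : A ⊆ X.cone x (A ∩ X.perp {p}) := by
      intro y hy
      by_cases hyx : y = x
      · exact Or.inl hyx
      obtain ⟨L, hL, hxL, hyL⟩ := hA.2 x hxA y hy
      obtain ⟨u, hu, hpu⟩ := h.exists_collinear_mem_line hL p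
      refine Or.inr ⟨u, ⟨hA.1 y hy x hxA hyx L hL hyL hxL hu, ?_⟩, L, hL, hxL, hu, hyL⟩
      rintro _ rfl
      exact hpu.symm
    have hI : X.IsSingularSubspace (A ∩ X.perp {p}) := hA.inter_subspace (h.isSubspace_perp _)
    have hx : x ∈ X.perp (A ∩ X.perp {p}) := fun a ha => hA.2 x hxA a ha.1
    have hxI : x ∉ A ∩ X.perp {p} := fun hh => hxp hh.2
    have h3 := h.rk_cone hI hx hxI
    rw [← h3]
    exact h.rk_mono hA (h.cone_isSingularSubspace hI hx hxI) h1

theorem rk_empty : X.rk ∅ = 0 := by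
  have : (X.rk ∅ : ℕ∞) = 0 := by
    rw [h.coe_rk X.isSingularSubspace_empty, Order.height_eq_zero]
    exact fun B _ => Set.empty_subset B.1
  exact_mod_cast this

theorem eq_empty_of_rk_eq_zero {A : Set P} (hA : X.IsSingularSubspace A) (hr : X.rk A = 0) :
    A = ∅ :=
  (h.eq_of_subset X.isSingularSubspace_empty hA (Set.empty_subset _) (by omega)).symm

theorem nonempty_of_rk_pos {A : Set P} (_hA : X.IsSingularSubspace A) (hr : 0 < X.rk A) :
    A.Nonempty := by
  by_contra hne
  rw [Set.not_nonempty_iff_eq_empty] at hne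
  rw [hne, h.rk_empty] at hr
  exact absurd hr (lt_irrefl _)

theorem rk_pos {A : Set P} (hA : X.IsSingularSubspace A) (hne : A.Nonempty) : 0 < X.rk A := by
  by_contra hr
  rw [h.eq_empty_of_rk_eq_zero hA (by omega)] at hne
  exact Set.not_nonempty_empty hne

theorem rk_singleton (p : P) : X.rk {p} = 1 := by
  have h1 := h.rk_cone X.isSingularSubspace_empty (p := p) (fun a ha => absurd ha id) id
  rw [h.rk_empty, zero_add] at h1
  rw [← h1]
  congr 1
  ext x
  constructor
  · rintro rfl
    exact Or.inl rfl
  · rintro (rfl | ⟨a, ha, -⟩)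
    · rfl
    · exact absurd ha id

theorem eq_of_mem_of_rk_le_one {A : Set P} (hA : X.IsSingularSubspace A) (hr : X.rk A ≤ 1)
    {p q : P} (hp : p ∈ A) (hq : q ∈ A) : p = q := by
  have := h.eq_of_subset (X.isSingularSubspace_singleton p) hA (Set.singleton_subset_iff.mpr hp)
    (by rw [h.rk_singleton]; exact hr)
  rw [← this] at hq
  exact hq.symm

theorem exists_between {A B : Set P} (hA : X.IsSingularSubspace A) (hB : X.IsSingularSubspace B)
    (hAB : A ⊆ B) {m : ℕ} (hAm : X.rk A ≤ m) (hmB : m ≤ X.rk B) :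
    ∃ C, X.IsSingularSubspace C ∧ A ⊆ C ∧ C ⊆ B ∧ X.rk C = m := by
  induction m, hAm using Nat.le_induction with
  | base => exact ⟨A, hA, subset_rfl, hAB, rfl⟩
  | succ m hm ih =>
    obtain ⟨C, hC, hAC, hCB, hr⟩ := ih (by omega)
    obtain ⟨x, hxB, hxC⟩ : ∃ x ∈ B, x ∉ C := by
      by_contra! hcon
      have := h.rk_mono hB hC hcon
      omega
    have hx : x ∈ X.perp C := fun a ha => hB.2 x hxB a (hCB ha)
    exact ⟨X.cone x C, h.cone_isSingularSubspace hC hx hxC,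
      hAC.trans (IsShultSpace.subset_cone hx), IsShultSpace.cone_subset hB.1 hxC hCB hxB,
      by rw [h.rk_cone hC hx hxC, hr]⟩

/-- B is built from B₀ by successive cones, and each new apex cuts the perp in A by at most one
rank. -/
theorem rk_inter_perp_le {A B₀ B : Set P} (hA : X.IsSingularSubspace A)
    (hB₀ : X.IsSingularSubspace B₀) (hB : X.IsSingularSubspace B) (hBB : B₀ ⊆ B) :
    X.rk (A ∩ X.perp B₀) + X.rk B₀ ≤ X.rk (A ∩ X.perp B) + X.rk B := by
  generalize hm : X.rk B - X.rk B₀ = m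
  induction m generalizing B₀ with
  | zero =>
    have := h.eq_of_subset hB₀ hB hBB (by omega)
    rw [this]
  | succ m ih =>
    obtain ⟨x, hxB, hxC⟩ : ∃ x ∈ B, x ∉ B₀ := by
      by_contra! hcon
      have := h.rk_mono hB hB₀ hcon
      omega
    have hx : x ∈ X.perp B₀ := fun a ha => hB.2 x hxB a (hBB ha)
    have h1 := h.rk_cone hB₀ hx hxC
    have hc := h.cone_isSingularSubspace hB₀ hx hxC
    have h2 := ih hc (IsShultSpace.cone_subset hB.1 hxC hBB hxB) (by omega)
    have hI : X.IsSingularSubspace (A ∩ X.perp B₀) := hA.inter_subspace (h.isSubspace_perp _)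
    have h3 := h.rk_le_rk_inter_perp hI x
    have h4 : X.rk (A ∩ X.perp B₀ ∩ X.perp {x}) ≤ X.rk (A ∩ X.perp (X.cone x B₀)) := by
      refine h.rk_mono (hI.inter_subspace (h.isSubspace_perp _))
        (hA.inter_subspace (h.isSubspace_perp _)) ?_
      rintro y ⟨⟨hyA, hy0⟩, hyx⟩
      refine ⟨hyA, ?_⟩
      have : X.cone x B₀ ⊆ X.perp {y} := by
        refine h.cone_subset_perp hxC ?_ ?_
        · rintro b hb _ rfl
          exact (hy0 b hb).symm
        · rintro _ rfl
          exact (hyx x rfl).symm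
      exact fun b hb => (this hb y rfl).symm
    omega

theorem exists_mem_perp {A B : Set P} (hA : X.IsSingularSubspace A)
    (hB : X.IsSingularSubspace B) (hr : X.rk B < X.rk A) : ∃ a ∈ A, a ∈ X.perp B := by
  have h1 := h.rk_inter_perp_le hA X.isSingularSubspace_empty hB (Set.empty_subset _)
  have h2 : A ∩ X.perp ∅ = A := Set.inter_eq_left.mpr fun a _ b hb => absurd hb id
  rw [h2, h.rk_empty] at h1
  obtain ⟨a, ha⟩ := h.nonempty_of_rk_pos (hA.inter_subspace (h.isSubspace_perp B)) (by omega)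
  exact ⟨a, ha.1, ha.2⟩

theorem mem_of_mem_perp {A : Set P} (hA : X.IsSingularSubspace A) (hr : X.rk A = n) {p : P}
    (hp : p ∈ X.perp A) : p ∈ A := by
  by_contra hpA
  have h1 := h.rk_cone hA hp hpA
  have h2 := h.rk_le _ (h.cone_isSingularSubspace hA hp hpA)
  omega

omit h in
theorem subset_perp_span {A B : Set P} (h : X.IsShultSpace) (hAB : A ⊆ X.perp B) :
    X.span A ⊆ X.perp B :=
  Set.sInter_subset_of_mem ⟨h.isSubspace_perp B, hAB⟩

omit h in
theorem subset_span (X : PartialLinearSpace P) (A : Set P) : A ⊆ X.span A :=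
  Set.subset_sInter fun _ hS => hS.2

omit h in
theorem span_subset {A B : Set P} (hB : X.IsSubspace B) (hAB : A ⊆ B) : X.span A ⊆ B :=
  Set.sInter_subset_of_mem ⟨hB, hAB⟩

omit h in
theorem span_mono {A B : Set P} (hAB : A ⊆ B) : X.span A ⊆ X.span B :=
  Set.subset_sInter fun _ hS => Set.sInter_subset_of_mem ⟨hS.1, hAB.trans hS.2⟩

omit h in
theorem isSubspace_span (X : PartialLinearSpace P) (A : Set P) : X.IsSubspace (X.span A) :=
  fun _ hp _ hq hpq L hL hpL hqL => Set.subset_sInter fun S hS =>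
    hS.1 _ (hp S hS) _ (hq S hS) hpq L hL hpL hqL

omit h in
theorem isSingularSubspace_span {A : Set P} (h : X.IsShultSpace) (hA : A ⊆ X.perp A) :
    X.IsSingularSubspace (X.span A) :=
  ⟨isSubspace_span X A, fun _ hp q hq => subset_perp_span h
    (subset_perp_comm.mp (subset_perp_span h hA)) hp q hq⟩

end IsPolarLike

/-- Finiteness of chains gives, by Zorn, a maximal singular subspace above each one, so the rank
hypothesis on maximal subspaces bounds every height by `n`. -/
theorem isPolarLike_of_isPolarSpace {X : PartialLinearSpace P} {n : ℕ} (hX : X.IsPolarSpace)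
    (hr : X.HasRank n) : X.IsPolarLike n := by
  have hmax : ∀ A : X.SingularSubspace, ∃ M, A ≤ M ∧ IsMax M := by
    intro A
    refine zorn_le_nonempty_Ici₀ A ?_ A le_rfl
    intro c _ hc y hy
    obtain ⟨m, hm, hmm⟩ := (hX.finite_chain c hc).exists_maximal ⟨y, hy⟩
    refine ⟨m, fun z hz => ?_⟩
    rcases hc.total hm hz with h1 | h1
    · exact hmm hz h1
    · exact h1
  have hM : ∀ M : X.SingularSubspace, IsMax M → Order.height M = (n : ℕ∞) := by
    intro M hMm
    obtain ⟨m, h1, h2⟩ := hr M hMm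
    rw [h1]
    have : m = n := by omega
    rw [this]
  have hle : ∀ A : X.SingularSubspace, Order.height A ≤ (n : ℕ∞) := by
    intro A
    obtain ⟨M, hAM, hMm⟩ := hmax A
    exact (Order.height_mono hAM).trans (hM M hMm).le
  refine { one_or_all := hX.one_or_all, nondegenerate := ?_, height_ne_top := ?_, rk_le := ?_,
           exists_extension := ?_ }
  · have := hX.nondegenerate
    push Not at this
    exact this
  · intro A hA
    have := hle A
    rw [hA] at this
    exact absurd this (by simp)
  · intro A hA
    rw [rk, dif_pos hA]
    exact ENat.toNat_le_of_le_natCast (hle _)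
  · intro A hA hlt
    rw [rk, dif_pos hA] at hlt
    have hnm : ¬ IsMax (⟨A, hA⟩ : X.SingularSubspace) := by
      intro hm
      rw [hM _ hm] at hlt
      simp at hlt
    obtain ⟨B, hB⟩ := not_isMax_iff.mp hnm
    have hAB : A ⊆ B.1 := hB.le
    obtain ⟨p, hpB, hpA⟩ := Set.not_subset.mp (show ¬ B.1 ⊆ A from hB.not_ge)
    exact ⟨p, hpA, fun a ha => B.2.2 p hpB a (hAB ha)⟩

end PartialLinearSpace

/-! ### Distance and opposition in the Grassmann graph -/

namespace PartialLinearSpace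

variable {P Q : Type*}

/-- No point of `B` is collinear to all points of `A`. -/
def Opposite (X : PartialLinearSpace P) (A B : Set P) : Prop := ∀ b ∈ B, b ∉ X.perp A

/-- `A` and `B` lie in a common singular subspace of rank `m`. -/
def Joint (X : PartialLinearSpace P) (m : ℕ) (A B : Set P) : Prop :=
  ∃ U, X.IsSingularSubspace U ∧ X.rk U = m ∧ A ⊆ U ∧ B ⊆ U

namespace IsPolarLike

variable {X : PartialLinearSpace P} {n : ℕ} (h : X.IsPolarLike n)
include h

theorem rk_grassmannian {k : ℕ} (S : X.Grassmannian k) : X.rk S.1.1 = k + 1 := by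
  have := (h.hasDim_iff S.1 k).mp S.2
  exact_mod_cast this

theorem adj_iff_joint {k : ℕ} (hk : k + 2 ≤ n) (S T : X.Grassmannian k) :
    (X.grassmannGraph n k).Adj S T ↔ S ≠ T ∧ X.Joint (k + 2) S.1.1 T.1.1 := by
  constructor
  · rintro ⟨hne, ⟨-, U, hU, hS, hT⟩ | ⟨hk', -⟩⟩
    · refine ⟨hne, U.1, U.2, ?_, hS, hT⟩
      have := (h.hasDim_iff U _).mp hU
      have h2 : (X.rk U.1 : ℤ) = ((k + 2 : ℕ) : ℤ) := by push_cast; linarith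
      exact_mod_cast h2
    · omega
  · rintro ⟨hne, U, hU, hr, hS, hT⟩
    refine ⟨hne, Or.inl ⟨hk, ⟨U, hU⟩, (h.hasDim_iff _ _).mpr ?_, hS, hT⟩⟩
    rw [hr]
    push_cast
    ring

theorem adj_iff_inter {k : ℕ} (hk : k + 1 = n) (S T : X.Grassmannian k) :
    (X.grassmannGraph n k).Adj S T ↔ S ≠ T ∧ X.rk (S.1.1 ∩ T.1.1) = k := by
  constructor
  · rintro ⟨hne, ⟨hk', -⟩ | ⟨-, hI⟩⟩
    · omega
    · refine ⟨hne, ?_⟩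
      have := (h.hasDim_iff _ _).mp hI
      have h2 : (X.rk (S.1.1 ∩ T.1.1) : ℤ) = (k : ℤ) := by
        rw [show S.1.1 ∩ T.1.1 = (S.1.inter T.1).1 from rfl, this]
        omega
      exact_mod_cast h2
  · rintro ⟨hne, hr⟩
    refine ⟨hne, Or.inr ⟨hk, (h.hasDim_iff _ _).mpr ?_⟩⟩
    rw [show (S.1.inter T.1).1 = S.1.1 ∩ T.1.1 from rfl, hr]
    omega

theorem rk_le_rk_inter_of_joint {k : ℕ} {A B : Set P} (hA : X.IsSingularSubspace A)
    (hB : X.IsSingularSubspace B) (hrB : X.rk B = k + 1)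
    (hJ : X.Joint (k + 2) A B) : X.rk A ≤ X.rk (A ∩ B) + 1 := by
  obtain ⟨U, hU, hr, hAU, hBU⟩ := hJ
  exact h.rk_le_rk_inter hA hB hU hAU hBU (by omega)

theorem rk_le_rk_inter_of_adj {k : ℕ} (hk : k < n) {S T : X.Grassmannian k}
    (hST : (X.grassmannGraph n k).Adj S T) : X.rk S.1.1 ≤ X.rk (S.1.1 ∩ T.1.1) + 1 := by
  rcases Nat.lt_or_ge (k + 1) n with hk' | hk'
  · exact h.rk_le_rk_inter_of_joint S.1.2 T.1.2 (h.rk_grassmannian T)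
      ((h.adj_iff_joint hk' S T).mp hST).2
  · rw [h.rk_grassmannian, ((h.adj_iff_inter (by omega) S T).mp hST).2]

/-- Every edge meets in at least a hyperplane of its first end, so intersecting along the walk loses
at most one rank per step. -/
theorem rk_le_of_walk {k : ℕ} (hk : k < n) {S T : X.Grassmannian k}
    (w : (X.grassmannGraph n k).Walk S T) {A : Set P} (hA : X.IsSingularSubspace A)
    (hAS : A ⊆ S.1.1) : X.rk A ≤ X.rk (A ∩ T.1.1) + w.length := by
  induction w generalizing A with
  | nil =>
    rw [Set.inter_eq_left.mpr hAS]
    simp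
  | @cons S S' T hadj w ih =>
    have h1 := h.rk_le_rk_inter_of_adj hk hadj
    have hI : X.IsSingularSubspace (S.1.1 ∩ S'.1.1) := S.1.2.inter_subspace S'.1.2.1
    have hA' : X.IsSingularSubspace (A ∩ S'.1.1) := hA.inter_subspace S'.1.2.1
    have h2 := h.rk_le_rk_inter hA hI S.1.2 hAS Set.inter_subset_left h1
    have h3 : A ∩ (S.1.1 ∩ S'.1.1) = A ∩ S'.1.1 := by
      rw [← Set.inter_assoc, Set.inter_eq_left.mpr hAS]
    rw [h3] at h2
    have h4 := ih hA' Set.inter_subset_right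
    have h5 : X.rk (A ∩ S'.1.1 ∩ T.1.1) ≤ X.rk (A ∩ T.1.1) :=
      h.rk_mono (hA'.inter_subspace T.1.2.1) (hA.inter_subspace T.1.2.1)
        fun x hx => ⟨hx.1.1, hx.2⟩
    rw [SimpleGraph.Walk.length_cons]
    omega

omit h in
theorem exists_walk_of_edist_le {V : Type*} {G : SimpleGraph V} {u v : V} {m : ℕ}
    (hm : G.edist u v ≤ (m : ℕ∞)) : ∃ w : G.Walk u v, w.length ≤ m := by
  have hne : G.edist u v ≠ ⊤ := by
    intro ht
    rw [ht] at hm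
    simp at hm
  obtain ⟨w, hw⟩ := SimpleGraph.exists_walk_of_edist_ne_top hne
  refine ⟨w, ?_⟩
  rw [← hw] at hm
  exact_mod_cast hm

/-- The first step is free: its end S' lies with S in a singular subspace, and after at most `k`
further steps S' still has a point in common with T. That point is collinear to all of S. -/
theorem not_opposite_of_edist_le {k : ℕ} (hk : k + 2 ≤ n) {S T : X.Grassmannian k}
    (hd : (X.grassmannGraph n k).edist S T ≤ ((k + 1 : ℕ) : ℕ∞)) :
    ¬ X.Opposite S.1.1 T.1.1 := by
  obtain ⟨w, hw⟩ := exists_walk_of_edist_le hd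
  have hrS := h.rk_grassmannian S
  intro hopp
  cases w with
  | nil =>
    obtain ⟨p, hp⟩ := h.nonempty_of_rk_pos S.1.2 (by omega)
    exact hopp p hp (S.1.2.subset_perp hp)
  | @cons _ S' _ hadj w =>
    have hrS' := h.rk_grassmannian S'
    have h1 := h.rk_le_of_walk (by omega) w S'.1.2 subset_rfl
    rw [SimpleGraph.Walk.length_cons] at hw
    obtain ⟨p, hpS', hpT⟩ := h.nonempty_of_rk_pos (S'.1.2.inter_subspace T.1.2.1)
      (by omega : 0 < X.rk (S'.1.1 ∩ T.1.1))
    obtain ⟨-, U, hU, -, hSU, hS'U⟩ := (h.adj_iff_joint hk S S').mp hadj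
    exact hopp p hpT fun a ha => hU.2 p (hS'U hpS') a (hSU ha)

/-- Adjacent maximal subspaces have no common singular overspace, so no step is free; within `k`
steps S and T themselves share a point. -/
theorem not_opposite_of_edist_le_of_maximal {k : ℕ} (hk : k + 1 = n) {S T : X.Grassmannian k}
    (hd : (X.grassmannGraph n k).edist S T ≤ (k : ℕ∞)) : ¬ X.Opposite S.1.1 T.1.1 := by
  obtain ⟨w, hw⟩ := exists_walk_of_edist_le hd
  have hrS := h.rk_grassmannian S
  have h1 := h.rk_le_of_walk (by omega) w S.1.2 subset_rfl
  obtain ⟨p, hpS, hpT⟩ := h.nonempty_of_rk_pos (S.1.2.inter_subspace T.1.2.1)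
    (by omega : 0 < X.rk (S.1.1 ∩ T.1.1))
  exact fun hopp => hopp p hpT (S.1.2.subset_perp hpS)

/-- The vertex of the Grassmannian given by a singular subspace of rank `k + 1`. -/
def vertex {k : ℕ} {A : Set P} (hA : X.IsSingularSubspace A) (hr : X.rk A = k + 1) :
    X.Grassmannian k :=
  ⟨⟨A, hA⟩, (h.hasDim_iff _ _).mpr (by rw [hr]; push_cast; ring)⟩

omit h in
theorem edist_le_succ {V : Type*} {G : SimpleGraph V} {u v w : V} {m : ℕ} (huv : G.Adj u v)
    (hm : G.edist v w ≤ (m : ℕ∞)) : G.edist u w ≤ ((m + 1 : ℕ) : ℕ∞) := by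
  obtain ⟨p, hp⟩ := exists_walk_of_edist_le hm
  refine (SimpleGraph.edist_le (SimpleGraph.Walk.cons huv p)).trans ?_
  rw [SimpleGraph.Walk.length_cons]
  exact_mod_cast Nat.succ_le_succ hp

theorem subset_of_rk_inter {A B : Set P} (hA : X.IsSingularSubspace A)
    (hB : X.IsSingularSubspace B) (hr : X.rk A ≤ X.rk (A ∩ B)) : A ⊆ B :=
  Set.inter_eq_left.mp (h.eq_of_subset (hA.inter_subspace hB.1) hA Set.inter_subset_left hr)

/-- A greedy walk. Pick q ∈ T outside the cone of p over S ∩ T, and a hyperplane H of S with S ∩ T ⊆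
H ⊆ q^⊥. The cone of p over H is adjacent to S, meets T in p as well as in S ∩ T, and has q in the
role of p for the next step. -/
theorem edist_le_of_mem_perp {k : ℕ} (hk : k + 2 ≤ n) (m : ℕ) (S T : X.Grassmannian k)
    (hm : k + 1 ≤ X.rk (S.1.1 ∩ T.1.1) + m) {p : P} (hpT : p ∈ T.1.1) (hpS : p ∉ S.1.1)
    (hp : p ∈ X.perp S.1.1) : (X.grassmannGraph n k).edist S T ≤ (m : ℕ∞) := by
  induction m generalizing S p with
  | zero =>
    have h1 := h.rk_grassmannian T
    have h2 : T.1.1 ⊆ S.1.1 := h.subset_of_rk_inter T.1.2 S.1.2 (by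
      rw [Set.inter_comm]; omega)
    exact absurd (h2 hpT) hpS
  | succ m ih =>
    have hrS := h.rk_grassmannian S
    have hrT := h.rk_grassmannian T
    have hI : X.IsSingularSubspace (S.1.1 ∩ T.1.1) := S.1.2.inter_subspace T.1.2.1
    have hpI : p ∈ X.perp (S.1.1 ∩ T.1.1) := fun a ha => hp a ha.1
    have hpI' : p ∉ S.1.1 ∩ T.1.1 := fun hh => hpS hh.1
    have hc := h.cone_isSingularSubspace hI hpI hpI'
    have hrc := h.rk_cone hI hpI hpI'
    have hcT : X.cone p (S.1.1 ∩ T.1.1) ⊆ T.1.1 :=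
      IsShultSpace.cone_subset T.1.2.1 hpI' Set.inter_subset_right hpT
    have hU := h.cone_isSingularSubspace S.1.2 hp hpS
    have hrU := h.rk_cone S.1.2 hp hpS
    have hSU : S.1.1 ⊆ X.cone p S.1.1 := IsShultSpace.subset_cone hp
    have hpU : p ∈ X.cone p S.1.1 := IsShultSpace.self_mem_cone X p _
    by_cases hTc : T.1.1 ⊆ X.cone p (S.1.1 ∩ T.1.1)
    · have hadj : (X.grassmannGraph n k).Adj S T := by
        rw [h.adj_iff_joint hk]
        refine ⟨?_, X.cone p S.1.1, hU, by omega, hSU, hTc.trans ?_⟩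
        · rintro rfl
          exact hpS hpT
        · exact IsShultSpace.cone_subset hU.1 hpI' (Set.inter_subset_left.trans hSU) hpU
      have h1 := SimpleGraph.edist_le (SimpleGraph.Walk.cons hadj SimpleGraph.Walk.nil)
      refine h1.trans ?_
      rw [SimpleGraph.Walk.length_cons, SimpleGraph.Walk.length_nil]
      exact_mod_cast Nat.succ_le_succ (Nat.zero_le m)
    · obtain ⟨q, hqT, hqc⟩ := Set.not_subset.mp hTc
      have hIr : X.rk (S.1.1 ∩ T.1.1) ≤ k := by
        by_contra hcon
        have := h.subset_of_rk_inter T.1.2 S.1.2 (by rw [Set.inter_comm]; omega)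
        exact hpS (this hpT)
      have h1 := h.rk_le_rk_inter_perp S.1.2 q
      have hSq : X.IsSingularSubspace (S.1.1 ∩ X.perp {q}) :=
        S.1.2.inter_subspace (h.isSubspace_perp _)
      obtain ⟨H, hH, hIH, hHq, hrH⟩ := h.exists_between hI hSq (m := k) (by
        rintro a ⟨haS, haT⟩
        refine ⟨haS, ?_⟩
        rintro b rfl
        exact T.1.2.2 a haT b hqT) hIr (by omega)
      have hHS : H ⊆ S.1.1 := fun a ha => (hHq ha).1
      have hpH : p ∈ X.perp H := fun a ha => hp a (hHS ha)
      have hpH' : p ∉ H := fun hh => hpS (hHS hh)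
      have hX1 := h.cone_isSingularSubspace hH hpH hpH'
      have hr1 := h.rk_cone hH hpH hpH'
      let S' := h.vertex (k := k) hX1 (by omega)
      have hadj : (X.grassmannGraph n k).Adj S S' := by
        rw [h.adj_iff_joint hk]
        refine ⟨?_, X.cone p S.1.1, hU, by omega, hSU,
          IsShultSpace.cone_subset hU.1 hpH' (hHS.trans hSU) hpU⟩
        intro hh
        apply hpS
        rw [hh]
        exact IsShultSpace.self_mem_cone X p _
      refine edist_le_succ hadj (ih S' ?_ hqT ?_ ?_)
      · have h2 : X.cone p (S.1.1 ∩ T.1.1) ⊆ S'.1.1 ∩ T.1.1 :=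
          Set.subset_inter (IsShultSpace.cone_subset hX1.1 hpI'
            (hIH.trans (IsShultSpace.subset_cone hpH)) (IsShultSpace.self_mem_cone X p _)) hcT
        have h3 := h.rk_mono hc (S'.1.2.inter_subspace T.1.2.1) h2
        omega
      · rintro (rfl | ⟨a, ha, L, hL, hpL, haL, hqL⟩)
        · exact hqc (IsShultSpace.self_mem_cone X q _)
        · by_cases hqp : q = p
          · exact hqc (Or.inl hqp)
          have haT : a ∈ T.1.1 := T.1.2.1 q hqT p hpT hqp L hL hqL hpL haL
          exact hqc (Or.inr ⟨a, ⟨hHS ha, haT⟩, L, hL, hpL, haL, hqL⟩)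
      · have h3 : X.cone p H ⊆ X.perp {q} := h.cone_subset_perp hpH'
          (fun a ha => (hHq ha).2) (by
            rintro b rfl
            exact T.1.2.2 p hpT b hqT)
        exact fun a ha => (h3 ha q rfl).symm

/-- The extra step stays inside a subspace of rank `k + 2` through S. It moves S into q^⊥ for some q
∈ T while keeping S ∩ T, after which `edist_le_of_mem_perp` applies. -/
theorem edist_le_of_rk_inter {k : ℕ} (hk : k + 2 ≤ n) (m : ℕ) (S T : X.Grassmannian k)
    (hm : k + 1 ≤ X.rk (S.1.1 ∩ T.1.1) + m) :
    (X.grassmannGraph n k).edist S T ≤ ((m + 1 : ℕ) : ℕ∞) := by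
  have hrS := h.rk_grassmannian S
  have hrT := h.rk_grassmannian T
  by_cases hTS : T.1.1 ⊆ S.1.1
  · have : T = S := Subtype.ext (Subtype.ext (h.eq_of_subset T.1.2 S.1.2 hTS (by omega)))
    rw [this, SimpleGraph.edist_self]
    exact bot_le
  obtain ⟨q, hqT, hqS⟩ := Set.not_subset.mp hTS
  by_cases hq : q ∈ X.perp S.1.1
  · refine (h.edist_le_of_mem_perp hk m S T hm hqT hqS hq).trans ?_
    exact_mod_cast Nat.le_succ m
  obtain ⟨p, hpS, hp⟩ := h.exists_extension _ S.1.2 (by omega)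
  have hU := h.cone_isSingularSubspace S.1.2 hp hpS
  have hrU := h.rk_cone S.1.2 hp hpS
  have hSU : S.1.1 ⊆ X.cone p S.1.1 := IsShultSpace.subset_cone hp
  have h1 := h.rk_le_rk_inter_perp hU q
  have hI : X.IsSingularSubspace (S.1.1 ∩ T.1.1) := S.1.2.inter_subspace T.1.2.1
  have hIr := h.rk_mono hI S.1.2 Set.inter_subset_left
  obtain ⟨H, hH, hIH, hHq, hrH⟩ := h.exists_between hI
    (hU.inter_subspace (h.isSubspace_perp {q})) (m := k + 1) (by
      rintro a ⟨haS, haT⟩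
      refine ⟨hSU haS, ?_⟩
      rintro b rfl
      exact T.1.2.2 a haT b hqT) (by omega) (by omega)
  have hqH : q ∈ X.perp H := fun a ha => ((hHq ha).2 q rfl).symm
  let S' := h.vertex (k := k) hH hrH
  have hadj : (X.grassmannGraph n k).Adj S S' := by
    rw [h.adj_iff_joint hk]
    refine ⟨?_, X.cone p S.1.1, hU, by omega, hSU, fun a ha => (hHq ha).1⟩
    intro hh
    apply hq
    rw [hh]
    exact hqH
  refine edist_le_succ hadj (h.edist_le_of_mem_perp hk m S' T ?_ hqT ?_ hqH)
  · have h3 : X.rk (S.1.1 ∩ T.1.1) ≤ X.rk (S'.1.1 ∩ T.1.1) :=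
      h.rk_mono hI (S'.1.2.inter_subspace T.1.2.1) fun a ha => ⟨hIH ha, ha.2⟩
    omega
  · intro hqH'
    exact hq fun a ha => hU.2 q (hHq hqH').1 a (hSU ha)

theorem edist_le_of_not_opposite {k : ℕ} (hk : k + 2 ≤ n) {S T : X.Grassmannian k}
    (hopp : ¬ X.Opposite S.1.1 T.1.1) :
    (X.grassmannGraph n k).edist S T ≤ ((k + 1 : ℕ) : ℕ∞) := by
  rw [Opposite] at hopp
  push Not at hopp
  obtain ⟨p, hpT, hp⟩ := hopp
  by_cases hpS : p ∈ S.1.1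
  · refine h.edist_le_of_rk_inter hk k S T ?_
    have := h.rk_pos (S.1.2.inter_subspace T.1.2.1) ⟨p, hpS, hpT⟩
    omega
  · exact h.edist_le_of_mem_perp hk (k + 1) S T (by omega) hpT hpS hp

/-- S is replaced by the cone of some q ∈ T∖S over S ∩ q^⊥. Since S ∩ T ⊆ q^⊥, the intersection with
T is kept and gains q. -/
theorem edist_le_of_rk_inter_of_maximal {k : ℕ} (hk : k + 1 = n) (m : ℕ) (S T : X.Grassmannian k)
    (hm : k + 1 ≤ X.rk (S.1.1 ∩ T.1.1) + m) :
    (X.grassmannGraph n k).edist S T ≤ (m : ℕ∞) := by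
  induction m generalizing S with
  | zero =>
    have h1 := h.rk_grassmannian T
    have h2 : T.1.1 ⊆ S.1.1 := h.subset_of_rk_inter T.1.2 S.1.2 (by
      rw [Set.inter_comm]; omega)
    have hrS := h.rk_grassmannian S
    have : T = S := Subtype.ext (Subtype.ext (h.eq_of_subset T.1.2 S.1.2 h2 (by omega)))
    rw [this, SimpleGraph.edist_self]
    exact bot_le
  | succ m ih =>
    have hrS := h.rk_grassmannian S
    have hrT := h.rk_grassmannian T
    by_cases hTS : T.1.1 ⊆ S.1.1
    · have : T = S := Subtype.ext (Subtype.ext (h.eq_of_subset T.1.2 S.1.2 hTS (by omega)))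
      rw [this, SimpleGraph.edist_self]
      exact bot_le
    obtain ⟨q, hqT, hqS⟩ := Set.not_subset.mp hTS
    have hSq : X.IsSingularSubspace (S.1.1 ∩ X.perp {q}) :=
      S.1.2.inter_subspace (h.isSubspace_perp _)
    have h1 := h.rk_le_rk_inter_perp S.1.2 q
    have hqI : q ∈ X.perp (S.1.1 ∩ X.perp {q}) := fun a ha => (ha.2 q rfl).symm
    have hqI' : q ∉ S.1.1 ∩ X.perp {q} := fun hh => hqS hh.1
    have hc := h.cone_isSingularSubspace hSq hqI hqI'
    have hrc := h.rk_cone hSq hqI hqI'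
    have hlt : X.rk (S.1.1 ∩ X.perp {q}) < k + 1 := by
      have := h.rk_le _ hc
      omega
    let S' := h.vertex (k := k) hc (by omega)
    have hqS' : q ∈ S'.1.1 := IsShultSpace.self_mem_cone X q _
    have hSI : S.1.1 ∩ X.perp {q} ⊆ S'.1.1 := IsShultSpace.subset_cone hqI
    have hadj : (X.grassmannGraph n k).Adj S S' := by
      rw [h.adj_iff_inter hk]
      have hne : S ≠ S' := by
        intro hh
        apply hqS
        rw [hh]
        exact hqS'
      refine ⟨hne, le_antisymm ?_ ?_⟩
      · by_contra hcon
        have h4 := h.subset_of_rk_inter S.1.2 S'.1.2 (by omega)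
        exact hne (Subtype.ext (Subtype.ext (h.eq_of_subset S.1.2 S'.1.2 h4
          (by rw [hrS, h.rk_grassmannian]))))
      · have h3 := h.rk_mono hSq (S.1.2.inter_subspace S'.1.2.1)
          (Set.subset_inter Set.inter_subset_left hSI)
        omega
    refine edist_le_succ hadj (ih S' ?_)
    have hI : X.IsSingularSubspace (S.1.1 ∩ T.1.1) := S.1.2.inter_subspace T.1.2.1
    have hqT' : q ∈ X.perp (S.1.1 ∩ T.1.1) := fun a ha => T.1.2.2 q hqT a ha.2
    have hqT'' : q ∉ S.1.1 ∩ T.1.1 := fun hh => hqS hh.1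
    have h5 := h.rk_cone hI hqT' hqT''
    have h6 : X.cone q (S.1.1 ∩ T.1.1) ⊆ S'.1.1 ∩ T.1.1 :=
      IsShultSpace.cone_subset (S'.1.2.inter_subspace T.1.2.1).1 hqT'' (by
        rintro a ⟨haS, haT⟩
        refine ⟨hSI ⟨haS, ?_⟩, haT⟩
        rintro b rfl
        exact T.1.2.2 a haT b hqT) ⟨hqS', hqT⟩
    have h7 := h.rk_mono (h.cone_isSingularSubspace hI hqT' hqT'')
      (S'.1.2.inter_subspace T.1.2.1) h6
    omega

theorem edist_le_of_not_opposite_of_maximal {k : ℕ} (hk : k + 1 = n) {S T : X.Grassmannian k}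
    (hopp : ¬ X.Opposite S.1.1 T.1.1) :
    (X.grassmannGraph n k).edist S T ≤ (k : ℕ∞) := by
  rw [Opposite] at hopp
  push Not at hopp
  obtain ⟨p, hpT, hp⟩ := hopp
  have hpS : p ∈ S.1.1 := h.mem_of_mem_perp S.1.2 (by rw [h.rk_grassmannian, hk]) hp
  refine h.edist_le_of_rk_inter_of_maximal hk k S T ?_
  have := h.rk_pos (S.1.2.inter_subspace T.1.2.1) ⟨p, hpS, hpT⟩
  omega

/-- Opposition is determined by the distance in the Grassmann graph. -/
theorem edist_le_iff {k : ℕ} (hk : k < n) (S T : X.Grassmannian k) :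
    (X.grassmannGraph n k).edist S T ≤ ((if k + 1 = n then k else k + 1 : ℕ) : ℕ∞) ↔
      ¬ X.Opposite S.1.1 T.1.1 := by
  -- The threshold is one smaller in the maximal case, where a point collinear to all of S already
  -- lies in S.
  split_ifs with hk'
  · exact ⟨h.not_opposite_of_edist_le_of_maximal hk', h.edist_le_of_not_opposite_of_maximal hk'⟩
  · exact ⟨h.not_opposite_of_edist_le (by omega), h.edist_le_of_not_opposite (by omega)⟩

end IsPolarLike

end PartialLinearSpace

/-! ### Faces of the cross-polytope and configurations -/

namespace PartialLinearSpace

variable {P Q : Type*} {n : ℕ}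

@[simp] theorem antipode_antipode (i : Fin n × Bool) : antipode (antipode i) = i := by
  simp [antipode]

theorem antipode_ne (i : Fin n × Bool) : antipode i ≠ i := by
  intro hh
  have := congrArg Prod.snd hh
  simp [antipode] at this

theorem antipode_injective : Function.Injective (antipode (n := n)) := fun i j hij => by
  rw [← antipode_antipode i, hij, antipode_antipode]

theorem antipode_eq_iff {i j : Fin n × Bool} : antipode i = j ↔ i = antipode j :=
  ⟨fun hh => by rw [← hh, antipode_antipode], fun hh => by rw [hh, antipode_antipode]⟩

theorem eq_or_eq_antipode {i j : Fin n × Bool} (hij : i.1 = j.1) : i = j ∨ i = antipode j := by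
  obtain ⟨a, b⟩ := i
  obtain ⟨c, d⟩ := j
  obtain rfl : a = c := hij
  cases b <;> cases d <;> simp [antipode]

/-- The faces with `m` vertices of the cross-polytope with vertices `±1, …, ±n`. -/
structure IsFace (m : ℕ) (S : Finset (Fin n × Bool)) : Prop where
  antipode_notMem : ∀ i ∈ S, antipode i ∉ S
  card_eq : S.card = m

/-- The antipodal set. -/
def opp (S : Finset (Fin n × Bool)) : Finset (Fin n × Bool) := S.image antipode

theorem mem_opp {S : Finset (Fin n × Bool)} {i : Fin n × Bool} : i ∈ opp S ↔ antipode i ∈ S := by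
  simp only [opp, Finset.mem_image]
  constructor
  · rintro ⟨j, hj, rfl⟩
    rwa [antipode_antipode]
  · exact fun hi => ⟨_, hi, antipode_antipode i⟩

@[simp] theorem opp_opp (S : Finset (Fin n × Bool)) : opp (opp S) = S := by
  ext i
  rw [mem_opp, mem_opp, antipode_antipode]

theorem card_opp (S : Finset (Fin n × Bool)) : (opp S).card = S.card :=
  Finset.card_image_of_injective _ antipode_injective

theorem opp_injective : Function.Injective (opp (n := n)) := fun S T hST => by
  rw [← opp_opp S, hST, opp_opp]

namespace IsFace

variable {m : ℕ} {S : Finset (Fin n × Bool)}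

protected theorem opp (hS : IsFace m S) : IsFace m (opp S) :=
  ⟨fun _ hi hi' => hS.antipode_notMem _ (mem_opp.mp hi) (mem_opp.mp hi'),
    (card_opp S).trans hS.card_eq⟩

theorem injOn_fst (hS : IsFace m S) : Set.InjOn Prod.fst (S : Set (Fin n × Bool)) := by
  intro i hi j hj hij
  rcases eq_or_eq_antipode hij with h1 | rfl
  · exact h1
  · exact absurd hi (hS.antipode_notMem j hj)

theorem card_image_fst (hS : IsFace m S) : (S.image Prod.fst).card = m :=
  (Finset.card_image_of_injOn hS.injOn_fst).trans hS.card_eq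

theorem le (hS : IsFace m S) : m ≤ n := by
  rw [← hS.card_image_fst]
  exact (Finset.card_le_univ _).trans (by simp)

theorem exists_notMem (hS : IsFace m S) (hm : m < n) : ∃ c, c ∉ S ∧ antipode c ∉ S := by
  obtain ⟨i, hi⟩ : ∃ i, i ∉ S.image Prod.fst := by
    by_contra! hcon
    have : S.image Prod.fst = Finset.univ := Finset.eq_univ_iff_forall.mpr hcon
    have h2 := hS.card_image_fst
    rw [this] at h2
    simp at h2
    omega
  refine ⟨(i, true), fun hh => hi ?_, fun hh => hi ?_⟩
  · exact Finset.mem_image.mpr ⟨_, hh, rfl⟩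
  · exact Finset.mem_image.mpr ⟨_, hh, rfl⟩

theorem mem_or_antipode_mem (hS : IsFace n S) (c : Fin n × Bool) : c ∈ S ∨ antipode c ∈ S := by
  have : S.image Prod.fst = Finset.univ := by
    rw [← Finset.card_eq_iff_eq_univ, hS.card_image_fst, Fintype.card_fin]
  obtain ⟨i, hi, hic⟩ := Finset.mem_image.mp (this ▸ Finset.mem_univ c.1)
  rcases eq_or_eq_antipode hic with rfl | rfl
  · exact Or.inl hi
  · exact Or.inr hi

protected theorem insert (hS : IsFace m S) {c : Fin n × Bool} (hc : c ∉ S) (hc' : antipode c ∉ S) :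
    IsFace (m + 1) (insert c S) := by
  refine ⟨fun i hi hi' => ?_, by rw [Finset.card_insert_of_notMem hc, hS.card_eq]⟩
  rcases Finset.mem_insert.mp hi with rfl | hi
  · rcases Finset.mem_insert.mp hi' with h1 | h1
    · exact antipode_ne _ h1
    · exact hc' h1
  · rcases Finset.mem_insert.mp hi' with h1 | h1
    · rw [antipode_eq_iff] at h1
      exact hc' (h1 ▸ hi)
    · exact hS.antipode_notMem i hi h1

protected theorem erase {a : Fin n × Bool} (hS : IsFace (m + 1) S) (ha : a ∈ S) :
    IsFace m (S.erase a) :=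
  ⟨fun i hi hi' => hS.antipode_notMem i (Finset.mem_of_mem_erase hi)
    (Finset.mem_of_mem_erase hi'), by rw [Finset.card_erase_of_mem ha, hS.card_eq]; rfl⟩

theorem of_insert {c : Fin n × Bool} (hS : IsFace (m + 1) (insert c S)) (hc : c ∉ S) :
    IsFace m S := by
  have := hS.erase (Finset.mem_insert_self c S)
  rwa [Finset.erase_insert hc] at this

theorem antipode_notMem_of_insert {c : Fin n × Bool} (hS : IsFace m (insert c S)) :
    antipode c ∉ S :=
  fun hh => hS.antipode_notMem c (Finset.mem_insert_self c S) (Finset.mem_insert_of_mem hh)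

theorem insert_antipode {c : Fin n × Bool} (hS : IsFace (m + 1) (insert c S))
    (hc : c ∉ S) : IsFace (m + 1) (insert (antipode c) S) :=
  (hS.of_insert hc).insert hS.antipode_notMem_of_insert (by rwa [antipode_antipode])

theorem mono {T : Finset (Fin n × Bool)} (hS : IsFace m S) (hTS : T ⊆ S) : IsFace T.card T :=
  ⟨fun i hi hi' => hS.antipode_notMem i (hTS hi) (hTS hi'), rfl⟩

end IsFace

/-- The hypotheses under which images of thin polar spaces are studied: a family of singular
subspaces indexed by the faces with `k + 1` vertices, with the adjacency and opposition relations
of the faces. -/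
structure IsConfiguration (X : PartialLinearSpace P) (n k : ℕ)
    (x : Finset (Fin n × Bool) → Set P) : Prop where
  sing : ∀ S, IsFace (k + 1) S → X.IsSingularSubspace (x S)
  rk_eq : ∀ S, IsFace (k + 1) S → X.rk (x S) = k + 1
  joint_iff : ∀ S T, IsFace (k + 1) S → IsFace (k + 1) T →
    (X.Joint (k + 2) (x S) (x T) ↔ ∃ W, IsFace (k + 2) W ∧ S ⊆ W ∧ T ⊆ W)
  hinge : k + 1 = n → ∀ R c, c ∉ R → IsFace (k + 1) (insert c R) →
    k ≤ X.rk (x (insert c R) ∩ x (insert (antipode c) R))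
  opposite_iff : ∀ S T, IsFace (k + 1) S → IsFace (k + 1) T →
    (X.Opposite (x S) (x T) ↔ T = opp S)

/-- `p` parametrizes the points of `T` such that the lines are the pairs of points that are not
antipodal. -/
structure IsThinParam (T : PartialLinearSpace Q) (p : (Fin n × Bool) ≃ Q) : Prop where
  mem_lines : ∀ L, L ∈ T.lines ↔ ∃ i j, i ≠ j ∧ j ≠ antipode i ∧ L = {p i, p j}

theorem IsThinPolarSpace.exists_param {T : PartialLinearSpace Q} (hT : T.IsThinPolarSpace n) :
    2 ≤ n ∧ ∃ p : (Fin n × Bool) ≃ Q, T.IsThinParam p := by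
  obtain ⟨hn, α, hα⟩ := hT
  refine ⟨hn, α.symm, ⟨fun L => ?_⟩⟩
  have h1 : L ∈ T.lines ↔ α '' L ∈ (thinPolarSpace n hn).lines := by
    rw [← hα]
    constructor
    · exact fun hL => ⟨L, hL, rfl⟩
    · rintro ⟨M, hM, hML⟩
      rwa [← α.injective.image_injective hML]
  rw [h1]
  constructor
  · rintro ⟨i, j, hij, hj, hL⟩
    refine ⟨i, j, hij, hj, ?_⟩
    have : α.symm '' (α '' L) = L := by rw [Equiv.symm_image_image]
    rw [← this, hL, Set.image_pair]
  · rintro ⟨i, j, hij, hj, rfl⟩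
    exact ⟨i, j, hij, hj, by simp [Set.image_pair]⟩

/-! ### Thin polar spaces, and the configuration of an isometric embedding -/

namespace IsThinParam

variable {T : PartialLinearSpace Q} {p : (Fin n × Bool) ≃ Q} (hp : T.IsThinParam p)
include hp

theorem collinear_iff {i j : Fin n × Bool} : T.Collinear (p i) (p j) ↔ j ≠ antipode i := by
  constructor
  · rintro ⟨L, hL, hi, hj⟩ hij
    obtain ⟨a, b, hab, hb, rfl⟩ := (hp.mem_lines L).mp hL
    simp only [Set.mem_insert_iff, Set.mem_singleton_iff, p.injective.eq_iff] at hi hj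
    subst hij
    rcases hi with rfl | rfl <;> rcases hj with hj | hj
    · exact antipode_ne _ hj
    · exact hb hj.symm
    · exact hb (antipode_eq_iff.mp hj)
    · exact antipode_ne _ hj
  · intro hj
    by_cases hij : i = j
    · subst hij
      exact T.collinear_refl _
    · exact ⟨{p i, p j}, (hp.mem_lines _).mpr ⟨i, j, hij, hj, rfl⟩, Or.inl rfl, Or.inr rfl⟩

theorem isShultSpace : T.IsShultSpace := by
  constructor
  · intro q L hL
    obtain ⟨i, j, hij, hj, rfl⟩ := (hp.mem_lines L).mp hL
    obtain ⟨l, rfl⟩ := p.surjective q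
    by_cases hi : i = antipode l
    · left
      refine ⟨p j, ⟨Or.inr rfl, hp.collinear_iff.mpr fun hh => hij (hi.trans hh.symm)⟩, ?_⟩
      rintro _ ⟨rfl | rfl, hc⟩
      · exact absurd hi (hp.collinear_iff.mp hc)
      · rfl
    by_cases hj' : j = antipode l
    · left
      refine ⟨p i, ⟨Or.inl rfl, hp.collinear_iff.mpr hi⟩, ?_⟩
      rintro _ ⟨rfl | rfl, hc⟩
      · rfl
      · exact absurd hj' (hp.collinear_iff.mp hc)
    · right
      rintro _ (rfl | rfl)
      · exact hp.collinear_iff.mpr hi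
      · exact hp.collinear_iff.mpr hj'
  · intro q
    obtain ⟨l, rfl⟩ := p.surjective q
    exact ⟨p (antipode l), fun hc => hp.collinear_iff.mp hc rfl⟩

/-- Lines have only two points, so closure under lines is no condition. -/
theorem isSubspace (A : Set Q) : T.IsSubspace A := by
  intro a ha b hb hab L hL haL hbL
  obtain ⟨i, j, -, -, rfl⟩ := (hp.mem_lines L).mp hL
  rcases haL with rfl | rfl <;> rcases hbL with rfl | rfl
  · exact absurd rfl hab
  · rintro _ (rfl | rfl) <;> assumption
  · rintro _ (rfl | rfl) <;> assumption
  · exact absurd rfl hab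

theorem isSingularSubspace_iff {S : Finset (Fin n × Bool)} :
    T.IsSingularSubspace (p '' S) ↔ IsFace S.card S := by
  constructor
  · rintro ⟨-, hS⟩
    exact ⟨fun i hi hi' => hp.collinear_iff.mp
      (hS _ (Set.mem_image_of_mem p hi) _ (Set.mem_image_of_mem p hi')) rfl, rfl⟩
  · intro hS
    refine ⟨hp.isSubspace _, ?_⟩
    rintro _ ⟨i, hi, rfl⟩ _ ⟨j, hj, rfl⟩
    refine hp.collinear_iff.mpr ?_
    rintro rfl
    exact hS.antipode_notMem i hi hj

omit hp in
theorem exists_finset (p : (Fin n × Bool) ≃ Q) (A : Set Q) :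
    ∃ S : Finset (Fin n × Bool), A = p '' S := by
  classical
  refine ⟨Set.toFinset (p ⁻¹' A), ?_⟩
  rw [Set.coe_toFinset, Set.image_preimage_eq _ p.surjective]

/-- Cardinality is strictly monotone, which bounds the height above; subsets of a face are singular,
so adding its points one by one gives a chain of full length. -/
theorem height_eq {S : Finset (Fin n × Bool)} (hS : T.IsSingularSubspace (p '' S)) :
    Order.height (⟨_, hS⟩ : T.SingularSubspace) = (S.card : ℕ∞) := by
  apply le_antisymm
  · have hfin : Finite Q := Finite.of_equiv _ p
    let g : T.SingularSubspace → ℕ := fun A => A.1.ncard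
    have hg : StrictMono g := by
      intro A B hAB
      exact Set.ncard_lt_ncard hAB (Set.toFinite _)
    have h1 := Order.height_le_height_apply_of_strictMono g hg ⟨_, hS⟩
    rw [Order.height_nat] at h1
    refine h1.trans ?_
    have : g ⟨_, hS⟩ = S.card := by
      simp only [g]
      rw [Set.ncard_image_of_injective _ p.injective, Set.ncard_coe_finset]
    rw [this]
  · induction S using Finset.induction_on with
    | empty => simp
    | insert a S ha ih =>
      have hS' : T.IsSingularSubspace (p '' S) := by
        have := hp.isSingularSubspace_iff.mp hS
        exact hp.isSingularSubspace_iff.mpr (this.mono (Finset.subset_insert a S))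
      have hlt : (⟨_, hS'⟩ : T.SingularSubspace) < ⟨_, hS⟩ := by
        refine lt_of_le_of_ne ?_ ?_
        · exact Set.image_mono (by simp)
        · intro hh
          have h1 := congrArg Subtype.val hh
          have h2 := p.injective.image_injective h1
          exact ha (by
            have : a ∈ ((insert a S : Finset _) : Set (Fin n × Bool)) := by simp
            rw [← h2] at this
            exact this)
      rw [Finset.card_insert_of_notMem ha]
      refine le_trans ?_ (Order.height_add_one_le hlt)
      push_cast
      gcongr
      exact ih hS'

theorem rk_eq {S : Finset (Fin n × Bool)} (hS : IsFace S.card S) : T.rk (p '' S) = S.card := by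
  have hS' := hp.isSingularSubspace_iff.mpr hS
  rw [rk, dif_pos hS', hp.height_eq hS']
  rfl

theorem isPolarLike : T.IsPolarLike n := by
  refine { hp.isShultSpace with height_ne_top := ?_, rk_le := ?_, exists_extension := ?_ }
  · rintro ⟨A, hA⟩
    obtain ⟨S, rfl⟩ := exists_finset p A
    rw [hp.height_eq hA]
    simp
  · intro A hA
    obtain ⟨S, rfl⟩ := exists_finset p A
    have hS := hp.isSingularSubspace_iff.mp hA
    rw [hp.rk_eq hS]
    exact hS.le
  · intro A hA hlt
    obtain ⟨S, rfl⟩ := exists_finset p A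
    have hS := hp.isSingularSubspace_iff.mp hA
    rw [hp.rk_eq hS] at hlt
    obtain ⟨c, hc, hc'⟩ := hS.exists_notMem hlt
    refine ⟨p c, ?_, ?_⟩
    · rintro ⟨i, hi, hic⟩
      exact hc (p.injective hic ▸ hi)
    · rintro _ ⟨i, hi, rfl⟩
      refine hp.collinear_iff.mpr ?_
      rintro rfl
      exact hc' hi

theorem joint_iff {m : ℕ} {S S' : Finset (Fin n × Bool)} :
    T.Joint m (p '' S) (p '' S') ↔ ∃ W, IsFace m W ∧ S ⊆ W ∧ S' ⊆ W := by
  constructor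
  · rintro ⟨U, hU, hr, hS, hS'⟩
    obtain ⟨W, rfl⟩ := exists_finset p U
    have hW := hp.isSingularSubspace_iff.mp hU
    rw [hp.rk_eq hW] at hr
    subst hr
    rw [Set.image_subset_image_iff p.injective] at hS hS'
    exact ⟨W, hW, Finset.coe_subset.mp hS, Finset.coe_subset.mp hS'⟩
  · rintro ⟨W, hW, hS, hS'⟩
    have hc := hW.card_eq
    subst hc
    exact ⟨p '' W, hp.isSingularSubspace_iff.mpr hW, hp.rk_eq hW,
      Set.image_mono (Finset.coe_subset.mpr hS), Set.image_mono (Finset.coe_subset.mpr hS')⟩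

theorem opposite_iff {m : ℕ} {S S' : Finset (Fin n × Bool)} (hS : IsFace m S)
    (hS' : IsFace m S') : T.Opposite (p '' S) (p '' S') ↔ S' = opp S := by
  constructor
  · intro ho
    refine Finset.eq_of_subset_of_card_le ?_ ?_
    · intro j hj
      have h1 := ho (p j) (Set.mem_image_of_mem p hj)
      rw [mem_perp] at h1
      push Not at h1
      obtain ⟨_, ⟨i, hi, rfl⟩, hc⟩ := h1
      rw [hp.collinear_iff, not_not] at hc
      rw [mem_opp, ← hc]
      exact hi
    · rw [card_opp, hS.card_eq, hS'.card_eq]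
  · rintro rfl _ ⟨j, hj, rfl⟩ hperp
    rw [Finset.mem_coe, mem_opp] at hj
    exact hp.collinear_iff.mp (hperp _ (Set.mem_image_of_mem p hj)) rfl

-- Opposition is a bound on the distance by `edist_le_iff`, with the same bound in both spaces, so
-- the isometry transports it. The clauses on joins and hinges come from adjacency alone.
open Classical in
theorem exists_isConfiguration {X : PartialLinearSpace P} (hX : X.IsPolarLike n) {k : ℕ}
    (hk : k < n) (f : T.grassmannGraph n k ↪g X.grassmannGraph n k)
    (hf : IsIsometricEmbedding f) :
    ∃ x : Finset (Fin n × Bool) → Set P, X.IsConfiguration n k x ∧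
      Set.range f = {S | ∃ A, IsFace (k + 1) A ∧ S.1.1 = x A} := by
  have hT := hp.isPolarLike
  have hsing : ∀ S : Finset (Fin n × Bool), IsFace (k + 1) S → T.IsSingularSubspace (p '' S) :=
    fun S hS => hp.isSingularSubspace_iff.mpr (hS.mono subset_rfl)
  have hrk : ∀ S : Finset (Fin n × Bool), IsFace (k + 1) S → T.rk (p '' S) = k + 1 :=
    fun S hS => (hp.rk_eq (hS.mono subset_rfl)).trans hS.card_eq
  let v : ∀ S : Finset (Fin n × Bool), IsFace (k + 1) S → T.Grassmannian k :=
    fun S hS => hT.vertex (hsing S hS) (hrk S hS)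
  have hv : ∀ S hS, (v S hS).1.1 = p '' S := fun S hS => rfl
  have hvinj : ∀ S S' hS hS', v S hS = v S' hS' → S = S' := by
    intro S S' hS hS' hh
    have h1 : p '' S = p '' S' := congrArg (fun w => w.1.1) hh
    exact Finset.coe_injective (p.injective.image_injective h1)
  let x : Finset (Fin n × Bool) → Set P :=
    fun S => if hS : IsFace (k + 1) S then (f (v S hS)).1.1 else ∅
  have hx : ∀ S (hS : IsFace (k + 1) S), x S = (f (v S hS)).1.1 := fun S hS => dif_pos hS
  refine ⟨x, ⟨?_, ?_, ?_, ?_, ?_⟩, ?_⟩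
  · intro S hS
    rw [hx S hS]
    exact (f (v S hS)).1.2
  · intro S hS
    rw [hx S hS]
    exact hX.rk_grassmannian _
  · intro S S' hS hS'
    rcases Nat.lt_or_ge (k + 1) n with hk' | hk'
    -- Adjacency says nothing when the two faces agree; both sides then hold, because `k + 1 < n`
    -- leaves room for an extension.
    · by_cases hSS : S = S'
      · subst hSS
        constructor
        · intro _
          obtain ⟨c, hc, hc'⟩ := hS.exists_notMem hk'
          exact ⟨insert c S, hS.insert hc hc', Finset.subset_insert _ _,
            Finset.subset_insert _ _⟩
        · intro _
          rw [hx S hS]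
          obtain ⟨q, hq, hq'⟩ := hX.exists_extension _ (f (v S hS)).1.2
            (by rw [hX.rk_grassmannian]; exact hk')
          exact ⟨_, hX.cone_isSingularSubspace (f (v S hS)).1.2 hq' hq,
            by rw [hX.rk_cone (f (v S hS)).1.2 hq' hq, hX.rk_grassmannian],
            IsShultSpace.subset_cone hq', IsShultSpace.subset_cone hq'⟩
      · have hne : v S hS ≠ v S' hS' := fun hh => hSS (hvinj _ _ hS hS' hh)
        have h1 := hX.adj_iff_joint hk' (f (v S hS)) (f (v S' hS'))
        have h2 := hT.adj_iff_joint hk' (v S hS) (v S' hS')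
        rw [f.map_adj_iff, h2, hv S hS, hv S' hS', hp.joint_iff] at h1
        rw [hx S hS, hx S' hS']
        exact ⟨fun hJ => (h1.mpr ⟨f.injective.ne hne, hJ⟩).2, fun hJ => (h1.mp ⟨hne, hJ⟩).2⟩
    -- Here `k + 2` exceeds `n`, so both sides fail.
    · constructor
      · rintro ⟨U, hU, hr, -⟩
        have := hX.rk_le U hU
        omega
      · rintro ⟨W, hW, -⟩
        have := hW.le
        omega
  · intro hkn R c hc hR
    have hR' := hR.insert_antipode hc
    rw [hx _ hR, hx _ hR']
    have hne : insert c R ≠ insert (antipode c) R := by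
      intro hh
      have : c ∈ insert (antipode c) R := hh ▸ Finset.mem_insert_self c R
      rcases Finset.mem_insert.mp this with h1 | h1
      · exact antipode_ne c h1.symm
      · exact hc h1
    have hadj : (T.grassmannGraph n k).Adj (v _ hR) (v _ hR') := by
      rw [hT.adj_iff_inter hkn]
      refine ⟨fun hh => hne (hvinj _ _ hR hR' hh), ?_⟩
      rw [hv _ hR, hv _ hR', ← Set.image_inter p.injective, ← Finset.coe_inter]
      have h1 : insert c R ∩ insert (antipode c) R = R := by
        ext i
        simp only [Finset.mem_inter, Finset.mem_insert]
        constructor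
        · rintro ⟨rfl | h1, h2 | h2⟩
          · exact absurd h2.symm (antipode_ne _)
          · exact h2
          · exact h1
          · exact h1
        · exact fun hi => ⟨Or.inr hi, Or.inr hi⟩
      have hR0 := hR.of_insert hc
      rw [h1, hp.rk_eq (hR0.mono subset_rfl), hR0.card_eq]
    exact ((hX.adj_iff_inter hkn _ _).mp (f.map_adj_iff.mpr hadj)).2.ge
  · intro S S' hS hS'
    have h1 := hX.edist_le_iff hk (f (v S hS)) (f (v S' hS'))
    rw [hf, hT.edist_le_iff hk, not_iff_not] at h1
    rw [hx S hS, hx S' hS']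
    exact h1.symm.trans (hp.opposite_iff hS hS')
  · ext S
    constructor
    · rintro ⟨w, rfl⟩
      obtain ⟨A, hA⟩ := exists_finset p w.1.1
      have hA1 : IsFace A.card A := hp.isSingularSubspace_iff.mp (hA ▸ w.1.2)
      have hA2 : IsFace (k + 1) A := ⟨hA1.antipode_notMem, by
        rw [← hp.rk_eq hA1, ← hA, hT.rk_grassmannian]⟩
      have : w = v A hA2 := Subtype.ext (Subtype.ext hA)
      exact ⟨A, hA2, by rw [hx A hA2, this]⟩
    · rintro ⟨A, hA, hSA⟩
      rw [hx A hA] at hSA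
      exact ⟨v A hA, (Subtype.ext (Subtype.ext hSA)).symm⟩

end IsThinParam

end PartialLinearSpace

/-! ### Exchanging vertices of faces -/

namespace PartialLinearSpace

variable {P Q : Type*} {n : ℕ}

namespace IsFace

variable {m : ℕ} {S : Finset (Fin n × Bool)}

theorem singleton (i : Fin n × Bool) : IsFace 1 {i} :=
  ⟨fun j hj hj' => by
    rw [Finset.mem_singleton] at hj hj'
    exact antipode_ne j (hj'.trans hj.symm), Finset.card_singleton i⟩

theorem pair {i j : Fin n × Bool} (hij : i ≠ j) (hj : j ≠ antipode i) : IsFace 2 {i, j} :=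
  (singleton j).insert (by simpa using hij) (by simpa using hj.symm)

theorem exists_superset (hS : IsFace m S) {m' : ℕ} (hmm : m ≤ m') (hn : m' ≤ n) :
    ∃ W, IsFace m' W ∧ S ⊆ W := by
  induction m', hmm using Nat.le_induction with
  | base => exact ⟨S, hS, subset_rfl⟩
  | succ m' _ ih =>
    obtain ⟨W, hW, hSW⟩ := ih (by omega)
    obtain ⟨c, hc, hc'⟩ := hW.exists_notMem (by omega)
    exact ⟨insert c W, hW.insert hc hc', hSW.trans (Finset.subset_insert c W)⟩

theorem eq_of_subset {T : Finset (Fin n × Bool)} (hS : IsFace m S) (hT : IsFace m T)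
    (hST : S ⊆ T) : S = T :=
  Finset.eq_of_subset_of_card_le hST (by rw [hS.card_eq, hT.card_eq])

/-- Two faces are connected by a sequence of faces obtained by replacing one vertex; the common
vertices are kept. -/
theorem swap_induction (A : Finset (Fin n × Bool)) {p : Finset (Fin n × Bool) → Prop}
    (hstep : ∀ R c c', A ⊆ R → c ∉ R → c' ∉ R → IsFace m (insert c R) → IsFace m (insert c' R) →
      p (insert c R) → p (insert c' R)) {W W' : Finset (Fin n × Bool)} (hW : IsFace m W)
    (hW' : IsFace m W') (hA : A ⊆ W) (hA' : A ⊆ W') (hp : p W) : p W' := by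
  generalize hd : (W' \ W).card = d
  induction d generalizing W with
  | zero =>
    rw [Finset.card_eq_zero, Finset.sdiff_eq_empty_iff_subset] at hd
    rwa [hW'.eq_of_subset hW hd]
  | succ d ih =>
    obtain ⟨c', hc'⟩ : (W' \ W).Nonempty := Finset.card_pos.mp (by omega)
    have hc1 := (Finset.mem_sdiff.mp hc').1
    have hc2 := (Finset.mem_sdiff.mp hc').2
    -- If the antipode of the incoming vertex c' lies in W, it has to be the outgoing vertex;
    -- otherwise the exchange would not produce a face.
    obtain ⟨c, hcW, hcW', hcc⟩ : ∃ c ∈ W, c ∉ W' ∧ (antipode c' ∈ W → c = antipode c') := by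
      by_cases h1 : antipode c' ∈ W
      · exact ⟨_, h1, hW'.antipode_notMem c' hc1, fun _ => rfl⟩
      · obtain ⟨c, hc⟩ : (W \ W').Nonempty := by
          rw [Finset.sdiff_nonempty]
          intro hsub
          exact hc2 (hW.eq_of_subset hW' hsub ▸ hc1)
        exact ⟨c, (Finset.mem_sdiff.mp hc).1, (Finset.mem_sdiff.mp hc).2, fun h2 => absurd h2 h1⟩
    obtain ⟨m, rfl⟩ : ∃ m', m = m' + 1 := by
      have := Finset.card_pos.mpr ⟨c, hcW⟩
      rw [hW.card_eq] at this
      exact ⟨m - 1, by omega⟩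
    have hR := hW.erase hcW
    have hins : insert c (W.erase c) = W := Finset.insert_erase hcW
    have hc'R : c' ∉ W.erase c := fun hh => hc2 (Finset.mem_of_mem_erase hh)
    have hW1 : IsFace (m + 1) (insert c' (W.erase c)) := by
      refine hR.insert hc'R fun hh => ?_
      have h1 := hcc (Finset.mem_of_mem_erase hh)
      rw [← h1] at hh
      exact Finset.notMem_erase c W hh
    have hAR : A ⊆ W.erase c := fun a ha =>
      Finset.mem_erase.mpr ⟨fun hh => hcW' (hh ▸ hA' ha), hA ha⟩
    refine ih hW1 (hAR.trans (Finset.subset_insert _ _))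
      (hstep _ c c' hAR (Finset.notMem_erase c W) hc'R (hins.symm ▸ hW) hW1 (hins.symm ▸ hp)) ?_
    have : W' \ insert c' (W.erase c) = (W' \ W).erase c' := by
      ext i
      simp only [Finset.mem_sdiff, Finset.mem_insert, Finset.mem_erase]
      constructor
      · rintro ⟨h1, h2⟩
        refine ⟨fun hh => h2 (Or.inl hh), h1, fun h3 => h2 (Or.inr ⟨?_, h3⟩)⟩
        rintro rfl
        exact hcW' h1
      · rintro ⟨h1, h2, h3⟩
        refine ⟨h2, ?_⟩
        rintro (h4 | ⟨-, h4⟩)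
        · exact h1 h4
        · exact h3 h4
    rw [this, Finset.card_erase_of_mem hc']
    omega

/-- A version of `swap_induction` in which the two exchanged vertices are not antipodal. -/
theorem swap_induction' (A : Finset (Fin n × Bool)) {p : Finset (Fin n × Bool) → Prop}
    (hm : m < n)
    (hstep : ∀ R c c', A ⊆ R → c ∉ R → c' ∉ R → c ≠ c' → IsFace (m + 1) (insert c (insert c' R)) →
      p (insert c R) → p (insert c' R)) {W W' : Finset (Fin n × Bool)} (hW : IsFace m W)
    (hW' : IsFace m W') (hA : A ⊆ W) (hA' : A ⊆ W') (hp : p W) : p W' := by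
  refine swap_induction A ?_ hW hW' hA hA' hp
  intro R c c' hAR hc hc' hF hF' hp
  by_cases hcc : c = c'
  · rwa [← hcc]
  have key : ∀ c c' : Fin n × Bool, c ∉ R → c' ∉ R → IsFace m (insert c R) →
      IsFace m (insert c' R) → c ≠ c' → c' ≠ antipode c → p (insert c R) → p (insert c' R) := by
    intro c c' hc hc' hF hF' hcc h1 hp
    refine hstep R c c' hAR hc hc' hcc (hF'.insert ?_ ?_) hp
    · rw [Finset.mem_insert]
      rintro (h2 | h2)
      · exact hcc h2
      · exact hc h2
    · rw [Finset.mem_insert]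
      rintro (h2 | h2)
      · exact h1 h2.symm
      · exact hF.antipode_notMem_of_insert h2
  -- An antipodal exchange is split into two others through a vertex d with ±d unused, which exists
  -- because `m < n`.
  by_cases h1 : c' = antipode c
  · obtain ⟨d, hd, hd'⟩ := hF.exists_notMem hm
    rw [Finset.mem_insert, not_or] at hd hd'
    have hd1 : d ≠ c' := by
      rintro rfl
      exact hd'.1 (by rw [h1, antipode_antipode])
    obtain ⟨m, rfl⟩ : ∃ m', m = m' + 1 := by
      have := hF.card_eq
      rw [Finset.card_insert_of_notMem hc] at this
      exact ⟨R.card, this.symm⟩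
    have hFd : IsFace (m + 1) (insert d R) := (hF.of_insert hc).insert hd.2 hd'.2
    refine key d c' hd.2 hc' hFd hF' hd1 ?_
      (key c d hc hd.2 hF hFd (Ne.symm hd.1) ?_ hp)
    · rw [h1]
      exact fun hh => hd.1 (antipode_injective hh).symm
    · rw [← h1]
      exact hd1
  · exact key c c' hc hc' hF hF' hcc h1 hp

end IsFace

/-! ### Frames and apartments -/

/-- `p` maps the vertices of the cross-polytope to the points of a frame. -/
def IsFrameMap (X : PartialLinearSpace P) (p : Fin n × Bool → P) : Prop :=
  ∀ i j, X.Collinear (p i) (p j) ↔ j ≠ antipode i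

namespace IsFrameMap

variable {X : PartialLinearSpace P} {p : Fin n × Bool → P} (hp : X.IsFrameMap p)
include hp

theorem injective : Function.Injective p := by
  intro i j hij
  have h1 := hp i (antipode i)
  rw [hij, hp] at h1
  by_contra hne
  exact h1.mp (fun hh => hne (antipode_injective hh)) rfl

theorem isFrame : X.IsFrame n (Set.range p) := by
  constructor
  · rw [← Set.image_univ, hp.injective.encard_image]
    simp [Set.encard_univ, mul_comm]
  · rintro _ ⟨i, rfl⟩
    refine ⟨p (antipode i), ⟨⟨_, rfl⟩, fun hh => (hp _ _).mp hh rfl⟩, ?_⟩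
    rintro _ ⟨⟨j, rfl⟩, hj⟩
    rw [hp, not_not] at hj
    rw [hj]

theorem image_subset_perp {m : ℕ} {S : Finset (Fin n × Bool)} (hS : IsFace m S) :
    p '' S ⊆ X.perp (p '' S) := by
  rintro _ ⟨i, hi, rfl⟩ _ ⟨j, hj, rfl⟩
  rw [hp]
  rintro rfl
  exact hS.antipode_notMem i hi hj

theorem isSingularSubspace_span (h : X.IsShultSpace) {m : ℕ} {S : Finset (Fin n × Bool)}
    (hS : IsFace m S) : X.IsSingularSubspace (X.span (p '' S)) :=
  IsPolarLike.isSingularSubspace_span h (hp.image_subset_perp hS)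

/-- The perp of p_{−a} contains every p_i with i ≠ a, hence the span, but not p_a. -/
theorem notMem_span (h : X.IsShultSpace) {S : Finset (Fin n × Bool)} {a : Fin n × Bool}
    (ha : a ∉ S) : p a ∉ X.span (p '' S) := by
  intro hmem
  have h1 : p '' S ⊆ X.perp {p (antipode a)} := by
    rintro _ ⟨i, hi, rfl⟩ _ rfl
    rw [hp]
    intro hh
    exact ha (antipode_injective hh ▸ hi)
  have h2 := IsPolarLike.subset_perp_span h h1 hmem _ rfl
  exact (hp _ _).mp h2 rfl

theorem rk_span (h : X.IsPolarLike n) {m : ℕ} {S : Finset (Fin n × Bool)} (hS : IsFace m S) :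
    X.rk (X.span (p '' S)) = m := by
  have hS' := hS.mono subset_rfl
  rw [← hS.card_eq]
  clear hS
  induction S using Finset.induction_on with
  | empty =>
    have : X.span (p '' ((∅ : Finset (Fin n × Bool)) : Set (Fin n × Bool))) = ∅ := by
      rw [Finset.coe_empty, Set.image_empty]
      exact Set.subset_eq_empty
        (IsPolarLike.span_subset X.isSingularSubspace_empty.1 (Set.empty_subset _)) rfl
    rw [this, h.rk_empty, Finset.card_empty]
  | insert a S ha ih =>
    have hF := hS'
    rw [Finset.card_insert_of_notMem ha] at hF ⊢
    have hS := hF.of_insert ha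
    have hs := hp.isSingularSubspace_span h.toIsShultSpace hS
    have hs' := hp.isSingularSubspace_span h.toIsShultSpace hF
    have hna := hp.notMem_span h.toIsShultSpace ha
    have hsub : X.span (p '' S) ⊆ X.span (p '' (insert a S : Finset _)) :=
      IsPolarLike.span_mono (Set.image_mono (Finset.coe_subset.mpr (Finset.subset_insert a S)))
    have hpa : p a ∈ X.span (p '' (insert a S : Finset _)) :=
      IsPolarLike.subset_span X _ ⟨a, by simp, rfl⟩
    have hperp : p a ∈ X.perp (X.span (p '' S)) := fun b hb => hs'.2 _ hpa b (hsub hb)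
    have hc := h.cone_isSingularSubspace hs hperp hna
    have heq : X.span (p '' (insert a S : Finset _)) = X.cone (p a) (X.span (p '' S)) := by
      refine subset_antisymm (IsPolarLike.span_subset hc.1 ?_)
        (IsShultSpace.cone_subset hs'.1 hna hsub hpa)
      rintro _ ⟨i, hi, rfl⟩
      rcases Finset.mem_insert.mp hi with rfl | hi
      · exact IsShultSpace.self_mem_cone X _ _
      · exact IsShultSpace.subset_cone hperp (IsPolarLike.subset_span X _ ⟨i, hi, rfl⟩)
    rw [heq, h.rk_cone hs hperp hna, ih (hS.mono subset_rfl)]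

theorem eq_span (h : X.IsPolarLike n) {m : ℕ} {S : Finset (Fin n × Bool)} (hS : IsFace m S)
    {A : Set P} (hA : X.IsSingularSubspace A) (hr : X.rk A = m) (hpA : ∀ i ∈ S, p i ∈ A) :
    A = X.span (p '' S) := by
  refine (h.eq_of_subset (hp.isSingularSubspace_span h.toIsShultSpace hS) hA
    (IsPolarLike.span_subset hA.1 ?_) ?_).symm
  · rintro _ ⟨i, hi, rfl⟩
    exact hpA i hi
  · rw [hr, hp.rk_span h hS]

/-- By rank, x(S) is the span of the p_i with i ∈ S. Conversely, a part of the frame spanning a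
singular subspace has no antipodal pair, and the rank counts its points, so it comes from a face
with `k + 1` vertices. -/
theorem isApartment (h : X.IsPolarLike n) {k : ℕ} {x : Finset (Fin n × Bool) → Set P}
    (hx : X.IsConfiguration n k x) (hpx : ∀ S, IsFace (k + 1) S → ∀ i ∈ S, p i ∈ x S) :
    X.IsApartment n k {S | ∃ A, IsFace (k + 1) A ∧ S.1.1 = x A} := by
  have hspan : ∀ S, IsFace (k + 1) S → x S = X.span (p '' S) := fun S hS =>
    hp.eq_span h hS (hx.sing S hS) (hx.rk_eq S hS) (hpx S hS)
  refine ⟨Set.range p, hp.isFrame, ?_⟩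
  ext S
  constructor
  · rintro ⟨A, hA, hSA⟩
    exact ⟨p '' A, Set.image_subset_range _ _, hSA.trans (hspan A hA)⟩
  · rintro ⟨A, hA, hSA⟩
    classical
    let B : Finset (Fin n × Bool) := Set.toFinset (p ⁻¹' A)
    have hB : p '' B = A := by
      rw [Set.coe_toFinset, Set.image_preimage_eq_of_subset hA]
    have hBS : ∀ i ∈ B, p i ∈ S.1.1 := fun i hi => by
      rw [hSA]
      exact IsPolarLike.subset_span X A (hB ▸ ⟨i, hi, rfl⟩)
    have hBf : IsFace B.card B := ⟨fun i hi hi' =>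
      (hp _ _).mp (S.1.2.2 _ (hBS i hi) _ (hBS _ hi')) rfl, rfl⟩
    have hc : B.card = k + 1 := by
      rw [← hp.rk_span h hBf, hB, ← hSA, h.rk_grassmannian]
    rw [hc] at hBf
    exact ⟨B, hBf, by rw [hspan B hBf, hB, hSA]⟩

end IsFrameMap

/-! ### The cases k = n − 1 and k = 0 -/

/-- An isometric hypercube of maximal singular subspaces is an apartment. -/
theorem IsPolarLike.exists_isFrameMap_of_hypercube {X : PartialLinearSpace P}
    (h : X.IsPolarLike n) {u : Finset (Fin n × Bool) → Set P}
    (hs : ∀ W, IsFace n W → X.IsSingularSubspace (u W)) (hr : ∀ W, IsFace n W → X.rk (u W) = n)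
    (hinge : ∀ R c, c ∉ R → IsFace n (insert c R) →
      n ≤ X.rk (u (insert c R) ∩ u (insert (antipode c) R)) + 1)
    (hopp : ∀ W, IsFace n W → u W ∩ u (opp W) = ∅) :
    ∃ p : Fin n × Bool → P, X.IsFrameMap p ∧ ∀ W, IsFace n W → ∀ i ∈ W, p i ∈ u W := by
  -- Flipping the vertices of V∖V' one by one loses at most one rank per flip.
  have path : ∀ (d : ℕ) (V V' : Finset (Fin n × Bool)), IsFace n V → IsFace n V' →
      (V \ V').card = d → ∀ A, X.IsSingularSubspace A → A ⊆ u V →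
      X.rk A ≤ X.rk (A ∩ u V') + d := by
    intro d
    induction d with
    | zero =>
      intro V V' hV hV' hd A hA hAV
      rw [Finset.card_eq_zero, Finset.sdiff_eq_empty_iff_subset] at hd
      rw [← hV.eq_of_subset hV' hd, Set.inter_eq_left.mpr hAV]
      omega
    | succ d ih =>
      intro V V' hV hV' hd A hA hAV
      obtain ⟨c, hc⟩ : (V \ V').Nonempty := Finset.card_pos.mp (by omega)
      have hcV := (Finset.mem_sdiff.mp hc).1
      have hcV' := (Finset.mem_sdiff.mp hc).2
      have hc' : antipode c ∈ V' := (hV'.mem_or_antipode_mem c).resolve_left hcV'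
      have hins : insert c (V.erase c) = V := Finset.insert_erase hcV
      obtain ⟨m, rfl⟩ : ∃ m, n = m + 1 := ⟨n - 1, by have := c.1.2; omega⟩
      have hV1 : IsFace (m + 1) (insert (antipode c) (V.erase c)) :=
        IsFace.insert_antipode (hins.symm ▸ hV) (Finset.notMem_erase c V)
      have h1 := hinge (V.erase c) c (Finset.notMem_erase c V) (hins.symm ▸ hV)
      rw [hins] at h1
      have h2 := h.rk_le_rk_inter hA ((hs V hV).inter_subspace (hs _ hV1).1) (hs V hV) hAV
        Set.inter_subset_left (by rw [hr V hV]; exact h1)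
      rw [← Set.inter_assoc, Set.inter_eq_left.mpr hAV] at h2
      have hA1 := hA.inter_subspace (hs _ hV1).1
      have h3 := ih _ V' hV1 hV' (by
        have : insert (antipode c) (V.erase c) \ V' = (V \ V').erase c := by
          ext i
          simp only [Finset.mem_sdiff, Finset.mem_insert, Finset.mem_erase]
          constructor
          · rintro ⟨rfl | h1, h2⟩
            · exact absurd hc' h2
            · exact ⟨h1.1, h1.2, h2⟩
          · rintro ⟨h1, h2, h3⟩
            exact ⟨Or.inr ⟨h1, h2⟩, h3⟩
        rw [this, Finset.card_erase_of_mem hc]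
        omega) _ hA1 Set.inter_subset_right
      have h4 := h.rk_mono (hA1.inter_subspace (hs V' hV').1) (hA.inter_subspace (hs V' hV').1)
        fun a ha => ⟨ha.1.1, ha.2⟩
      omega
  have hpt : ∀ i : Fin n × Bool, ∃ q, ∀ W, IsFace n W → i ∈ W → q ∈ u W := by
    intro i
    obtain ⟨m, rfl⟩ : ∃ m, n = m + 1 := ⟨n - 1, by have := i.1.2; omega⟩
    obtain ⟨W, hW, hiW⟩ := (IsFace.singleton i).exists_superset (m' := m + 1) (by omega) le_rfl
    rw [Finset.singleton_subset_iff] at hiW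
    -- The face W' shares only i with W, and one flip takes it to −W. The point p_i will be the only
    -- point of u(W) ∩ u(W').
    have hW' : IsFace (m + 1) (insert i (opp (W.erase i))) := by
      have h1 : IsFace m (W.erase i) := IsFace.erase hW hiW
      refine h1.opp.insert ?_ ?_
      · rw [mem_opp]
        exact fun hh => hW.antipode_notMem i hiW (Finset.mem_of_mem_erase hh)
      · rw [mem_opp, antipode_antipode]
        exact Finset.notMem_erase i W
    set W' := insert i (opp (W.erase i)) with hWdef
    have hsI := (hs W hW).inter_subspace (hs W' hW').1
    -- Every face V through i lies on a geodesic from W to W', of total length m = n − 1.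
    have hdiff : ∀ V, IsFace (m + 1) V → i ∈ V → (W \ V).card + (V \ W').card + 1 = m + 1 := by
      intro V hV hiV
      have h1 : V \ W' = (W ∩ V).erase i := by
        ext j
        simp only [hWdef, Finset.mem_sdiff, Finset.mem_insert, mem_opp, Finset.mem_erase,
          Finset.mem_inter, not_or, not_and]
        constructor
        · rintro ⟨h1, h2, h3⟩
          refine ⟨h2, ?_, h1⟩
          by_contra hjW
          have h4 := (hW.mem_or_antipode_mem j).resolve_left hjW
          refine h3 ?_ h4
          rintro h5
          rw [antipode_eq_iff] at h5
          exact hV.antipode_notMem i hiV (h5 ▸ h1)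
        · rintro ⟨h1, h2, h3⟩
          exact ⟨h3, h1, fun _ => hW.antipode_notMem j h2⟩
      have hiI : i ∈ W ∩ V := Finset.mem_inter.mpr ⟨hiW, hiV⟩
      have h2 := Finset.card_sdiff_add_card_inter W V
      have h3 := Finset.card_pos.mpr ⟨i, hiI⟩
      rw [h1, Finset.card_erase_of_mem hiI]
      rw [hW.card_eq] at h2
      omega
    -- The flip from W' to −W costs at most one rank and leaves nothing, since u(W) and u(−W) are
    -- disjoint.
    have hle : X.rk (u W ∩ u W') ≤ 1 := by
      have h1 := path (W' \ opp W).card W' (opp W) hW' hW.opp rfl _ hsI Set.inter_subset_right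
      have h2 : u W ∩ u W' ∩ u (opp W) = ∅ := by
        refine Set.subset_eq_empty ?_ (hopp W hW)
        exact fun a ha => ⟨ha.1.1, ha.2⟩
      rw [h2, h.rk_empty] at h1
      have h3 : W' \ opp W ⊆ {i} := by
        intro j hj
        rw [Finset.mem_sdiff, hWdef, Finset.mem_insert, mem_opp, mem_opp] at hj
        rcases hj with ⟨h4 | h4, h5⟩
        · exact Finset.mem_singleton.mpr h4
        · exact absurd (Finset.mem_of_mem_erase h4) h5
      have h4 := Finset.card_le_card h3
      rw [Finset.card_singleton] at h4
      omega
    -- Going from W to W' through V costs at most m of the rank m + 1, so a common point of all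
    -- three survives.
    have hge : ∀ V, IsFace (m + 1) V → i ∈ V → (u W ∩ u V ∩ u W').Nonempty := by
      intro V hV hiV
      have h1 := path _ W V hW hV rfl _ (hs W hW) subset_rfl
      have hsV := (hs W hW).inter_subspace (hs V hV).1
      have h2 := path _ V W' hV hW' rfl _ hsV Set.inter_subset_right
      have h3 := hdiff V hV hiV
      rw [hr W hW] at h1
      exact h.nonempty_of_rk_pos (hsV.inter_subspace (hs W' hW').1) (by omega)
    obtain ⟨q, ⟨hq1, -⟩, hq2⟩ := hge W hW hiW
    refine ⟨q, fun V hV hiV => ?_⟩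
    obtain ⟨q', ⟨hq1', hqV⟩, hq2'⟩ := hge V hV hiV
    rwa [h.eq_of_mem_of_rk_le_one hsI hle ⟨hq1, hq2⟩ ⟨hq1', hq2'⟩]
  choose p hpu using hpt
  have hnot : ∀ W, IsFace n W → ∀ i, antipode i ∈ W → p i ∉ u W := by
    intro W hW i hi hpi
    have h1 : p i ∈ u W ∩ u (opp W) := ⟨hpi, hpu i _ hW.opp (mem_opp.mpr hi)⟩
    rw [hopp W hW] at h1
    exact h1
  refine ⟨p, ?_, fun W hW i hi => hpu i W hW hi⟩
  intro i j
  constructor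
  · rintro hc rfl
    obtain ⟨m, rfl⟩ : ∃ m, n = m + 1 := ⟨n - 1, by have := i.1.2; omega⟩
    obtain ⟨W, hW, hiW⟩ := (IsFace.singleton i).exists_superset (m' := m + 1) (by omega) le_rfl
    rw [Finset.singleton_subset_iff] at hiW
    have hins : insert i (W.erase i) = W := Finset.insert_erase hiW
    have hV : IsFace (m + 1) (insert (antipode i) (W.erase i)) :=
      IsFace.insert_antipode (hins.symm ▸ hW) (Finset.notMem_erase i W)
    have h1 := hinge (W.erase i) i (Finset.notMem_erase i W) (hins.symm ▸ hW)
    rw [hins] at h1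
    set V := insert (antipode i) (W.erase i) with hVdef
    have hiV : antipode i ∈ V := Finset.mem_insert_self _ _
    have hZ := (hs W hW).inter_subspace (hs V hV).1
    have hpZ : p i ∉ u W ∩ u V := fun hh => hnot V hV i hiV hh.2
    -- With V obtained from W by flipping i, u(W) is spanned by p_i and u(W) ∩ u(V). If p_{−i} ∈
    -- u(V) were collinear to p_i, it would be collinear to all of u(W) and so, by maximality, lie
    -- in it.
    have hWc := h.eq_cone hZ (hs W hW) Set.inter_subset_left (by rw [hr W hW]; exact h1)
      (hpu i W hW hiW) hpZ
    have h2 : p (antipode i) ∈ u W := by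
      refine h.mem_of_mem_perp (hs W hW) (hr W hW) ?_
      have h3 : X.cone (p i) (u W ∩ u V) ⊆ X.perp {p (antipode i)} := by
        refine h.cone_subset_perp hpZ ?_ ?_
        · rintro a ha _ rfl
          exact (hs V hV).2 a ha.2 _ (hpu _ V hV hiV)
        · rintro _ rfl
          exact hc
      rw [← hWc] at h3
      exact fun a ha => (h3 ha _ rfl).symm
    exact hnot W hW (antipode i) (by rwa [antipode_antipode]) h2
  · intro hij
    by_cases h1 : i = j
    · rw [h1]
      exact X.collinear_refl _
    have hF := IsFace.pair h1 hij
    obtain ⟨W, hW, hsub⟩ := hF.exists_superset (m' := n) hF.le le_rfl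
    exact (hs W hW).2 _ (hpu i W hW (hsub (by simp))) _ (hpu j W hW (hsub (by simp)))

theorem IsConfiguration.exists_isFrameMap_of_maximal {X : PartialLinearSpace P}
    (h : X.IsPolarLike n) {k : ℕ} {x : Finset (Fin n × Bool) → Set P}
    (hx : X.IsConfiguration n k x) (hk : k + 1 = n) :
    ∃ p : Fin n × Bool → P, X.IsFrameMap p ∧ ∀ S, IsFace (k + 1) S → ∀ i ∈ S, p i ∈ x S := by
  subst hk
  refine h.exists_isFrameMap_of_hypercube hx.sing hx.rk_eq
    (fun R c hc hR => Nat.succ_le_succ (hx.hinge rfl R c hc hR)) ?_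
  intro W hW
  have h1 := (hx.opposite_iff W (opp W) hW hW.opp).mpr rfl
  refine Set.eq_empty_of_forall_notMem ?_
  rintro b ⟨hb, hb'⟩
  exact h1 b hb' ((hx.sing W hW).subset_perp hb)

/-- Two points are collinear exactly when they are not opposite, so opposition alone gives the frame
relations. -/
theorem IsConfiguration.exists_isFrameMap_of_points {X : PartialLinearSpace P}
    (h : X.IsPolarLike n) {x : Finset (Fin n × Bool) → Set P}
    (hx : X.IsConfiguration n 0 x) :
    ∃ p : Fin n × Bool → P, X.IsFrameMap p ∧ ∀ S, IsFace (0 + 1) S → ∀ i ∈ S, p i ∈ x S := by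
  have hF : ∀ i : Fin n × Bool, IsFace (0 + 1) {i} := IsFace.singleton
  have hne : ∀ i : Fin n × Bool, ∃ q, q ∈ x {i} := fun i =>
    h.nonempty_of_rk_pos (hx.sing _ (hF i)) (by rw [hx.rk_eq _ (hF i)]; omega)
  choose p hp using hne
  have heq : ∀ i q, q ∈ x {i} → q = p i := fun i q hq =>
    h.eq_of_mem_of_rk_le_one (hx.sing _ (hF i)) (hx.rk_eq _ (hF i)).le hq (hp i)
  refine ⟨p, fun i j => ?_, ?_⟩
  · have h1 := (hx.opposite_iff _ _ (hF i) (hF j)).not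
    have h2 : X.Collinear (p i) (p j) ↔ ¬ X.Opposite (x {i}) (x {j}) := by
      rw [Opposite]
      push Not
      constructor
      · intro hc
        refine ⟨p j, hp j, fun a ha => ?_⟩
        rw [heq i a ha]
        exact hc.symm
      · rintro ⟨b, hb, hperp⟩
        have := hperp _ (hp i)
        rw [heq j b hb] at this
        exact this.symm
    rw [h2, h1]
    simp [opp]
  · intro S hS i hi
    obtain ⟨j, rfl⟩ := Finset.card_eq_one.mp hS.card_eq
    rw [Finset.mem_singleton.mp hi]
    exact hp j

end PartialLinearSpace

/-! ### Tops, stars and rows -/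

namespace PartialLinearSpace

variable {P Q : Type*} {n k : ℕ}

/-- The subspaces corresponding to the facets of `W` lie in a common subspace of rank `k + 2`. -/
def IsTop (X : PartialLinearSpace P) (k : ℕ) (x : Finset (Fin n × Bool) → Set P)
    (W : Finset (Fin n × Bool)) : Prop :=
  ∃ U, X.IsSingularSubspace U ∧ X.rk U = k + 2 ∧ ∀ a ∈ W, x (W.erase a) ⊆ U

/-- The subspaces corresponding to the facets of `W` contain a common subspace of rank `k`. -/
def IsStar (X : PartialLinearSpace P) (k : ℕ) (x : Finset (Fin n × Bool) → Set P)
    (W : Finset (Fin n × Bool)) : Prop :=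
  ∃ K, X.IsSingularSubspace K ∧ X.rk K = k ∧ ∀ a ∈ W, K ⊆ x (W.erase a)

/-- `R` has `k` elements and spans a face with `k + 3` vertices together with `c`, `d`, `e`. -/
structure IsRow (k : ℕ) (R : Finset (Fin n × Bool)) (c d e : Fin n × Bool) : Prop where
  face : IsFace (k + 3) (insert c (insert d (insert e R)))
  notMem_left : c ∉ insert d (insert e R)
  notMem_mid : d ∉ insert e R
  notMem_right : e ∉ R

/-- The three subspaces of a row lie in a common subspace of rank `k + 2`. -/
def IsRowTop (X : PartialLinearSpace P) (k : ℕ) (x : Finset (Fin n × Bool) → Set P)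
    (R : Finset (Fin n × Bool)) (c d e : Fin n × Bool) : Prop :=
  ∃ U, X.IsSingularSubspace U ∧ X.rk U = k + 2 ∧ x (insert c R) ⊆ U ∧ x (insert d R) ⊆ U ∧
    x (insert e R) ⊆ U

namespace IsRow

variable {R : Finset (Fin n × Bool)} {c d e : Fin n × Bool}

theorem swap_left (hR : IsRow k R c d e) : IsRow k R d c e := by
  obtain ⟨h1, h2, h3, h4⟩ := hR
  rw [Finset.mem_insert, not_or] at h2
  refine ⟨by rwa [Finset.insert_comm], ?_, h2.2, h4⟩
  rw [Finset.mem_insert, not_or]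
  exact ⟨Ne.symm h2.1, h3⟩

theorem swap_right (hR : IsRow k R c d e) : IsRow k R c e d := by
  obtain ⟨h1, h2, h3, h4⟩ := hR
  rw [Finset.mem_insert, not_or] at h3
  have := Finset.insert_comm d e R
  refine ⟨this ▸ h1, this ▸ h2, ?_, h3.2⟩
  rw [Finset.mem_insert, not_or]
  exact ⟨Ne.symm h3.1, h4⟩

theorem face_pair (hR : IsRow k R c d e) : IsFace (k + 2) (insert d (insert e R)) :=
  hR.face.of_insert hR.notMem_left

theorem face_right (hR : IsRow k R c d e) : IsFace (k + 1) (insert e R) :=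
  hR.face_pair.of_insert hR.notMem_mid

theorem ne_right (hR : IsRow k R c d e) : insert d R ≠ insert e R := by
  intro hh
  exact hR.notMem_mid (hh ▸ Finset.mem_insert_self d R)

end IsRow

theorem isRow_erase {S : Finset (Fin n × Bool)} {a c c' : Fin n × Bool} (ha : a ∈ S)
    (hc : c ∉ S) (hc' : c' ∉ S) (hcc : c ≠ c')
    (hF : IsFace (k + 3) (insert c (insert c' S))) : IsRow k (S.erase a) a c c' := by
  have h1 : insert a (insert c (insert c' (S.erase a))) = insert c (insert c' S) := by
    rw [Finset.insert_comm a c, Finset.insert_comm a c', Finset.insert_erase ha]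
  refine ⟨h1 ▸ hF, ?_, ?_, fun hh => hc' (Finset.mem_of_mem_erase hh)⟩
  · simp only [Finset.mem_insert, not_or]
    exact ⟨fun hh => hc (hh ▸ ha), fun hh => hc' (hh ▸ ha), Finset.notMem_erase a S⟩
  · simp only [Finset.mem_insert, not_or]
    exact ⟨hcc, fun hh => hc (Finset.mem_of_mem_erase hh)⟩

theorem erase_insert_of_mem {S : Finset (Fin n × Bool)} {a c : Fin n × Bool} (ha : a ∈ S)
    (hc : c ∉ S) : (insert c S).erase a = insert c (S.erase a) :=
  Finset.erase_insert_of_ne (by rintro rfl; exact hc ha)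

theorem erase_ne_erase {W : Finset (Fin n × Bool)} {a b : Fin n × Bool} (ha : a ∈ W)
    (hab : a ≠ b) : W.erase a ≠ W.erase b := by
  intro hh
  have : a ∈ W.erase b := Finset.mem_erase.mpr ⟨hab, ha⟩
  rw [← hh] at this
  exact Finset.notMem_erase a W this

theorem opp_erase (W : Finset (Fin n × Bool)) (a : Fin n × Bool) :
    opp (W.erase a) = (opp W).erase (antipode a) := by
  ext i
  simp only [mem_opp, Finset.mem_erase, ne_eq, antipode_eq_iff]

theorem IsPolarLike.eq_of_two {X : PartialLinearSpace P} (h : X.IsPolarLike n) {m : ℕ}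
    {A B U V : Set P} (hA : X.IsSingularSubspace A) (hrA : X.rk A = m)
    (hBA : ¬ B ⊆ A) (hU : X.IsSingularSubspace U) (hrU : X.rk U = m + 1)
    (hV : X.IsSingularSubspace V) (hrV : X.rk V = m + 1) (hAU : A ⊆ U) (hBU : B ⊆ U)
    (hAV : A ⊆ V) (hBV : B ⊆ V) : U = V := by
  obtain ⟨q, hqB, hqA⟩ := Set.not_subset.mp hBA
  rw [h.eq_cone hA hU hAU (by omega) (hBU hqB) hqA, h.eq_cone hA hV hAV (by omega) (hBV hqB) hqA]

namespace IsConfiguration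

variable {X : PartialLinearSpace P} {x : Finset (Fin n × Bool) → Set P}

theorem not_mem_perp_opp (hx : X.IsConfiguration n k x) {S : Finset (Fin n × Bool)}
    (hS : IsFace (k + 1) S) {v : P} (hv : v ∈ x (opp S)) : v ∉ X.perp (x S) :=
  (hx.opposite_iff S (opp S) hS hS.opp).mpr rfl v hv

theorem not_mem_perp (hx : X.IsConfiguration n k x) {S : Finset (Fin n × Bool)}
    (hS : IsFace (k + 1) S) {v : P} (hv : v ∈ x S) : v ∉ X.perp (x (opp S)) :=
  (hx.opposite_iff (opp S) S hS.opp hS).mpr (opp_opp S).symm v hv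

theorem exists_mem_perp_opp (hx : X.IsConfiguration n k x) {S T : Finset (Fin n × Bool)}
    (hS : IsFace (k + 1) S) (hT : IsFace (k + 1) T) (hTS : T ≠ S) :
    ∃ z ∈ x T, z ∈ X.perp (x (opp S)) := by
  have h1 := (hx.opposite_iff (opp S) T hS.opp hT).not.mpr (by rwa [opp_opp])
  rw [Opposite] at h1
  push Not at h1
  exact h1

/-- By rank an inclusion would be an equality, but x(−S) is opposite to x(S) and to no other x(T).
-/
theorem not_subset (h : X.IsPolarLike n) (hx : X.IsConfiguration n k x)
    {S T : Finset (Fin n × Bool)} (hS : IsFace (k + 1) S) (hT : IsFace (k + 1) T)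
    (hTS : S ≠ T) : ¬ x S ⊆ x T := by
  intro hsub
  have heq := h.eq_of_subset (hx.sing S hS) (hx.sing T hT) hsub
    (by rw [hx.rk_eq S hS, hx.rk_eq T hT])
  have h1 := (hx.opposite_iff S (opp S) hS hS.opp).mpr rfl
  rw [heq, hx.opposite_iff T (opp S) hT hS.opp] at h1
  exact hTS (opp_injective h1)

theorem rk_inter (h : X.IsPolarLike n) (hx : X.IsConfiguration n k x)
    {S T : Finset (Fin n × Bool)} (hS : IsFace (k + 1) S) (hT : IsFace (k + 1) T)
    (hTS : S ≠ T) (hJ : X.Joint (k + 2) (x S) (x T)) : X.rk (x S ∩ x T) = k := by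
  have h1 := h.rk_le_rk_inter_of_joint (hx.sing S hS) (hx.sing T hT) (hx.rk_eq T hT) hJ
  have h2 : X.rk (x S ∩ x T) < X.rk (x S) :=
    h.rk_lt ((hx.sing S hS).inter_subspace (hx.sing T hT).1) (hx.sing S hS)
      Set.inter_subset_left
      fun hh => hx.not_subset h hS hT hTS (Set.inter_eq_left.mp hh)
  rw [hx.rk_eq S hS] at h1 h2
  omega

theorem joint_erase (hx : X.IsConfiguration n k x) {W : Finset (Fin n × Bool)}
    (hW : IsFace (k + 2) W) {a b : Fin n × Bool} (ha : a ∈ W) (hb : b ∈ W) :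
    X.Joint (k + 2) (x (W.erase a)) (x (W.erase b)) :=
  (hx.joint_iff _ _ (IsFace.erase hW ha) (IsFace.erase hW hb)).mpr
    ⟨W, hW, Finset.erase_subset _ _, Finset.erase_subset _ _⟩

theorem joint_row (hx : X.IsConfiguration n k x) {R : Finset (Fin n × Bool)}
    {c d e : Fin n × Bool} (hR : IsRow k R c d e) :
    X.Joint (k + 2) (x (insert d R)) (x (insert e R)) :=
  (hx.joint_iff _ _ hR.swap_right.face_right hR.face_right).mpr
    ⟨_, hR.face_pair, Finset.insert_subset_insert _ (Finset.subset_insert _ _),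
      Finset.subset_insert _ _⟩

/-- Since T ≠ S, x(T) contains a point z collinear to all of x(−S). No point of x(S), in particular
none of K, has this property, so x(T) is the cone of z over K; both z and K lie in v^⊥. -/
theorem mem_perp_of_star (h : X.IsPolarLike n) (hx : X.IsConfiguration n k x) {K : Set P}
    (hK : X.IsSingularSubspace K) (hrK : X.rk K = k) {S T : Finset (Fin n × Bool)}
    (hS : IsFace (k + 1) S) (hT : IsFace (k + 1) T) (hTS : T ≠ S) (hKS : K ⊆ x S)
    (hKT : K ⊆ x T) {v : P} (hv : v ∈ x (opp S)) (hvK : v ∈ X.perp K) : v ∈ X.perp (x T) := by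
  obtain ⟨z, hzT, hz⟩ := hx.exists_mem_perp_opp hS hT hTS
  have hzK : z ∉ K := fun hh => hx.not_mem_perp hS (hKS hh) hz
  have hc := h.eq_cone hK (hx.sing T hT) hKT (by rw [hx.rk_eq T hT, hrK]) hzT hzK
  have h1 : X.cone z K ⊆ X.perp {v} := by
    refine h.cone_subset_perp hzK ?_ ?_
    · rintro a ha _ rfl
      exact (hvK a ha).symm
    · rintro _ rfl
      exact hz _ hv
  rw [← hc] at h1
  exact fun a ha => (h1 ha v rfl).symm

/-- The rank of x(−S) is k + 1, larger than that of K, so some point v of x(−S) lies in K^⊥. It then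
separates x(S) from every other member through K. -/
theorem exists_separating (h : X.IsPolarLike n) (hx : X.IsConfiguration n k x) {K : Set P}
    (hK : X.IsSingularSubspace K) (hrK : X.rk K = k) {S : Finset (Fin n × Bool)}
    (hS : IsFace (k + 1) S) (hKS : K ⊆ x S) :
    ∃ v, v ∈ X.perp K ∧ v ∉ X.perp (x S) ∧
      ∀ T, IsFace (k + 1) T → T ≠ S → K ⊆ x T → v ∈ X.perp (x T) := by
  obtain ⟨v, hv, hvK⟩ := h.exists_mem_perp (hx.sing _ hS.opp) hK
    (by rw [hx.rk_eq _ hS.opp, hrK]; omega)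
  exact ⟨v, hvK, hx.not_mem_perp_opp hS hv,
    fun T hT hTS hKT => hx.mem_perp_of_star h hK hrK hS hT hTS hKS hKT hv hvK⟩

/-- Modulo K these would be three points of one line. A point separating x(S₁) from the other two is
collinear to both of them, hence to all of their join U ⊇ x(S₁). -/
theorem not_line (h : X.IsPolarLike n) (hx : X.IsConfiguration n k x) {K U : Set P}
    (hK : X.IsSingularSubspace K) (hrK : X.rk K = k) (hU : X.IsSingularSubspace U)
    (hrU : X.rk U = k + 2) {S₁ S₂ S₃ : Finset (Fin n × Bool)} (h₁ : IsFace (k + 1) S₁)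
    (h₂ : IsFace (k + 1) S₂) (h₃ : IsFace (k + 1) S₃) (h₁₂ : S₂ ≠ S₁) (h₁₃ : S₃ ≠ S₁)
    (h₂₃ : S₃ ≠ S₂) (hK₁ : K ⊆ x S₁) (hK₂ : K ⊆ x S₂) (hK₃ : K ⊆ x S₃) (hU₁ : x S₁ ⊆ U)
    (hU₂ : x S₂ ⊆ U) (hU₃ : x S₃ ⊆ U) : False := by
  obtain ⟨v, -, hv1, hv⟩ := hx.exists_separating h hK hrK h₁ hK₁
  have hv2 := hv S₂ h₂ h₁₂ hK₂
  have hv3 := hv S₃ h₃ h₁₃ hK₃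
  obtain ⟨q, hq3, hq2⟩ := Set.not_subset.mp (hx.not_subset h h₃ h₂ h₂₃)
  have hc := h.eq_cone (hx.sing S₂ h₂) hU hU₂ (by rw [hx.rk_eq S₂ h₂, hrU]) (hU₃ hq3) hq2
  have h1 : X.cone q (x S₂) ⊆ X.perp {v} := by
    refine h.cone_subset_perp hq2 ?_ ?_
    · rintro a ha _ rfl
      exact (hv2 a ha).symm
    · rintro _ rfl
      exact (hv3 q hq3).symm
  rw [← hc] at h1
  exact hv1 fun a ha => (h1 (hU₁ ha) v rfl).symm

/-- Three pairwise adjacent subspaces lie in a common subspace or have a common intersection. -/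
theorem subset_or_inter_subset (h : X.IsPolarLike n) (hx : X.IsConfiguration n k x) {U : Set P}
    (hU : X.IsSingularSubspace U) {S₁ S₂ S₃ : Finset (Fin n × Bool)}
    (h₁ : IsFace (k + 1) S₁) (h₂ : IsFace (k + 1) S₂) (h₃ : IsFace (k + 1) S₃) (h₁₂ : S₁ ≠ S₂)
    (h₁₃ : S₁ ≠ S₃) (h₂₃ : S₂ ≠ S₃) (hJ₁₂ : X.Joint (k + 2) (x S₁) (x S₂))
    (hJ₁₃ : X.Joint (k + 2) (x S₁) (x S₃)) (hJ₂₃ : X.Joint (k + 2) (x S₂) (x S₃))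
    (hU₁ : x S₁ ⊆ U) (hU₂ : x S₂ ⊆ U) : x S₃ ⊆ U ∨ x S₁ ∩ x S₂ ⊆ x S₃ := by
  by_contra! hcon
  obtain ⟨hcU, hcI⟩ := hcon
  have s₁ := hx.sing S₁ h₁
  have s₂ := hx.sing S₂ h₂
  have s₃ := hx.sing S₃ h₃
  have hns : ¬ x S₁ ∩ x S₃ ⊆ x S₂ := by
    intro hsub
    have heq := h.eq_of_subset (s₁.inter_subspace s₃.1) (s₁.inter_subspace s₂.1)
      (Set.subset_inter Set.inter_subset_left hsub)
      (by rw [hx.rk_inter h h₁ h₂ h₁₂ hJ₁₂, hx.rk_inter h h₁ h₃ h₁₃ hJ₁₃])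
    rw [← heq] at hcI
    exact hcI Set.inter_subset_right
  obtain ⟨q, ⟨hq1, hq3⟩, hq2⟩ := Set.not_subset.mp hns
  have hqI : q ∉ x S₂ ∩ x S₃ := fun hh => hq2 hh.1
  have hc := h.eq_cone (s₂.inter_subspace s₃.1) s₃ Set.inter_subset_right
    (by rw [hx.rk_inter h h₂ h₃ h₂₃ hJ₂₃, hx.rk_eq S₃ h₃]) hq3 hqI
  apply hcU
  rw [hc]
  exact IsShultSpace.cone_subset hU.1 hqI (Set.inter_subset_left.trans hU₂) (hU₁ hq1)

/-- Fix two facets with join U and intersection K; every other facet maps into U or over K. A facet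
c not inside U and a facet d not over K cannot coexist: d would lie in the join of the first with
the second and in that of the first with c, making the two joins equal. -/
theorem isTop_or_isStar (h : X.IsPolarLike n) (hx : X.IsConfiguration n k x)
    {W : Finset (Fin n × Bool)} (hW : IsFace (k + 2) W) : IsTop X k x W ∨ IsStar X k x W := by
  obtain ⟨a, b, ha, hb, hab⟩ : ∃ a b, a ∈ W ∧ b ∈ W ∧ a ≠ b := by
    have : 1 < W.card := by rw [hW.card_eq]; omega
    obtain ⟨a, ha, b, hb, hab⟩ := Finset.one_lt_card.mp this
    exact ⟨a, b, ha, hb, hab⟩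
  have hf : ∀ c ∈ W, IsFace (k + 1) (W.erase c) := fun c hc => IsFace.erase hW hc
  have sa := hx.sing _ (hf a ha)
  have sb := hx.sing _ (hf b hb)
  obtain ⟨U, hU, hrU, haU, hbU⟩ := hx.joint_erase hW ha hb
  have hJab : X.Joint (k + 2) (x (W.erase a)) (x (W.erase b)) := ⟨U, hU, hrU, haU, hbU⟩
  by_cases hall : ∀ c ∈ W, x (W.erase c) ⊆ U
  · exact Or.inl ⟨U, hU, hrU, hall⟩
  push Not at hall
  obtain ⟨c, hc, hcU⟩ := hall
  have hca : c ≠ a := by rintro rfl; exact hcU haU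
  have hcb : c ≠ b := by rintro rfl; exact hcU hbU
  have hKc := (hx.subset_or_inter_subset h hU (hf a ha) (hf b hb) (hf c hc)
    (erase_ne_erase ha hab) (erase_ne_erase ha hca.symm) (erase_ne_erase hb hcb.symm) hJab
    (hx.joint_erase hW ha hc) (hx.joint_erase hW hb hc) haU hbU).resolve_left hcU
  have hrK := hx.rk_inter h (hf a ha) (hf b hb) (erase_ne_erase ha hab) hJab
  have hKs := sa.inter_subspace sb.1
  refine Or.inr ⟨_, hKs, hrK, fun d hd => ?_⟩
  by_cases hda : d = a
  · rw [hda]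
    exact Set.inter_subset_left
  by_cases hdb : d = b
  · rw [hdb]
    exact Set.inter_subset_right
  by_cases hdc : d = c
  · rw [hdc]
    exact hKc
  by_contra hKd
  have hdU := (hx.subset_or_inter_subset h hU (hf a ha) (hf b hb) (hf d hd)
    (erase_ne_erase ha hab) (erase_ne_erase ha (Ne.symm hda)) (erase_ne_erase hb (Ne.symm hdb))
    hJab (hx.joint_erase hW ha hd) (hx.joint_erase hW hb hd) haU hbU).resolve_right hKd
  obtain ⟨V, hV, hrV, haV, hcV⟩ := hx.joint_erase hW ha hc
  have hJac : X.Joint (k + 2) (x (W.erase a)) (x (W.erase c)) := ⟨V, hV, hrV, haV, hcV⟩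
  have hac := hx.rk_inter h (hf a ha) (hf c hc) (erase_ne_erase ha hca.symm) hJac
  have heq := h.eq_of_subset hKs (sa.inter_subspace (hx.sing _ (hf c hc)).1)
    (Set.subset_inter Set.inter_subset_left hKc) (by rw [hac, hrK])
  have hdV := (hx.subset_or_inter_subset h hV (hf a ha) (hf c hc) (hf d hd)
    (erase_ne_erase ha hca.symm) (erase_ne_erase ha (Ne.symm hda)) (erase_ne_erase hc (Ne.symm hdc))
    hJac (hx.joint_erase hW ha hd) (hx.joint_erase hW hc hd) haV hcV).resolve_right
    (by rwa [← heq])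
  have hUV := h.eq_of_two sa (hx.rk_eq _ (hf a ha))
    (hx.not_subset h (hf d hd) (hf a ha) (erase_ne_erase hd hda)) hU hrU hV hrV haU hdU haV hdV
  rw [hUV] at hcU
  exact hcU hcV

/-- The `k + 2` members are independent modulo the centre K: for each there is a point whose perp
contains K and the others but not it. Their pairwise joined span is singular of rank at least k + (k
+ 2). -/
theorem le_of_isStar (h : X.IsPolarLike n) (hx : X.IsConfiguration n k x)
    {W : Finset (Fin n × Bool)} (hW : IsFace (k + 2) W) (hs : IsStar X k x W) :
    2 * k + 2 ≤ n := by
  obtain ⟨K, hK, hrK, hKW⟩ := hs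
  have hf : ∀ c ∈ W, IsFace (k + 1) (W.erase c) := fun c hc => IsFace.erase hW hc
  let G : Finset (Fin n × Bool) → Set P := fun D => K ∪ ⋃ a ∈ D, x (W.erase a)
  have hGmono : ∀ D E : Finset (Fin n × Bool), D ⊆ E → G D ⊆ G E := fun D E hDE =>
    Set.union_subset_union_right _ (Set.biUnion_subset_biUnion_left hDE)
  have hxx : ∀ a ∈ W, ∀ b ∈ W, x (W.erase a) ⊆ X.perp (x (W.erase b)) := by
    intro a ha b hb
    obtain ⟨U, hU, -, h1, h2⟩ := hx.joint_erase hW ha hb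
    exact fun p hp q hq => hU.2 p (h1 hp) q (h2 hq)
  have hKx : ∀ a ∈ W, K ⊆ X.perp (x (W.erase a)) := fun a ha =>
    (hKW a ha).trans (hx.sing _ (hf a ha)).subset_perp
  have hGW : G W ⊆ X.perp (G W) := by
    rintro p hp q hq
    simp only [G, Set.mem_union, Set.mem_iUnion] at hp hq
    rcases hp with hp | ⟨a, ha, hp⟩ <;> rcases hq with hq | ⟨b, hb, hq⟩
    · exact hK.2 p hp q hq
    · exact hKx b hb hp q hq
    · exact (hKx a ha hq p hp).symm
    · exact hxx a ha b hb hp q hq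
  have hGs : ∀ D, D ⊆ W → X.IsSingularSubspace (X.span (G D)) := fun D hD =>
    IsPolarLike.isSingularSubspace_span h.toIsShultSpace
      ((hGmono D W hD).trans (hGW.trans (perp_anti (hGmono D W hD))))
  have key : ∀ D : Finset (Fin n × Bool), D ⊆ W → k + D.card ≤ X.rk (X.span (G D)) := by
    intro D
    induction D using Finset.induction_on with
    | empty =>
      intro hD
      rw [Finset.card_empty, add_zero, ← hrK]
      exact h.rk_mono hK (hGs ∅ hD) (Set.subset_union_left.trans (IsPolarLike.subset_span X _))
    | insert a D ha ih =>
      intro hD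
      have haW := hD (Finset.mem_insert_self a D)
      have hDW := (Finset.subset_insert a D).trans hD
      obtain ⟨v, hvK, hva, hv⟩ := hx.exists_separating h hK hrK (hf a haW) (hKW a haW)
      have h1 : G D ⊆ X.perp {v} := by
        rintro p hp _ rfl
        simp only [G, Set.mem_union, Set.mem_iUnion] at hp
        rcases hp with hp | ⟨b, hb, hp⟩
        · exact (hvK p hp).symm
        · refine (hv _ (hf b (hDW hb)) ?_ (hKW b (hDW hb)) p hp).symm
          exact erase_ne_erase (hDW hb) (by rintro rfl; exact ha hb)
      have h2 := IsPolarLike.subset_perp_span h.toIsShultSpace h1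
      have h3 : x (W.erase a) ⊆ X.span (G (insert a D)) := by
        refine Set.Subset.trans ?_ (IsPolarLike.subset_span X _)
        intro p hp
        simp only [G, Set.mem_union, Set.mem_iUnion]
        exact Or.inr ⟨a, Finset.mem_insert_self a D, hp⟩
      have h4 := h.rk_lt (hGs D hDW) (hGs _ hD)
        (IsPolarLike.span_mono (hGmono _ _ (Finset.subset_insert a D))) (by
          intro hh
          rw [← hh] at h3
          exact hva fun p hp => (h2 (h3 hp) v rfl).symm)
      have h5 := ih hDW
      rw [Finset.card_insert_of_notMem ha]
      omega
  have h1 := key W subset_rfl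
  have h2 := h.rk_le _ (hGs W subset_rfl)
  rw [hW.card_eq] at h1
  omega

/-- The row and the top share x(R∪b) and x(R∪c), hence the ambient subspace. For r ∈ R, which exists
as `1 ≤ k`, the faces R∪d and (R∪{b, c})∖r would then lie in a face with `k + 2` vertices, while
their union has `k + 3`. -/
theorem not_isRowTop_of_isTop (h : X.IsPolarLike n) (hx : X.IsConfiguration n k x) (hk : 1 ≤ k)
    {R : Finset (Fin n × Bool)} {b c d : Fin n × Bool} (hR : IsRow k R d b c)
    (ht : IsTop X k x (insert b (insert c R))) : ¬ IsRowTop X k x R b c d := by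
  rintro ⟨V, hV, hrV, hbV, hcV, hdV⟩
  obtain ⟨U, hU, hrU, hUW⟩ := ht
  have hW := hR.face_pair
  have hfb := hR.swap_right.face_right
  have hfc := hR.face_right
  have hfd := hR.swap_left.swap_right.face_right
  have e1 : (insert b (insert c R)).erase b = insert c R := Finset.erase_insert hR.notMem_mid
  have e2 : (insert b (insert c R)).erase c = insert b R := by
    rw [Finset.insert_comm]
    exact Finset.erase_insert hR.swap_right.notMem_mid
  have hcU : x (insert c R) ⊆ U := by
    have := hUW b (Finset.mem_insert_self _ _)
    rwa [e1] at this
  have hbU : x (insert b R) ⊆ U := by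
    have := hUW c (Finset.mem_insert_of_mem (Finset.mem_insert_self _ _))
    rwa [e2] at this
  have hUV := h.eq_of_two (hx.sing _ hfb) (hx.rk_eq _ hfb)
    (hx.not_subset h hfc hfb (Ne.symm hR.ne_right)) hU hrU hV hrV hbU hcU hbV hcV
  have hRf : IsFace k R := hfb.of_insert (fun hh => hR.notMem_mid (Finset.mem_insert_of_mem hh))
  obtain ⟨r, hr⟩ : R.Nonempty := Finset.card_pos.mp (by rw [hRf.card_eq]; omega)
  have hrW : r ∈ insert b (insert c R) :=
    Finset.mem_insert_of_mem (Finset.mem_insert_of_mem hr)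
  obtain ⟨Z, hZ, hZ1, hZ2⟩ := (hx.joint_iff _ _ (IsFace.erase hW hrW) hfd).mp
    ⟨U, hU, hrU, hUW r hrW, hUV ▸ hdV⟩
  have hsub : insert d (insert b (insert c R)) ⊆ Z := by
    intro i hi
    rcases Finset.mem_insert.mp hi with rfl | hi
    · exact hZ2 (Finset.mem_insert_self _ _)
    · by_cases hir : i = r
      · rw [hir]
        exact hZ2 (Finset.mem_insert_of_mem hr)
      · exact hZ1 (Finset.mem_erase.mpr ⟨hir, hi⟩)
  have := Finset.card_le_card hsub
  rw [hR.face.card_eq, hZ.card_eq] at this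
  omega

theorem inter_subset_of_not_isRowTop (h : X.IsPolarLike n) (hx : X.IsConfiguration n k x)
    {R : Finset (Fin n × Bool)} {c d e : Fin n × Bool} (hR : IsRow k R c d e)
    (ht : ¬ IsRowTop X k x R c d e) :
    x (insert c R) ∩ x (insert d R) ⊆ x (insert e R) := by
  have hce := hx.joint_row hR.swap_left
  have hde := hx.joint_row hR
  have hcd : X.Joint (k + 2) (x (insert c R)) (x (insert d R)) :=
    hx.joint_row hR.swap_right.swap_left
  obtain ⟨U, hU, hrU, hcU, hdU⟩ := hcd
  refine (hx.subset_or_inter_subset h hU hR.swap_left.swap_right.face_right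
    hR.swap_right.face_right hR.face_right hR.swap_right.swap_left.ne_right
    hR.swap_left.ne_right hR.ne_right ⟨U, hU, hrU, hcU, hdU⟩ hce hde hcU hdU).resolve_left ?_
  exact fun heU => ht ⟨U, hU, hrU, hcU, hdU, heU⟩

end IsConfiguration

end PartialLinearSpace

/-! ### From tops to frames -/

namespace PartialLinearSpace

variable {P Q : Type*} {n k : ℕ}

namespace IsConfiguration

variable {X : PartialLinearSpace P} {x : Finset (Fin n × Bool) → Set P}

/-- There is room for a further pair ±g. If x(R∪g) were outside U, it would contain the
intersections of x(R∪c) with x(R∪d) and x(R∪e); these would coincide, against `not_line`. So x(R∪g),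
and likewise x(R∪−g), lies in U, though g and −g lie in no common face. -/
theorem not_isRowTop_of_lt (h : X.IsPolarLike n) (hx : X.IsConfiguration n k x) (hk : k + 3 < n)
    {R : Finset (Fin n × Bool)} {c d e : Fin n × Bool} (hR : IsRow k R c d e) :
    ¬ IsRowTop X k x R c d e := by
  rintro ⟨U, hU, hrU, hcU, hdU, heU⟩
  obtain ⟨g, hg, hg'⟩ := hR.face.exists_notMem hk
  have hfc := hR.swap_left.swap_right.face_right
  have hfd := hR.swap_right.face_right
  have hfe := hR.face_right
  have hcd := hR.swap_right.swap_left.ne_right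
  have hce := hR.swap_left.ne_right
  have hde := hR.ne_right
  have jcd : X.Joint (k + 2) _ _ := hx.joint_row hR.swap_right.swap_left
  have jce : X.Joint (k + 2) _ _ := hx.joint_row hR.swap_left
  have hRf : IsFace k R := hfe.of_insert hR.notMem_right
  have key : ∀ y, y ∉ insert c (insert d (insert e R)) →
      antipode y ∉ insert c (insert d (insert e R)) → x (insert y R) ⊆ U := by
    intro y hy hy'
    simp only [Finset.mem_insert, not_or] at hy hy'
    have hyR : IsFace (k + 1) (insert y R) := hRf.insert hy.2.2.2 hy'.2.2.2
    have hcases : ∀ a, IsFace (k + 1) (insert a R) → a ∉ R → y ≠ a → antipode y ≠ a →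
        insert a R ≠ insert y R ∧ X.Joint (k + 2) (x (insert a R)) (x (insert y R)) := by
      intro a ha haR hya hya'
      refine ⟨fun hh => ?_, (hx.joint_iff _ _ ha hyR).mpr ⟨insert y (insert a R),
        ha.insert (by simp [hya, hy.2.2.2]) (by simp [hya', hy'.2.2.2]),
        Finset.subset_insert _ _, Finset.insert_subset_insert _ (Finset.subset_insert _ _)⟩⟩
      have : a ∈ insert y R := hh ▸ Finset.mem_insert_self a R
      rcases Finset.mem_insert.mp this with h1 | h1
      · exact hya h1.symm
      · exact haR h1
    have hcR : c ∉ R := fun hh => hR.notMem_left (by simp [hh])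
    have hdR : d ∉ R := fun hh => hR.notMem_mid (by simp [hh])
    obtain ⟨ncy, jcy⟩ := hcases c hfc hcR hy.1 hy'.1
    obtain ⟨ndy, jdy⟩ := hcases d hfd hdR hy.2.1 hy'.2.1
    obtain ⟨ney, jey⟩ := hcases e hfe hR.notMem_right hy.2.2.1 hy'.2.2.1
    by_contra hyU
    have h1 := (hx.subset_or_inter_subset h hU hfc hfd hyR hcd ncy ndy jcd jcy jdy hcU
      hdU).resolve_left hyU
    have h2 := (hx.subset_or_inter_subset h hU hfc hfe hyR hce ncy ney jce jcy jey hcU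
      heU).resolve_left hyU
    have sc := hx.sing _ hfc
    have sy := sc.inter_subspace (hx.sing _ hyR).1
    have r1 := hx.rk_inter h hfc hfd hcd jcd
    have r2 := hx.rk_inter h hfc hfe hce jce
    have r3 := hx.rk_inter h hfc hyR ncy jcy
    have e1 := h.eq_of_subset (sc.inter_subspace (hx.sing _ hfd).1) sy
      (Set.subset_inter Set.inter_subset_left h1) (by omega)
    have e2 := h.eq_of_subset (sc.inter_subspace (hx.sing _ hfe).1) sy
      (Set.subset_inter Set.inter_subset_left h2) (by omega)
    exact hx.not_line h sy r3 hU hrU hfc hfd hfe hcd.symm hce.symm hde.symm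
      Set.inter_subset_left (e1 ▸ Set.inter_subset_right) (e2 ▸ Set.inter_subset_right) hcU hdU heU
  have hgU := key g hg hg'
  have hgU' := key (antipode g) hg' (by rwa [antipode_antipode])
  simp only [Finset.mem_insert, not_or] at hg hg'
  have hfg : IsFace (k + 1) (insert g R) := hRf.insert hg.2.2.2 hg'.2.2.2
  obtain ⟨Z, hZ, hZ1, hZ2⟩ := (hx.joint_iff _ _ hfg (hfg.insert_antipode hg.2.2.2)).mp
    ⟨U, hU, hrU, hgU, hgU'⟩
  exact hZ.antipode_notMem g (hZ1 (Finset.mem_insert_self _ _)) (hZ2 (Finset.mem_insert_self _ _))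

/-- With every row sharing an intersection, the centre of a star survives each exchange of a vertex
and so reaches −W. It is non-empty as `1 ≤ k`, and its points would be common to opposite members.
-/
theorem isTop_of_forall_not_isRowTop (h : X.IsPolarLike n) (hx : X.IsConfiguration n k x)
    (hk : 1 ≤ k) (hkn : k + 3 ≤ n)
    (hrow : ∀ R c d e, IsRow k R c d e → ¬ IsRowTop X k x R c d e)
    {W : Finset (Fin n × Bool)} (hW : IsFace (k + 2) W) : IsTop X k x W := by
  refine (hx.isTop_or_isStar h hW).resolve_right ?_
  rintro ⟨K, hK, hrK, hKW⟩
  have h1 : ∀ a ∈ opp W, K ⊆ x ((opp W).erase a) := by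
    refine IsFace.swap_induction' (p := fun W => ∀ a ∈ W, K ⊆ x (W.erase a)) ∅ (by omega) ?_ hW
      hW.opp (Finset.empty_subset _) (Finset.empty_subset _) hKW
    intro S c c' _ hc hc' hcc hF hp a ha
    have hcS := hp c (Finset.mem_insert_self c S)
    rw [Finset.erase_insert hc] at hcS
    rcases Finset.mem_insert.mp ha with rfl | haS
    · rwa [Finset.erase_insert hc']
    · have h2 := hp a (Finset.mem_insert_of_mem haS)
      rw [erase_insert_of_mem haS hc] at h2
      rw [erase_insert_of_mem haS hc']
      have hR := isRow_erase haS hc hc' hcc hF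
      have h3 := hx.inter_subset_of_not_isRowTop h hR (hrow _ _ _ _ hR)
      rw [Finset.insert_erase haS] at h3
      exact (Set.subset_inter hcS h2).trans h3
  obtain ⟨a, ha⟩ : W.Nonempty := Finset.card_pos.mp (by rw [hW.card_eq]; omega)
  obtain ⟨b, hb⟩ := h.nonempty_of_rk_pos hK (by omega)
  have h2 := h1 (antipode a) (mem_opp.mpr (by rwa [antipode_antipode])) hb
  rw [← opp_erase] at h2
  have hf := IsFace.erase hW ha
  exact hx.not_mem_perp_opp hf h2 ((hx.sing _ hf).subset_perp (hKW a ha hb))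

/-- The transfer step for `swap_induction'`: a top face excludes a row top through it, so that row
has a common intersection. -/
theorem inter_subset_of_isTop (h : X.IsPolarLike n) (hx : X.IsConfiguration n k x)
    (hk : 1 ≤ k) {S : Finset (Fin n × Bool)} {a c c' : Fin n × Bool} (ha : a ∈ S) (hc : c ∉ S)
    (hc' : c' ∉ S) (hcc : c ≠ c') (hF : IsFace (k + 3) (insert c (insert c' S)))
    (ht : IsTop X k x (insert c S)) :
    x S ∩ x ((insert c S).erase a) ⊆ x ((insert c' S).erase a) := by
  have hR := isRow_erase ha hc hc' hcc hF
  have h1 : insert a (insert c (S.erase a)) = insert c S := by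
    rw [Finset.insert_comm, Finset.insert_erase ha]
  have h2 := hx.not_isRowTop_of_isTop h hk hR.swap_right.swap_left (h1.symm ▸ ht)
  have h3 := hx.inter_subset_of_not_isRowTop h hR h2
  rwa [Finset.insert_erase ha, ← erase_insert_of_mem ha hc, ← erase_insert_of_mem ha hc'] at h3

/-- Suppose the top S∪c has a star S∪c' as neighbour. Rows identify x(S) ∩ x((S∪c)∖a) with x(S) ∩
x((S∪c')∖a), which contains the centre K. So K lies below all facets of the top, against `not_line`;
three facets are available as `1 ≤ k`. -/
theorem isTop_of_isTop (h : X.IsPolarLike n) (hx : X.IsConfiguration n k x)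
    (hk : 1 ≤ k) (hkn : k + 3 ≤ n) {W W' : Finset (Fin n × Bool)} (hW : IsFace (k + 2) W)
    (hW' : IsFace (k + 2) W') (ht : IsTop X k x W) : IsTop X k x W' := by
  refine IsFace.swap_induction' (p := IsTop X k x) ∅ (by omega) ?_ hW hW'
    (Finset.empty_subset _) (Finset.empty_subset _) ht
  intro S c c' _ hc hc' hcc hF ht
  have hF' : IsFace (k + 3) (insert c' (insert c S)) := by rwa [Finset.insert_comm]
  have hfc : IsFace (k + 2) (insert c S) := hF'.of_insert (by simp [hc', Ne.symm hcc])
  have hfc' : IsFace (k + 2) (insert c' S) := hF.of_insert (by simp [hc, hcc])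
  have hfS : IsFace (k + 1) S := hfc.of_insert hc
  refine (hx.isTop_or_isStar h hfc').resolve_right ?_
  rintro ⟨K, hK, hrK, hKW⟩
  have hKS := hKW c' (Finset.mem_insert_self _ _)
  rw [Finset.erase_insert hc'] at hKS
  obtain ⟨U, hU, hrU, hUW⟩ := id ht
  have hUS := hUW c (Finset.mem_insert_self _ _)
  rw [Finset.erase_insert hc] at hUS
  have key : ∀ a ∈ S, K ⊆ x ((insert c S).erase a) := by
    intro a ha
    have h1 := hx.inter_subset_of_isTop h hk ha hc hc' hcc hF ht
    have hac := Finset.mem_insert_of_mem (b := c) ha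
    have hac' := Finset.mem_insert_of_mem (b := c') ha
    have hne : ∀ {y}, y ∉ S → S ≠ (insert y S).erase a := by
      intro y _ hh
      rw [hh] at ha
      exact Finset.notMem_erase a _ ha
    have hJ := hx.joint_erase hfc (Finset.mem_insert_self c S) hac
    have hJ' := hx.joint_erase hfc' (Finset.mem_insert_self c' S) hac'
    rw [Finset.erase_insert hc] at hJ
    rw [Finset.erase_insert hc'] at hJ'
    have ha1 := IsFace.erase hfc hac
    have ha2 := IsFace.erase hfc' hac'
    have r1 := hx.rk_inter h hfS ha1 (hne hc) hJ
    have r2 := hx.rk_inter h hfS ha2 (hne hc') hJ'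
    have sS := hx.sing S hfS
    have s1 := sS.inter_subspace (hx.sing _ ha1).1
    have s2 := sS.inter_subspace (hx.sing _ ha2).1
    have e1 := h.eq_of_subset s1 s2 (Set.subset_inter Set.inter_subset_left h1) (by omega)
    have h2 := Set.subset_inter hKS (hKW a hac')
    rw [← e1] at h2
    exact h2.trans Set.inter_subset_right
  obtain ⟨a, ha, b, hb, hab⟩ := Finset.one_lt_card.mp
    (show 1 < S.card by rw [hfS.card_eq]; omega)
  have ha' := Finset.mem_insert_of_mem (b := c) ha
  have hb' := Finset.mem_insert_of_mem (b := c) hb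
  have ne1 : (insert c S).erase a ≠ S := by
    intro hh
    rw [← hh] at ha
    exact Finset.notMem_erase a _ ha
  have ne2 : (insert c S).erase b ≠ S := by
    intro hh
    rw [← hh] at hb
    exact Finset.notMem_erase b _ hb
  exact hx.not_line h hK hrK hU hrU hfS (IsFace.erase hfc ha') (IsFace.erase hfc hb') ne1 ne2
    (erase_ne_erase hb' hab.symm) hKS (key a ha) (key b hb) hUS (hUW a ha') (hUW b hb')

/-- The points spanning the subspace that corresponds to `W`. -/
theorem exists_point_of_isTop (h : X.IsPolarLike n) (hx : X.IsConfiguration n k x)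
    {W : Finset (Fin n × Bool)} (hW : IsFace (k + 2) W) {U : Set P}
    (hU : X.IsSingularSubspace U) (hrU : X.rk U = k + 2) (hUW : ∀ a ∈ W, x (W.erase a) ⊆ U)
    {a : Fin n × Bool} (ha : a ∈ W) :
    ∃ q, (∀ q' ∈ U, q' ∈ X.perp (x (opp (W.erase a))) → q' = q) ∧
      (∀ b ∈ W, b ≠ a → q ∈ x (W.erase b)) ∧ q ∉ x (W.erase a) := by
  have hf := IsFace.erase hW ha
  -- U has rank one more than x(−(W∖a)), so some q ∈ U is collinear to all of it. Such points form a
  -- subspace disjoint from the hyperplane x(W∖a) of U, hence q is unique.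
  obtain ⟨q, hqU, hq⟩ := h.exists_mem_perp hU (hx.sing _ hf.opp)
    (by rw [hx.rk_eq _ hf.opp, hrU]; omega)
  have hE := hU.inter_subspace (h.isSubspace_perp (x (opp (W.erase a))))
  have h1 := h.rk_le_rk_inter hE (hx.sing _ hf) hU Set.inter_subset_left (hUW a ha)
    (by rw [hrU, hx.rk_eq _ hf])
  have h2 : U ∩ X.perp (x (opp (W.erase a))) ∩ x (W.erase a) = ∅ := by
    refine Set.eq_empty_of_forall_notMem ?_
    rintro y ⟨⟨-, hy⟩, hy'⟩
    exact hx.not_mem_perp hf hy' hy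
  rw [h2, h.rk_empty] at h1
  have huniq : ∀ q' ∈ U, q' ∈ X.perp (x (opp (W.erase a))) → q' = q := fun q' h3 h4 =>
    h.eq_of_mem_of_rk_le_one hE (by omega) ⟨h3, h4⟩ ⟨hqU, hq⟩
  refine ⟨q, huniq, ?_, fun hh => hx.not_mem_perp hf hh hq⟩
  intro b hb hba
  obtain ⟨z, hz, hzp⟩ := hx.exists_mem_perp_opp hf (IsFace.erase hW hb) (erase_ne_erase hb hba)
  rwa [← huniq z (hUW b hb hz) hzp]

/-- Each hyperplane x(W∖a) lowers the rank of the running intersection, because the point attached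
to a lies in the other facets but not in this one. -/
theorem inter_eq_empty_of_isTop (h : X.IsPolarLike n) (hx : X.IsConfiguration n k x)
    {W : Finset (Fin n × Bool)} (hW : IsFace (k + 2) W) (ht : IsTop X k x W) :
    ⋂ a ∈ W, x (W.erase a) = ∅ := by
  obtain ⟨U, hU, hrU, hUW⟩ := ht
  have hs : ∀ D ⊆ W, X.IsSingularSubspace (U ∩ ⋂ a ∈ D, x (W.erase a)) := by
    intro D hD
    refine hU.inter_subspace ?_
    intro p hp q hq hpq L hL hpL hqL
    refine Set.subset_iInter₂ fun a ha => ?_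
    exact (hx.sing _ (IsFace.erase hW (hD ha))).1 p (Set.mem_iInter₂.mp hp a ha) q
      (Set.mem_iInter₂.mp hq a ha) hpq L hL hpL hqL
  have key : ∀ D : Finset (Fin n × Bool), D ⊆ W →
      X.rk (U ∩ ⋂ a ∈ D, x (W.erase a)) + D.card ≤ k + 2 := by
    intro D
    induction D using Finset.induction_on with
    | empty =>
      intro hD
      rw [Finset.card_empty, add_zero, ← hrU]
      exact h.rk_mono (hs _ hD) hU Set.inter_subset_left
    | insert a D ha ih =>
      intro hD
      have haW := hD (Finset.mem_insert_self a D)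
      have hDW := (Finset.subset_insert a D).trans hD
      obtain ⟨q, -, hq, hqa⟩ := hx.exists_point_of_isTop h hW hU hrU hUW haW
      have h1 := ih hDW
      rw [Finset.card_insert_of_notMem ha]
      by_cases hDe : D = ∅
      · subst hDe
        have h2 := h.rk_mono (hs _ hD) (hx.sing _ (IsFace.erase hW haW))
          (fun y hy => Set.mem_iInter₂.mp hy.2 a (Finset.mem_insert_self a _))
        rw [hx.rk_eq _ (IsFace.erase hW haW)] at h2
        rw [Finset.card_empty]
        omega
      · obtain ⟨b, hb⟩ := Finset.nonempty_iff_ne_empty.mpr hDe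
        have hqU : q ∈ U := hUW b (hDW hb) (hq b (hDW hb) (by rintro rfl; exact ha hb))
        have h2 := h.rk_lt (hs _ hD) (hs _ hDW)
          (Set.inter_subset_inter_right _ (Set.biInter_subset_biInter_left
            (Finset.subset_insert a D))) (by
            intro hh
            have h3 : q ∈ U ∩ ⋂ a ∈ D, x (W.erase a) := ⟨hqU, Set.mem_iInter₂.mpr fun c hc =>
              hq c (hDW hc) (by rintro rfl; exact ha hc)⟩
            rw [← hh] at h3
            exact hqa (Set.mem_iInter₂.mp h3.2 a (Finset.mem_insert_self a D)))
        omega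
  have h1 := key W subset_rfl
  rw [hW.card_eq] at h1
  have h2 := h.eq_empty_of_rk_eq_zero (hs W subset_rfl) (by omega)
  obtain ⟨a, ha⟩ : W.Nonempty := Finset.card_pos.mp (by rw [hW.card_eq]; omega)
  refine Set.subset_eq_empty (fun y hy => ?_) h2
  exact ⟨hUW a ha (Set.mem_iInter₂.mp hy a ha), hy⟩

/-- The point attached to a by one face W is carried by `swap_induction'` to every face through a,
so it depends on a alone. -/
theorem exists_isFrameMap_of_forall_isTop (h : X.IsPolarLike n) (hx : X.IsConfiguration n k x)
    (hk : 1 ≤ k) (hkn : k + 3 ≤ n) (ht : ∀ W, IsFace (k + 2) W → IsTop X k x W) :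
    ∃ p : Fin n × Bool → P, X.IsFrameMap p ∧ ∀ S, IsFace (k + 1) S → ∀ i ∈ S, p i ∈ x S := by
  have hpt : ∀ a : Fin n × Bool, ∃ q, ∀ W, IsFace (k + 2) W → a ∈ W → ∀ b ∈ W, b ≠ a →
      q ∈ x (W.erase b) := by
    intro a
    obtain ⟨W, hW, haW⟩ := (IsFace.singleton a).exists_superset (m' := k + 2) (by omega) (by omega)
    obtain ⟨U, hU, hrU, hUW⟩ := ht W hW
    obtain ⟨q, -, hq, -⟩ := hx.exists_point_of_isTop h hW hU hrU hUW
      (haW (Finset.mem_singleton_self a))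
    refine ⟨q, fun W' hW' haW' => ?_⟩
    refine IsFace.swap_induction' (p := fun W => ∀ b ∈ W, b ≠ a → q ∈ x (W.erase b)) {a}
      (by omega) ?_ hW hW' haW (by simpa using haW') hq
    intro S c c' haS hc hc' hcc hF hp b hb hba
    have haS := haS (Finset.mem_singleton_self a)
    have hcS := hp c (Finset.mem_insert_self c S) (by rintro rfl; exact hc haS)
    rw [Finset.erase_insert hc] at hcS
    rcases Finset.mem_insert.mp hb with rfl | hbS
    · rwa [Finset.erase_insert hc']
    · have hfc : IsFace (k + 2) (insert c S) := by
        rw [Finset.insert_comm] at hF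
        exact hF.of_insert (by simp [hc', Ne.symm hcc])
      exact hx.inter_subset_of_isTop h hk hbS hc hc' hcc hF (ht _ hfc)
        ⟨hcS, hp b (Finset.mem_insert_of_mem hbS) hba⟩
  choose p hp using hpt
  have hmem : ∀ S, IsFace (k + 1) S → ∀ i ∈ S, p i ∈ x S := by
    intro S hS i hi
    obtain ⟨c, hc, hc'⟩ := hS.exists_notMem (by omega)
    have h1 := hp i _ (hS.insert hc hc') (Finset.mem_insert_of_mem hi) c
      (Finset.mem_insert_self c S) (by rintro rfl; exact hc hi)
    rwa [Finset.erase_insert hc] at h1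
  have hnot : ∀ W, IsFace (k + 2) W → ∀ a ∈ W, p a ∉ x (W.erase a) := by
    intro W hW a ha hpa
    have h1 := hx.inter_eq_empty_of_isTop h hW (ht W hW)
    have h2 : p a ∈ ⋂ b ∈ W, x (W.erase b) := by
      refine Set.mem_iInter₂.mpr fun b hb => ?_
      by_cases hba : b = a
      · rwa [hba]
      · exact hp a W hW ha b hb hba
    rw [h1] at h2
    exact h2
  have hcol : ∀ i j : Fin n × Bool, j ≠ antipode i → X.Collinear (p i) (p j) := by
    intro i j hij
    by_cases h1 : i = j
    · rw [h1]
      exact X.collinear_refl _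
    obtain ⟨S, hS, hsub⟩ := (IsFace.pair h1 hij).exists_superset (m' := k + 1) (by omega)
      (by omega)
    exact (hx.sing S hS).2 _ (hmem S hS i (hsub (by simp))) _ (hmem S hS j (hsub (by simp)))
  -- With c added to S, p_a lies outside x((S∪c)∖a), which contains the other p_i with i ∈ S. Hence
  -- the points of S are independent and span x(S).
  have hspan : ∀ S, IsFace (k + 1) S → x S ⊆ X.span (p '' S) := by
    intro S hS
    obtain ⟨c, hc, hc'⟩ := hS.exists_notMem (by omega)
    have hW := hS.insert hc hc'
    have hsub : ∀ D ⊆ S, X.span (p '' D) ⊆ x S := fun D hD => by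
      refine IsPolarLike.span_subset (hx.sing S hS).1 ?_
      rintro _ ⟨i, hi, rfl⟩
      exact hmem S hS i (hD hi)
    have hs : ∀ D ⊆ S, X.IsSingularSubspace (X.span (p '' D)) := fun D hD =>
      ⟨IsPolarLike.isSubspace_span X _, fun q hq r hr =>
        (hx.sing S hS).2 q (hsub D hD hq) r (hsub D hD hr)⟩
    have key : ∀ D : Finset (Fin n × Bool), D ⊆ S → D.card ≤ X.rk (X.span (p '' D)) := by
      intro D
      induction D using Finset.induction_on with
      | empty => simp
      | insert a D ha ih =>
        intro hD
        have haS := hD (Finset.mem_insert_self a D)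
        have hDS := (Finset.subset_insert a D).trans hD
        have h1 : X.span (p '' D) ⊆ x ((insert c S).erase a) := by
          have haW := Finset.mem_insert_of_mem (b := c) haS
          refine IsPolarLike.span_subset (hx.sing _ (IsFace.erase hW haW)).1 ?_
          rintro _ ⟨i, hi, rfl⟩
          exact hp i _ hW (Finset.mem_insert_of_mem (hDS hi)) a haW
            (by rintro rfl; exact ha hi)
        have h2 : p a ∈ X.span (p '' (insert a D : Finset _)) :=
          IsPolarLike.subset_span X _ ⟨a, by simp, rfl⟩
        have h3 := h.rk_lt (hs D hDS) (hs _ hD)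
          (IsPolarLike.span_mono (Set.image_mono (Finset.coe_subset.mpr
            (Finset.subset_insert a D)))) (by
            intro hh
            rw [← hh] at h2
            exact hnot _ hW a (Finset.mem_insert_of_mem haS) (h1 h2))
        have h4 := ih hDS
        rw [Finset.card_insert_of_notMem ha]
        omega
    refine (h.eq_of_subset (hs S subset_rfl) (hx.sing S hS) (hsub S subset_rfl) ?_).ge
    rw [hx.rk_eq S hS, ← hS.card_eq]
    exact key S subset_rfl
  refine ⟨p, fun i j => ⟨?_, hcol i j⟩, hmem⟩
  rintro hc rfl
  obtain ⟨S, hS, hiS⟩ := (IsFace.singleton i).exists_superset (m' := k + 1) (by omega) (by omega)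
  refine hx.not_mem_perp hS (hmem S hS i (hiS (by simp))) ?_
  -- If p_i were collinear to p_{−i}, it would be collinear to all the points spanning x(−S),
  -- although it lies in x(S).
  have h1 : p '' (opp S : Finset _) ⊆ X.perp {p i} := by
    rintro _ ⟨j, -, rfl⟩ _ rfl
    by_cases hij : j = antipode i
    · rw [hij]
      exact hc.symm
    · exact (hcol i j hij).symm
  have h2 := (hspan _ hS.opp).trans (IsPolarLike.subset_perp_span h.toIsShultSpace h1)
  exact fun a ha => (h2 ha _ rfl).symm

/-- For `k = n - 2` the tops are maximal singular subspaces and form a hypercube, and x(S) is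
recovered as the intersection of the tops of S∪c and S∪−c. -/
theorem exists_isFrameMap_of_forall_isTop_of_eq (h : X.IsPolarLike n)
    (hx : X.IsConfiguration n k x) (hkn : k + 2 = n)
    (ht : ∀ W, IsFace (k + 2) W → IsTop X k x W) :
    ∃ p : Fin n × Bool → P, X.IsFrameMap p ∧ ∀ S, IsFace (k + 1) S → ∀ i ∈ S, p i ∈ x S := by
  subst hkn
  have hex : ∀ W : Finset (Fin (k + 2) × Bool), ∃ U, IsFace (k + 2) W →
      X.IsSingularSubspace U ∧ X.rk U = k + 2 ∧ ∀ a ∈ W, x (W.erase a) ⊆ U := by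
    intro W
    by_cases hW : IsFace (k + 2) W
    · obtain ⟨U, hU⟩ := ht W hW
      exact ⟨U, fun _ => hU⟩
    · exact ⟨∅, fun hh => absurd hh hW⟩
  choose u hu using hex
  have hRu : ∀ R c, c ∉ R → IsFace (k + 2) (insert c R) → x R ⊆ u (insert c R) := by
    intro R c hc hR
    have h1 := (hu _ hR).2.2 c (Finset.mem_insert_self c R)
    rwa [Finset.erase_insert hc] at h1
  obtain ⟨p, hp, hpu⟩ := h.exists_isFrameMap_of_hypercube (u := u)
    (fun W hW => (hu W hW).1) (fun W hW => (hu W hW).2.1) (by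
      intro R c hc hR
      have hR' := hR.insert_antipode hc
      have hRf := hR.of_insert hc
      have h1 := h.rk_mono (hx.sing R hRf) ((hu _ hR).1.inter_subspace (hu _ hR').1.1)
        (Set.subset_inter (hRu R c hc hR) (hRu R _ hR.antipode_notMem_of_insert hR'))
      rw [hx.rk_eq R hRf] at h1
      omega) (by
      intro W hW
      refine Set.eq_empty_of_forall_notMem ?_
      rintro z ⟨hz, hz'⟩
      -- A point common to the tops of W and −W is collinear to every x(−(W∖a)), so it equals the
      -- attached point for every a ∈ W. These points differ for distinct a.
      have hperp : ∀ a ∈ W, z ∈ X.perp (x (opp (W.erase a))) := by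
        intro a ha y hy
        have ha' : antipode a ∈ opp W := mem_opp.mpr (by rwa [antipode_antipode])
        rw [opp_erase] at hy
        exact (hu _ hW.opp).1.2 z hz' y ((hu _ hW.opp).2.2 _ ha' hy)
      obtain ⟨a, ha, b, hb, hab⟩ := Finset.one_lt_card.mp
        (show 1 < W.card by rw [hW.card_eq]; omega)
      obtain ⟨hU, hrU, hUW⟩ := hu W hW
      obtain ⟨q, hq1, hq2, -⟩ := hx.exists_point_of_isTop h hW hU hrU hUW ha
      obtain ⟨r, hr1, -, hr3⟩ := hx.exists_point_of_isTop h hW hU hrU hUW hb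
      have h1 := hq1 z hz (hperp a ha)
      have h2 := hr1 z hz (hperp b hb)
      rw [← h2, h1] at hr3
      exact hr3 (hq2 b hb hab.symm))
  refine ⟨p, hp, fun S hS i hi => ?_⟩
  obtain ⟨c, hc, hc'⟩ := hS.exists_notMem (by omega)
  have hF := hS.insert hc hc'
  have hF' := hF.insert_antipode hc
  have hI := (hu _ hF).1.inter_subspace (hu _ hF').1.1
  have hlt := h.rk_lt hI (hu _ hF).1 Set.inter_subset_left (by
    intro hh
    have h1 := hpu _ hF c (Finset.mem_insert_self c S)
    rw [← hh] at h1
    exact (hp _ _).mp ((hu _ hF').1.2 _ h1.2 _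
      (hpu _ hF' (antipode c) (Finset.mem_insert_self _ S))) rfl)
  rw [(hu _ hF).2.1] at hlt
  have heq := h.eq_of_subset (hx.sing S hS) hI
    (Set.subset_inter (hRu S c hc hF) (hRu S _ hc' hF')) (by rw [hx.rk_eq S hS]; omega)
  rw [heq]
  exact ⟨hpu _ hF i (Finset.mem_insert_of_mem hi), hpu _ hF' i (Finset.mem_insert_of_mem hi)⟩

end IsConfiguration

end PartialLinearSpace

/-! ### The exceptional symmetry for n = 4, k = 1 -/

namespace PartialLinearSpace

variable {P Q : Type*} {n k : ℕ}

/-- Two edges of the cross-polytope lie in a common triangle. -/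
theorem exists_triangle_iff {S T : Finset (Fin n × Bool)} (hn : 3 ≤ n) (hS : IsFace 2 S)
    (hT : IsFace 2 T) : (∃ W, IsFace 3 W ∧ S ⊆ W ∧ T ⊆ W) ↔
      (∃ i ∈ S, i ∈ T) ∧ ∀ i ∈ S, antipode i ∉ T := by
  constructor
  · rintro ⟨W, hW, hSW, hTW⟩
    refine ⟨?_, fun i hi hi' => hW.antipode_notMem i (hSW hi) (hTW hi')⟩
    by_contra! hcon
    have h1 := Finset.card_union_of_disjoint (Finset.disjoint_left.mpr hcon)
    have h2 := Finset.card_le_card (Finset.union_subset hSW hTW)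
    rw [h1, hS.card_eq, hT.card_eq, hW.card_eq] at h2
    omega
  · rintro ⟨⟨i, hi, hi'⟩, hST⟩
    have hF : IsFace (S ∪ T).card (S ∪ T) := by
      refine ⟨fun j hj hj' => ?_, rfl⟩
      rcases Finset.mem_union.mp hj with h1 | h1 <;> rcases Finset.mem_union.mp hj' with h2 | h2
      · exact hS.antipode_notMem j h1 h2
      · exact hST j h1 h2
      · exact hST _ h2 (by rwa [antipode_antipode])
      · exact hT.antipode_notMem j h1 h2
    have hc : (S ∪ T).card ≤ 3 := by
      have h1 := Finset.card_union_add_card_inter S T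
      have h2 : 0 < (S ∩ T).card := Finset.card_pos.mpr ⟨i, Finset.mem_inter.mpr ⟨hi, hi'⟩⟩
      rw [hS.card_eq, hT.card_eq] at h1
      omega
    obtain ⟨W, hW, hsub⟩ := hF.exists_superset hc hn
    exact ⟨W, hW, Finset.subset_union_left.trans hsub, Finset.subset_union_right.trans hsub⟩

/-- The automorphism of the edge graph of the `4`-dimensional cross-polytope induced by the
reflection of the root system `D₄` in half the sum of the vertices of a facet `E`. -/
def reflect (E S : Finset (Fin 4 × Bool)) : Finset (Fin 4 × Bool) :=
  if S ⊆ E then opp (E \ S) else if S ⊆ opp E then E \ opp S else S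

section reflect

variable {E S T : Finset (Fin 4 × Bool)}

theorem opp_subset_iff {S T : Finset (Fin n × Bool)} : opp S ⊆ opp T ↔ S ⊆ T := by
  constructor
  · intro hsub i hi
    have := hsub (mem_opp.mpr (by rwa [antipode_antipode]) : antipode i ∈ opp S)
    rwa [mem_opp, antipode_antipode] at this
  · exact fun hsub i hi => mem_opp.mpr (hsub (mem_opp.mp hi))

theorem not_subset_opp {S E : Finset (Fin n × Bool)} {m : ℕ} (hE : IsFace m E)
    (hne : S.Nonempty) (hSE : S ⊆ E) : ¬ S ⊆ opp E := by
  obtain ⟨i, hi⟩ := hne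
  exact fun hh => hE.antipode_notMem i (hSE hi) (mem_opp.mp (hh hi))

theorem IsFace.nonempty {S : Finset (Fin n × Bool)} {m : ℕ} (hS : IsFace (m + 1) S) :
    S.Nonempty :=
  Finset.card_pos.mp (by rw [hS.card_eq]; omega)

theorem IsFace.sdiff (hE : IsFace 4 E) (hS : IsFace 2 S) (hSE : S ⊆ E) : IsFace 2 (E \ S) := by
  have h1 := hE.mono (Finset.sdiff_subset (s := E) (t := S))
  rwa [Finset.card_sdiff_of_subset hSE, hE.card_eq, hS.card_eq] at h1

theorem reflect_of_subset (hSE : S ⊆ E) : reflect E S = opp (E \ S) := if_pos hSE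

theorem reflect_of_subset_opp (hE : IsFace 4 E) (hS : IsFace 2 S) (hSE : S ⊆ opp E) :
    reflect E S = E \ opp S := by
  rw [reflect, if_neg fun hh => not_subset_opp hE hS.nonempty hh hSE, if_pos hSE]

theorem reflect_of_not_subset (h₁ : ¬ S ⊆ E) (h₂ : ¬ S ⊆ opp E) : reflect E S = S := by
  rw [reflect, if_neg h₁, if_neg h₂]

theorem reflect_opp (hE : IsFace 4 E) (hS : IsFace 2 S) :
    reflect E (opp S) = opp (reflect E S) := by
  by_cases h1 : S ⊆ E
  · rw [reflect_of_subset h1, reflect_of_subset_opp hE hS.opp (opp_subset_iff.mpr h1), opp_opp,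
      opp_opp]
  by_cases h2 : S ⊆ opp E
  · rw [reflect_of_subset_opp hE hS h2, reflect_of_subset]
    rwa [← opp_subset_iff, opp_opp]
  · rw [reflect_of_not_subset h1 h2, reflect_of_not_subset]
    · rwa [← opp_subset_iff, opp_opp]
    · rwa [opp_subset_iff]

theorem isFace_reflect (hE : IsFace 4 E) (hS : IsFace 2 S) : IsFace 2 (reflect E S) := by
  by_cases h1 : S ⊆ E
  · rw [reflect_of_subset h1]
    exact (hE.sdiff hS h1).opp
  by_cases h2 : S ⊆ opp E
  · rw [reflect_of_subset_opp hE hS h2]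
    exact hE.sdiff hS.opp (by rwa [← opp_subset_iff, opp_opp])
  · rwa [reflect_of_not_subset h1 h2]

theorem reflect_reflect (hE : IsFace 4 E) (hS : IsFace 2 S) : reflect E (reflect E S) = S := by
  have key : ∀ S, IsFace 2 S → S ⊆ E → reflect E (reflect E S) = S := by
    intro S hS h1
    have h2 : E \ S ⊆ E := Finset.sdiff_subset
    rw [reflect_of_subset h1, reflect_of_subset_opp hE (hE.sdiff hS h1).opp
      (opp_subset_iff.mpr h2), opp_opp, Finset.sdiff_sdiff_eq_self h1]
  by_cases h1 : S ⊆ E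
  · exact key S hS h1
  by_cases h2 : S ⊆ opp E
  · have h3 := key (opp S) hS.opp (by rwa [← opp_subset_iff, opp_opp])
    rw [reflect_opp hE hS, reflect_opp hE (isFace_reflect hE hS)] at h3
    exact opp_injective h3
  · rw [reflect_of_not_subset h1 h2, reflect_of_not_subset h1 h2]

/-- Reading edges as vectors ±e_i ± e_j, the condition is that the inner product is positive, which
a reflection preserves. The check is by the position of each edge: in E, in −E, or in neither. -/
theorem reflect_joint (hE : IsFace 4 E) (hS : IsFace 2 S) (hT : IsFace 2 T)
    (hI : ∃ i ∈ S, i ∈ T) (hST : ∀ i ∈ S, antipode i ∉ T) :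
    (∃ i ∈ reflect E S, i ∈ reflect E T) ∧
      ∀ i ∈ reflect E S, antipode i ∉ reflect E T := by
  have hnE : ∀ i, i ∉ E → antipode i ∈ E := fun i hi =>
    (hE.mem_or_antipode_mem i).resolve_left hi
  have inner : ∀ S T, IsFace 2 S → IsFace 2 T → S ⊆ E → T ⊆ E → (∃ i ∈ S, i ∈ T) →
      (∃ i ∈ reflect E S, i ∈ reflect E T) ∧
        ∀ i ∈ reflect E S, antipode i ∉ reflect E T := by
    rintro S T hS hT hSE hTE ⟨i, hi, hi'⟩
    rw [reflect_of_subset hSE, reflect_of_subset hTE]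
    constructor
    -- Two edges with a common vertex cover at most three vertices of E; the antipode of a missed
    -- one is common to the reflected edges.
    · have hc : (S ∪ T).card < E.card := by
        have h1 := Finset.card_union_add_card_inter S T
        have h2 : 0 < (S ∩ T).card := Finset.card_pos.mpr ⟨i, Finset.mem_inter.mpr ⟨hi, hi'⟩⟩
        rw [hS.card_eq, hT.card_eq] at h1
        rw [hE.card_eq]
        omega
      obtain ⟨m, hm, hm'⟩ := Finset.exists_mem_notMem_of_card_lt_card hc
      rw [Finset.mem_union, not_or] at hm'
      refine ⟨antipode m, ?_, ?_⟩ <;> rw [mem_opp, antipode_antipode, Finset.mem_sdiff]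
      · exact ⟨hm, hm'.1⟩
      · exact ⟨hm, hm'.2⟩
    · intro j hj hj'
      rw [mem_opp, Finset.mem_sdiff] at hj hj'
      exact hE.antipode_notMem _ hj.1 hj'.1
  have mixed : ∀ S T, IsFace 2 S → IsFace 2 T → S ⊆ E → ¬ T ⊆ E → ¬ T ⊆ opp E →
      (∃ i ∈ S, i ∈ T) → (∀ i ∈ S, antipode i ∉ T) →
      (∃ i ∈ reflect E S, i ∈ T) ∧ ∀ i ∈ reflect E S, antipode i ∉ T := by
    rintro S T hS hT hSE hTE hTE' ⟨i, hi, hi'⟩ hST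
    rw [reflect_of_subset hSE]
    obtain ⟨j, hj, hjE⟩ := Finset.not_subset.mp hTE
    have hjE' := hnE j hjE
    have hij : i ≠ j := by rintro rfl; exact hjE (hSE hi)
    have hTij : ∀ l ∈ T, l = i ∨ l = j := by
      have h1 : {i, j} = T := by
        refine Finset.eq_of_subset_of_card_le ?_ ?_
        · intro l hl
          rcases Finset.mem_insert.mp hl with rfl | hl
          · exact hi'
          · rwa [Finset.mem_singleton.mp hl]
        · rw [hT.card_eq, Finset.card_pair hij]
      intro l hl
      rw [← h1] at hl
      simpa using hl
    constructor
    · refine ⟨j, ?_, hj⟩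
      rw [mem_opp, Finset.mem_sdiff]
      exact ⟨hjE', fun hh => hST _ hh (by rwa [antipode_antipode])⟩
    · intro l hl hlT
      rw [mem_opp, Finset.mem_sdiff] at hl
      rcases hTij _ hlT with h1 | h1
      · exact hl.2 (h1 ▸ hi)
      · exact hjE (h1 ▸ hl.1)
  have mixed' : ∀ S T, IsFace 2 S → IsFace 2 T → S ⊆ opp E → ¬ T ⊆ E → ¬ T ⊆ opp E →
      (∃ i ∈ S, i ∈ T) → (∀ i ∈ S, antipode i ∉ T) →
      (∃ i ∈ reflect E S, i ∈ T) ∧ ∀ i ∈ reflect E S, antipode i ∉ T := by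
    rintro S T hS hT hSE hTE hTE' ⟨i, hi, hi'⟩ hST
    have h1 := mixed (opp S) (opp T) hS.opp hT.opp (by rwa [← opp_subset_iff, opp_opp])
      (by rwa [← opp_subset_iff, opp_opp]) (by rwa [opp_subset_iff])
      ⟨antipode i, by rwa [mem_opp, antipode_antipode], by rwa [mem_opp, antipode_antipode]⟩
      (fun j hj hj' => by
        rw [mem_opp] at hj hj'
        exact hST _ hj hj')
    rw [reflect_opp hE hS] at h1
    obtain ⟨⟨j, hj, hj'⟩, h2⟩ := h1
    refine ⟨⟨antipode j, mem_opp.mp hj, mem_opp.mp hj'⟩, fun l hl hl' => h2 (antipode l) ?_ ?_⟩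
    · rwa [mem_opp, antipode_antipode]
    · rwa [mem_opp, antipode_antipode]
  have symm : ∀ {A B : Finset (Fin 4 × Bool)},
      ((∃ i ∈ A, i ∈ B) ∧ ∀ i ∈ A, antipode i ∉ B) →
      (∃ i ∈ B, i ∈ A) ∧ ∀ i ∈ B, antipode i ∉ A := by
    rintro A B ⟨⟨i, hi, hi'⟩, h2⟩
    exact ⟨⟨i, hi', hi⟩, fun j hj hj' => h2 _ hj' (by rwa [antipode_antipode])⟩
  obtain ⟨i, hi, hi'⟩ := hI
  have hTS := (symm ⟨⟨i, hi, hi'⟩, hST⟩).2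
  by_cases hSE : S ⊆ E
  · by_cases hTE : T ⊆ E
    · exact inner S T hS hT hSE hTE ⟨i, hi, hi'⟩
    by_cases hTE' : T ⊆ opp E
    · exact absurd (mem_opp.mp (hTE' hi')) (hE.antipode_notMem i (hSE hi))
    · have h1 := mixed S T hS hT hSE hTE hTE' ⟨i, hi, hi'⟩ hST
      rwa [reflect_of_not_subset hTE hTE']
  by_cases hSE' : S ⊆ opp E
  · by_cases hTE' : T ⊆ opp E
    · have h1 := inner (opp S) (opp T) hS.opp hT.opp (by rwa [← opp_subset_iff, opp_opp])
        (by rwa [← opp_subset_iff, opp_opp])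
        ⟨antipode i, by rwa [mem_opp, antipode_antipode], by rwa [mem_opp, antipode_antipode]⟩
      rw [reflect_opp hE hS, reflect_opp hE hT] at h1
      obtain ⟨⟨j, hj, hj'⟩, h2⟩ := h1
      refine ⟨⟨antipode j, mem_opp.mp hj, mem_opp.mp hj'⟩, fun l hl hl' => h2 (antipode l) ?_ ?_⟩
      · rwa [mem_opp, antipode_antipode]
      · rwa [mem_opp, antipode_antipode]
    by_cases hTE : T ⊆ E
    · exact absurd (mem_opp.mp (hSE' hi)) (hE.antipode_notMem i (hTE hi'))
    · have h1 := mixed' S T hS hT hSE' hTE hTE' ⟨i, hi, hi'⟩ hST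
      rwa [reflect_of_not_subset hTE hTE']
  · rw [reflect_of_not_subset hSE hSE']
    by_cases hTE : T ⊆ E
    · exact symm (mixed T S hT hS hTE hSE hSE' ⟨i, hi', hi⟩ hTS)
    by_cases hTE' : T ⊆ opp E
    · exact symm (mixed' T S hT hS hTE' hSE hSE' ⟨i, hi', hi⟩ hTS)
    · rw [reflect_of_not_subset hTE hTE']
      exact ⟨⟨i, hi, hi'⟩, hST⟩

end reflect

/-! ### The case distinction -/

namespace IsConfiguration

variable {X : PartialLinearSpace P}

theorem comp_reflect {x : Finset (Fin 4 × Bool) → Set P} (hx : X.IsConfiguration 4 1 x)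
    {E : Finset (Fin 4 × Bool)} (hE : IsFace 4 E) :
    X.IsConfiguration 4 1 (fun S => x (reflect E S)) := by
  refine ⟨fun S hS => hx.sing _ (isFace_reflect hE hS), fun S hS =>
    hx.rk_eq _ (isFace_reflect hE hS), ?_, fun hh => absurd hh (by norm_num), ?_⟩
  · intro S T hS hT
    have hS' := isFace_reflect hE hS
    have hT' := isFace_reflect hE hT
    rw [hx.joint_iff _ _ hS' hT', exists_triangle_iff (by norm_num) hS' hT',
      exists_triangle_iff (by norm_num) hS hT]
    constructor
    · rintro ⟨h1, h2⟩
      have h3 := reflect_joint hE hS' hT' h1 h2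
      rwa [reflect_reflect hE hS, reflect_reflect hE hT] at h3
    · rintro ⟨h1, h2⟩
      exact reflect_joint hE hS hT h1 h2
  · intro S T hS hT
    rw [hx.opposite_iff _ _ (isFace_reflect hE hS) (isFace_reflect hE hT), ← reflect_opp hE hS]
    constructor
    · intro hh
      rw [← reflect_reflect hE hT, hh, reflect_reflect hE hS.opp]
    · rintro rfl
      rfl

/-- For a row at the vertex a, take E = {c, d, −a, −e}. The reflection fixes the edges ac and ad and
sends cd to ae, so the row becomes the three sides of the triangle acd. -/
theorem exists_isTop_comp_reflect {x : Finset (Fin 4 × Bool) → Set P}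
    {R : Finset (Fin 4 × Bool)} {c d e : Fin 4 × Bool} (hR : IsRow 1 R c d e)
    (ht : IsRowTop X 1 x R c d e) : ∃ E, IsFace 4 E ∧ ∃ W, IsFace 3 W ∧
      IsTop X 1 (fun S => x (reflect E S)) W := by
  obtain ⟨U, hU, hrU, hcU, hdU, heU⟩ := ht
  have hRf : IsFace 1 R := hR.face_right.of_insert hR.notMem_right
  obtain ⟨a, rfl⟩ := Finset.card_eq_one.mp hRf.card_eq
  obtain ⟨hF, h1, h2, h3⟩ := hR
  simp only [Finset.mem_insert, Finset.mem_singleton, not_or] at h1 h2 h3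
  obtain ⟨hcd, hce, hca⟩ := h1
  obtain ⟨hde, hda⟩ := h2
  have hF' := hF.antipode_notMem
  simp only [Finset.mem_insert, Finset.mem_singleton, forall_eq_or_imp, forall_eq, not_or] at hF'
  obtain ⟨⟨-, c1, c2, c3⟩, ⟨d1, -, d2, d3⟩, ⟨e1, e2, -, e3⟩, a1, a2, a3, -⟩ := hF'
  have ae : antipode a ≠ antipode e := fun hh => h3 (antipode_injective hh).symm
  have hE : IsFace 4 {c, d, antipode a, antipode e} := by
    have f1 : IsFace 1 {antipode e} := IsFace.singleton _
    have f2 : IsFace 2 {antipode a, antipode e} :=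
      f1.insert (by simpa using ae) (by rw [antipode_antipode, Finset.mem_singleton]; exact fun hh => e3 hh.symm)
    have f3 : IsFace 3 {d, antipode a, antipode e} := by
      refine f2.insert ?_ ?_
      · simp only [Finset.mem_insert, Finset.mem_singleton, not_or]
        exact ⟨fun hh => a2 hh.symm, fun hh => e2 hh.symm⟩
      · simp only [Finset.mem_insert, Finset.mem_singleton, not_or]
        exact ⟨fun hh => hda (antipode_injective hh), fun hh => hde (antipode_injective hh)⟩
    refine f3.insert ?_ ?_
    · simp only [Finset.mem_insert, Finset.mem_singleton, not_or]
      exact ⟨hcd, fun hh => a1 hh.symm, fun hh => e1 hh.symm⟩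
    · simp only [Finset.mem_insert, Finset.mem_singleton, not_or]
      exact ⟨c1, fun hh => hca (antipode_injective hh), fun hh => hce (antipode_injective hh)⟩
  have hW : IsFace 3 {a, c, d} := by
    have f2 : IsFace 2 {c, d} := IsFace.pair hcd (fun hh => c1 hh.symm)
    refine f2.insert ?_ ?_
    · simp only [Finset.mem_insert, Finset.mem_singleton, not_or]
      exact ⟨Ne.symm hca, Ne.symm hda⟩
    · simp only [Finset.mem_insert, Finset.mem_singleton, not_or]
      exact ⟨a1, a2⟩
  refine ⟨_, hE, _, hW, U, hU, hrU, ?_⟩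
  have haE : a ∉ ({c, d, antipode a, antipode e} : Finset (Fin 4 × Bool)) := by
    simp only [Finset.mem_insert, Finset.mem_singleton, not_or]
    exact ⟨Ne.symm hca, Ne.symm hda, fun hh => antipode_ne a hh.symm, fun hh => e3 hh.symm⟩
  have hmix : ∀ y ∈ ({c, d, antipode a, antipode e} : Finset (Fin 4 × Bool)),
      reflect {c, d, antipode a, antipode e} {a, y} = {a, y} := by
    intro y hy
    refine reflect_of_not_subset (fun hh => haE (hh (by simp))) fun hh => ?_
    exact hE.antipode_notMem y hy (mem_opp.mp (hh (by simp)))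
  have hcd' : reflect {c, d, antipode a, antipode e} {c, d} = {e, a} := by
    rw [reflect_of_subset (by
      intro i hi
      simp only [Finset.mem_insert, Finset.mem_singleton] at hi ⊢
      rcases hi with h | h
      · exact Or.inl h
      · exact Or.inr (Or.inl h))]
    ext i
    simp only [mem_opp, Finset.mem_sdiff, Finset.mem_insert, Finset.mem_singleton, not_or,
      antipode_injective.eq_iff]
    constructor
    · rintro ⟨h4 | h4 | h4 | h4, h5, h6⟩
      · exact absurd h4 h5
      · exact absurd h4 h6
      · exact Or.inr h4
      · exact Or.inl h4
    · rintro (rfl | rfl)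
      · exact ⟨Or.inr (Or.inr (Or.inr rfl)), e1, e2⟩
      · exact ⟨Or.inr (Or.inr (Or.inl rfl)), a1, a2⟩
  intro b hb
  simp only [Finset.mem_insert, Finset.mem_singleton] at hb
  rcases hb with rfl | rfl | rfl
  · have : ({b, c, d} : Finset (Fin 4 × Bool)).erase b = {c, d} :=
      Finset.erase_insert (by simp [Ne.symm hca, Ne.symm hda])
    simp only [this, hcd']
    exact heU
  · have : ({a, b, d} : Finset (Fin 4 × Bool)).erase b = {a, d} := by
      rw [Finset.insert_comm]
      exact Finset.erase_insert (by simp [hca, hcd])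
    simp only [this]
    rw [hmix d (by simp), Finset.pair_comm]
    exact hdU
  · have : ({a, c, b} : Finset (Fin 4 × Bool)).erase b = {a, c} := by
      rw [Finset.pair_comm c b, Finset.insert_comm]
      exact Finset.erase_insert (by simp [hda, Ne.symm hcd])
    simp only [this]
    rw [hmix c (by simp), Finset.pair_comm]
    exact hcU

/-- Up to an automorphism of the graph of the thin polar space, a configuration is spanned by the
points of a frame. -/
theorem exists_isFrameMap {x : Finset (Fin n × Bool) → Set P} (h : X.IsPolarLike n)
    (hx : X.IsConfiguration n k x) (hkn : k < n) :
    ∃ y : Finset (Fin n × Bool) → Set P, X.IsConfiguration n k y ∧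
      (∀ A : Set P, (∃ S, IsFace (k + 1) S ∧ A = x S) ↔ ∃ S, IsFace (k + 1) S ∧ A = y S) ∧
      ∃ p : Fin n × Bool → P, X.IsFrameMap p ∧ ∀ S, IsFace (k + 1) S → ∀ i ∈ S, p i ∈ y S := by
  rcases Nat.eq_zero_or_pos k with rfl | hk
  · exact ⟨x, hx, fun _ => Iff.rfl, hx.exists_isFrameMap_of_points h⟩
  by_cases hk1 : k + 1 = n
  · exact ⟨x, hx, fun _ => Iff.rfl, hx.exists_isFrameMap_of_maximal h hk1⟩
  by_cases hk2 : k + 2 = n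
  · refine ⟨x, hx, fun _ => Iff.rfl, hx.exists_isFrameMap_of_forall_isTop_of_eq h hk2 ?_⟩
    intro W hW
    -- A star would give 2k + 2 ≤ n = k + 2, impossible for k > 0.
    refine (hx.isTop_or_isStar h hW).resolve_right fun hs => ?_
    have := hx.le_of_isStar h hW hs
    omega
  have hk3 : k + 3 ≤ n := by omega
  by_cases htop : ∀ W, IsFace (k + 2) W → IsTop X k x W
  · exact ⟨x, hx, fun _ => Iff.rfl, hx.exists_isFrameMap_of_forall_isTop h hk hk3 htop⟩
  have hrow : ∃ R c d e, IsRow k R c d e ∧ IsRowTop X k x R c d e := by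
    by_contra! hcon
    exact htop fun W hW => hx.isTop_of_forall_not_isRowTop h hk hk3 hcon hW
  obtain ⟨R, c, d, e, hR, hRt⟩ := hrow
  have hn : n ≤ k + 3 := by
    by_contra hlt
    exact hx.not_isRowTop_of_lt h (by omega) hR hRt
  push Not at htop
  obtain ⟨W, hW, hWt⟩ := htop
  have h2k := hx.le_of_isStar h hW ((hx.isTop_or_isStar h hW).resolve_left hWt)
  -- The row top gives n ≤ k + 3 and the star 2k + 2 ≤ n.
  obtain rfl : k = 1 := by omega
  obtain rfl : n = 4 := by omega
  obtain ⟨E, hE, V, hV, hVt⟩ := exists_isTop_comp_reflect hR hRt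
  have hy := hx.comp_reflect hE
  -- The reflection is an involution on edges, so composing with it keeps the family of images.
  refine ⟨_, hy, fun A => ?_, hy.exists_isFrameMap_of_forall_isTop h hk hk3
    fun W hW => hy.isTop_of_isTop h hk hk3 hV hW hVt⟩
  constructor
  · rintro ⟨S, hS, rfl⟩
    exact ⟨reflect E S, isFace_reflect hE hS, by rw [reflect_reflect hE hS]⟩
  · rintro ⟨S, hS, rfl⟩
    exact ⟨reflect E S, isFace_reflect hE hS, rfl⟩

end IsConfiguration

end PartialLinearSpace

open PartialLinearSpace in
theorem corollary1 {P Q : Type*} (n k : ℕ) (hk : k < n)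
    (X : PartialLinearSpace P)
    (hX : (X.IsPolarSpace ∧ X.HasRank n) ∨ X.IsThinPolarSpace n)
    (T : PartialLinearSpace Q) (hT : T.IsThinPolarSpace n)
    (f : T.grassmannGraph n k ↪g X.grassmannGraph n k) (hf : IsIsometricEmbedding f) :
    X.IsApartment n k (Set.range f) := by
  have h : X.IsPolarLike n := by
    rcases hX with ⟨hX, hr⟩ | hX
    · exact isPolarLike_of_isPolarSpace hX hr
    · obtain ⟨-, p, hp⟩ := hX.exists_param
      exact hp.isPolarLike
  obtain ⟨-, p, hp⟩ := hT.exists_param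
  obtain ⟨x, hx, hrange⟩ := hp.exists_isConfiguration h hk f hf
  obtain ⟨y, hy, hxy, q, hq, hqy⟩ := hx.exists_isFrameMap h hk
  rw [hrange]
  have : {S : X.Grassmannian k | ∃ A, IsFace (k + 1) A ∧ S.1.1 = x A} =
      {S | ∃ A, IsFace (k + 1) A ∧ S.1.1 = y A} := by
    ext S
    exact hxy S.1.1
  rw [this]
  exact hq.isApartment h hy hqy
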